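/- Let $L>0$, $I_L=(0,L)$, and let $\|\cdot\|_m$ denote the usual norm of the Sobolev space $H^m(I_L)=H^m(I_L;\mathbf{R}^3)$. For $b\in\mathbf{R}^3$ consider the initial-boundary value problem for the vortex filament equation $$ v_t = v\times v_{ss}\ \ (s\in I_L,\ t>0),\qquad v(s,0)=v_0(s)\ \ (s\in I_L),\qquad v(0,t)=e_1,\ \ v(L,t)=b\ \ (t>0), \tag{P}$$ where $e_1=(1,0,0)$; solutions are understood in the class $C([0,\infty);H^3(I_L))\cap C^1([0,\infty);H^1(I_L))$. For $R>0$ put $v^R(s)=(\cos(s/R),-\sin(s/R),0)$ and $b=v^R(L)$. Call $\varphi_0\in H^3(I_L)$ admissible if $|v^R(s)+\varphi_0(s)|=1$ for $s\in I_L$ and $w:=v^R+\varphi_0$ satisfies the compatibility conditions $w(0)=e_1$, $w(L)=b$, and $w(0)\times w_{ss}(0)=w(L)\times w_{ss}(L)=0$. **Proposition.** Let $R>L/\pi$. Then $v^R$ is a stationary solution of (P) with initial datum $v^R$ and boundary datum $b=v^R(L)$, and it is Lyapunov stable in $H^3(I_L)$ in the following sense. There is a constant $C>0$ depending only on $L$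 and $R$ such that, for every admissible $\varphi_0\in H^3(I_L)$, the solution $v\in C([0,\infty);H^3(I_L))\cap C^1([0,\infty);H^1(I_L))$ of (P) with initial datum $v^R+\varphi_0$ and boundary datum $b=v^R(L)$ satisfies $$\|v(t)-v^R\|_3\le C\big(\|\varphi_0\|_3+\|\varphi_0\|_3^3\big)\qquad\text{for all } t\ge 0.$$ In particular, for every $\varepsilon>0$ there is $\delta>0$ such that $\|v(t)-v^R\|_3<\varepsilon$ for all $t\ge0$ whenever $\varphi_0$ is admissible and $\|\varphi_0\|_3<\delta$. -/

import Mathlib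

open MeasureTheory Set
open scoped ContDiff

noncomputable section

namespace VFE

/-- Euclidean three-space. -/
abbrev E3 : Type := EuclideanSpace ℝ (Fin 3)

/-- The vector product in Euclidean three-space. -/
def cross (a b : E3) : E3 := WithLp.toLp 2 (crossProduct (WithLp.ofLp a) (WithLp.ofLp b))

/-- Lebesgue measure on the interval `I_L = (0, L)`. -/
abbrev volI (L : ℝ) : Measure ℝ := volume.restrict (Ioo 0 L)

/-- The Hilbert space `L²(I_L)` of `ℝ³`-valued functions. -/
abbrev L2 (L : ℝ) : Type := Lp E3 2 (volI L)

/-- `g` is the derivative of `u` on `I_L` in the sense of distributions: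
`∫ η' u = - ∫ η g` for every test function `η ∈ C_c^∞(I_L)`. -/
def IsWeakDeriv (L : ℝ) (u g : L2 L) : Prop :=
  ∀ η : ℝ → ℝ, ContDiff ℝ ∞ η → HasCompactSupport η → tsupport η ⊆ Ioo 0 L →
    ∫ s in Ioo 0 L, deriv η s • u s = - ∫ s in Ioo 0 L, η s • g s

theorem integrable_test_smul {L : ℝ} (u : L2 L) {η : ℝ → ℝ} (h1 : Continuous η)
    (h2 : HasCompactSupport η) : Integrable (fun s => η s • u s) (volI L) := by
  have hu : Integrable u (volI L) := (Lp.memLp u).integrable (by norm_num)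
  obtain ⟨c, hc⟩ := h2.exists_bound_of_continuous h1
  exact hu.bdd_smul c h1.aestronglyMeasurable (Filter.Eventually.of_forall hc)

theorem IsWeakDeriv.zero (L : ℝ) : IsWeakDeriv L 0 0 := by
  intro η _ _ _
  have h0 : ((0 : L2 L) : ℝ → E3) =ᵐ[volI L] 0 := Lp.coeFn_zero _ _ _
  have e : ∀ θ : ℝ → ℝ, ∫ s in Ioo 0 L, θ s • (0 : L2 L) s = 0 := by
    intro θ
    refine integral_eq_zero_of_ae ?_
    filter_upwards [h0] with s hs
    rw [hs]
    simp
  rw [e, e, neg_zero]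

theorem IsWeakDeriv.add {L : ℝ} {u g u' g' : L2 L} (h : IsWeakDeriv L u g)
    (h' : IsWeakDeriv L u' g') : IsWeakDeriv L (u + u') (g + g') := by
  intro η h1 h2 h3
  have e : ∀ (θ : ℝ → ℝ) (a b : L2 L), Continuous θ → HasCompactSupport θ →
      ∫ s in Ioo 0 L, θ s • (a + b) s
        = (∫ s in Ioo 0 L, θ s • a s) + ∫ s in Ioo 0 L, θ s • b s := by
    intro θ a b ht ht'
    rw [← integral_add (integrable_test_smul a ht ht') (integrable_test_smul b ht ht')]
    refine integral_congr_ae ?_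
    filter_upwards [Lp.coeFn_add a b] with s hs
    rw [hs]
    simp
  rw [e _ _ _ (h1.continuous_deriv (by simp)) h2.deriv, e _ _ _ h1.continuous h2,
    h η h1 h2 h3, h' η h1 h2 h3, neg_add]

theorem IsWeakDeriv.smul {L : ℝ} {u g : L2 L} (c : ℝ) (h : IsWeakDeriv L u g) :
    IsWeakDeriv L (c • u) (c • g) := by
  intro η h1 h2 h3
  have e : ∀ (θ : ℝ → ℝ) (a : L2 L),
      ∫ s in Ioo 0 L, θ s • (c • a) s = c • ∫ s in Ioo 0 L, θ s • a s := by
    intro θ a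
    rw [← integral_smul]
    refine integral_congr_ae ?_
    filter_upwards [Lp.coeFn_smul c a] with s hs
    simp [hs, smul_comm c]
  rw [e, e, h η h1 h2 h3, smul_neg]

/-- The Sobolev space `H^m(I_L)` of `ℝ³`-valued functions. An element is recorded as the family
`(u, D u, …, D^m u)` of its distributional derivatives, all of them in `L²(I_L)`; since these are
determined by `u`, this is the usual space. As a subspace of the Hilbert sum of `m + 1` copies of
`L²(I_L)` it carries the usual norm `‖u‖_m = (∑_{k ≤ m} ‖D^k u‖²)^{1/2}`. -/
def sobolev (L : ℝ) (m : ℕ) : Submodule ℝ (PiLp 2 (fun _ : Fin (m + 1) => L2 L)) where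
  carrier := {u | ∀ k : Fin m, IsWeakDeriv L (u k.castSucc) (u k.succ)}
  add_mem' h h' k := (h k).add (h' k)
  zero_mem' _ := IsWeakDeriv.zero L
  smul_mem' c _ h k := (h k).smul c

/-- `H^m(I_L)` as a normed space. -/
abbrev H (L : ℝ) (m : ℕ) : Type := sobolev L m

/-- The `k`-th derivative `D^k u ∈ L²(I_L)` of `u ∈ H^m(I_L)`, `k ≤ m`. -/
def D {L : ℝ} {m : ℕ} (k : Fin (m + 1)) (u : H L m) : L2 L := u.1 k

/-- The inclusion of `H^3(I_L)` in `H^1(I_L)`. -/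
def toH1 {L : ℝ} (u : H L 3) : H L 1 :=
  ⟨WithLp.toLp 2 ![D 0 u, D 1 u], fun k => by
    have hk : k = 0 := Subsingleton.elim _ _
    subst hk
    exact u.2 0⟩

/-- `f` is the representative of `g ∈ L²(I_L)` that is continuous on `[0, L]`. It is unique on
`[0, L]` when `L > 0`, and it exists for `g = D^k u` with `u ∈ H^m(I_L)`, `k < m`; boundary values
are read off from it. -/
def IsContRep (L : ℝ) (g : L2 L) (f : ℝ → E3) : Prop :=
  ContinuousOn f (Icc 0 L) ∧ g =ᵐ[volI L] f

/-- The boundary value of `u` is `a` at `s = 0` and `b` at `s = L`. -/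
def HasBoundaryValues (L : ℝ) (g : L2 L) (a b : E3) : Prop :=
  ∃ f : ℝ → E3, IsContRep L g f ∧ f 0 = a ∧ f L = b

/-- The first basis vector. -/
def e₁ : E3 := !₂[1, 0, 0]

/-- The compatibility condition of order `0` : `v₀(0) = e₁` and `v₀(L) = b`. -/
def Compat0 (L : ℝ) (b : E3) (v₀ : H L 3) : Prop := HasBoundaryValues L (D 0 v₀) e₁ b

/-- The compatibility condition of order `1` : `v₀ × D² v₀ = 0` at `s = 0` and at `s = L`. -/
def Compat1 (L : ℝ) (v₀ : H L 3) : Prop :=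
  ∃ f h : ℝ → E3, IsContRep L (D 0 v₀) f ∧ IsContRep L (D 2 v₀) h ∧
    cross (f 0) (h 0) = 0 ∧ cross (f L) (h L) = 0

/-- `v ∈ C([0,∞); H^3(I_L)) ∩ C^1([0,∞); H^1(I_L))` is a solution of the problem
`v_t = v × v_ss` for `s ∈ I_L`, `t > 0`, with `v(·,0) = v₀` and, for `t > 0`,
`v(0,t) = e₁`, `v(L,t) = b`. -/
structure IsSolution (L : ℝ) (b : E3) (v₀ : H L 3) (v : ℝ → H L 3) : Prop where
  continuousOn : ContinuousOn v (Ici 0)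
  equation : ∃ vt : ℝ → H L 1, ContinuousOn vt (Ici 0) ∧
    (∀ t, 0 ≤ t → HasDerivWithinAt (fun τ => toH1 (v τ)) (vt t) (Ici 0) t) ∧
    ∀ t, 0 < t → ∀ᵐ s ∂(volI L), D 0 (vt t) s = cross (D 0 (v t) s) (D 2 (v t) s)
  initial : v 0 = v₀
  boundary : ∀ t, 0 < t → HasBoundaryValues L (D 0 (v t)) e₁ b

theorem memLp_of_continuous (L : ℝ) {f : ℝ → E3} (hf : Continuous f) : MemLp f 2 (volI L) := by
  obtain ⟨c, hc⟩ := isCompact_Icc.exists_bound_of_continuousOn (hf.continuousOn (s := Icc 0 L))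
  refine MemLp.of_bound hf.aestronglyMeasurable c ?_
  filter_upwards [ae_restrict_mem measurableSet_Ioo] with s hs
  exact hc s (Ioo_subset_Icc_self hs)

theorem isWeakDeriv_of_hasDerivAt (L : ℝ) {f f' : ℝ → E3} (hf : Continuous f)
    (hf' : Continuous f') (hd : ∀ s, HasDerivAt f (f' s) s) :
    IsWeakDeriv L ((memLp_of_continuous L hf).toLp f) ((memLp_of_continuous L hf').toLp f') := by
  intro η h1 h2 h3
  have e : ∀ (θ : ℝ → ℝ) (g : ℝ → E3) (hg : MemLp g 2 (volI L)),
      ∫ s in Ioo 0 L, θ s • hg.toLp g s = ∫ s in Ioo 0 L, θ s • g s := by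
    intro θ g hg
    refine integral_congr_ae ?_
    filter_upwards [hg.coeFn_toLp] with s hs
    rw [hs]
  rw [e, e]
  have hη : ∀ s, HasDerivAt η (deriv η s) s := fun s =>
    ((h1.differentiable (by simp)) s).hasDerivAt
  have hηc : Continuous (deriv η) := h1.continuous_deriv (by simp)
  have z : ∀ s, s ∉ Ioo 0 L → η s = 0 := fun s hs => by
    by_contra hne
    exact hs (h3 (subset_tsupport _ hne))
  have z' : ∀ s, s ∉ Ioo 0 L → deriv η s = 0 := fun s hs => by
    by_contra hne
    exact hs (h3 (tsupport_deriv_subset (f := η) (subset_tsupport _ hne)))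
  rw [setIntegral_eq_integral_of_forall_compl_eq_zero (fun s hs => by simp [z' s hs]),
    setIntegral_eq_integral_of_forall_compl_eq_zero (fun s hs => by simp [z s hs])]
  have i1 : Integrable (fun s => η s • f' s) :=
    (h1.continuous.smul hf').integrable_of_hasCompactSupport h2.smul_right
  have i2 : Integrable (fun s => deriv η s • f s) :=
    (hηc.smul hf).integrable_of_hasCompactSupport h2.deriv.smul_right
  have k : ∫ s, (η s • f' s + deriv η s • f s) = 0 :=
    integral_eq_zero_of_hasDerivAt_of_integrable (f := fun s => η s • f s)
      (fun s => (hη s).smul (hd s)) (i1.add i2)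
      ((h1.continuous.smul hf).integrable_of_hasCompactSupport h2.smul_right)
  rw [integral_add i1 i2] at k
  exact eq_neg_of_add_eq_zero_right k

/-- A smooth function on the line, restricted to `I_L`, as an element of `H^m(I_L)`. -/
def ofSmooth (L : ℝ) (m : ℕ) (f : ℝ → E3) (hf : ContDiff ℝ ∞ f) : H L m :=
  ⟨WithLp.toLp 2 fun k : Fin (m + 1) =>
      (memLp_of_continuous L (hf.continuous_iteratedDeriv (k : ℕ) (by exact_mod_cast le_top))).toLp
        (iteratedDeriv (k : ℕ) f), fun k => by
    refine isWeakDeriv_of_hasDerivAt L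
      (hf.continuous_iteratedDeriv (k : ℕ) (by exact_mod_cast le_top))
      (hf.continuous_iteratedDeriv ((k : ℕ) + 1) (by exact_mod_cast le_top)) fun s => ?_
    rw [iteratedDeriv_succ]
    exact ((hf.differentiable_iteratedDeriv (k : ℕ)
      (by exact_mod_cast WithTop.coe_lt_top _)) s).hasDerivAt⟩

/-- The arc `s ↦ (cos (s/R), - sin (s/R), 0)`. -/
def arc (R s : ℝ) : E3 := !₂[Real.cos (s / R), - Real.sin (s / R), 0]

theorem contDiff_arc (R : ℝ) : ContDiff ℝ ∞ (arc R) := by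
  rw [contDiff_euclidean]
  intro i
  fin_cases i <;> simp [arc] <;> fun_prop

/-- The arc as an element of `H^3(I_L)`. -/
def vR (L R : ℝ) : H L 3 := ofSmooth L 3 (arc R) (contDiff_arc R)

/-- The admissible initial perturbations of the arc: `v^R + φ₀` takes values in the unit sphere and
satisfies, together with `b = v^R(L)`, the compatibility conditions up to order `1`. -/
structure Admissible (L R : ℝ) (φ₀ : H L 3) : Prop where
  unit : ∀ᵐ s ∂(volI L), ‖D 0 (vR L R + φ₀) s‖ = 1
  compat0 : Compat0 L (arc R L) (vR L R + φ₀)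
  compat1 : Compat1 L (vR L R + φ₀)

end VFE

end

noncomputable section

namespace VFE

/-! Write `U = v × v_ss`, `φ = v - v^R` and `κ = R⁻²`. Since `v · v_t = 0`, the solution stays on
the sphere, and since its end values are fixed, `U = v_t` vanishes at both ends for `t > 0`. Three
integrals are then constant in time: `∫ |v_s|²`, `∫ |v_ss|² - (5/4) ∫ |v_s|⁴` and `∫ |U_s|² - (5/2)
∫ |v_s|² |v_ss|² + (21/8) ∫ |v_s|⁶`. Modulo the relations obtained by differentiating `|v|² = 1`,
their time derivatives are integrals of `s`-derivatives of quantities containing a factor `U`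
(`second_law_identity`, `third_law_identity`).

These laws control `φ` one derivative at a time. Because `v^R_ss = -κ v^R` and `|v| = |v^R| = 1`,
the function `ρ = |v_s|² - κ` satisfies `∫ ρ = ‖φ_s‖² - κ ‖φ‖²`. As `φ` vanishes at the ends and `R
> L/π`, `poincare` makes this form coercive, so the first law bounds `φ_s`. From `|v_ss|² = |U|² +
|v_s|⁴` the second law becomes conservation of `∫ |U|² - (1/4) ∫ ρ²`; since `|φ_ss + κ φ|² = |U|² +
ρ²`, and Agmon's inequality makes `∫ ρ²` of lower order, it bounds `φ_ss`. The third law bounds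
`U_s` in the same manner, hence `φ_sss`. No smallness is needed. The cubic growth comes from `|φ| ≤
2` and interpolation, by which `‖φ_s‖²` is bounded linearly, and not only quadratically, by the
initial norm (`exists_staticBounds`, `energy_le_of_conserved`).

The regularity makes `v_s`, but not obviously `v_ss`, differentiable in time with values in `L²`.
Each increment of an energy is therefore integrated by parts in `s` into a scalar product of the
increment of `v_s` with a field continuous in time (`hasDerivAt_of_inner_increment`). For `‖U_s‖²`
the same idea is applied to difference quotients in time, with a locally uniform limit
(`IsFlow.hasDerivAt_norm_sq_velocity`). All laws are used at positive times only; the initial time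
is reached by continuity. -/

/-- The Euclidean scalar product, written in coordinates. -/
def dot (x y : E3) : ℝ := x 0 * y 0 + x 1 * y 1 + x 2 * y 2

theorem inner_eq_dot (x y : E3) : inner ℝ x y = dot x y := by
  simp [PiLp.inner_apply, Fin.sum_univ_three, dot]; ring

theorem dot_self (x : E3) : dot x x = ‖x‖ ^ 2 := by
  rw [← inner_eq_dot, real_inner_self_eq_norm_sq]

@[simp] theorem cross_apply_zero (x y : E3) : cross x y 0 = x 1 * y 2 - x 2 * y 1 := by
  simp [cross, cross_apply]

@[simp] theorem cross_apply_one (x y : E3) : cross x y 1 = x 2 * y 0 - x 0 * y 2 := by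
  simp [cross, cross_apply]

@[simp] theorem cross_apply_two (x y : E3) : cross x y 2 = x 0 * y 1 - x 1 * y 0 := by
  simp [cross, cross_apply]

theorem ext3 {x y : E3} (h0 : x 0 = y 0) (h1 : x 1 = y 1) (h2 : x 2 = y 2) : x = y := by
  ext i
  fin_cases i <;> assumption

/-! ### Calculus of absolutely continuous functions. -/

/-- `f` is absolutely continuous on `[0, L]` and `f'` is its almost everywhere derivative. -/
def IsPrim (L : ℝ) (f f' : ℝ → ℝ) : Prop :=
  AbsolutelyContinuousOnInterval f 0 L ∧ ∀ᵐ s ∂(volI L), HasDerivAt f (f' s) s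

namespace IsPrim

variable {L : ℝ} {f f' g g' : ℝ → ℝ}

theorem continuousOn (hL : 0 < L) (h : IsPrim L f f') : ContinuousOn f (Icc 0 L) := by
  have := h.1.continuousOn
  rwa [uIcc_of_le hL.le] at this

theorem add (h : IsPrim L f f') (k : IsPrim L g g') :
    IsPrim L (fun s => f s + g s) (fun s => f' s + g' s) := by
  refine ⟨h.1.add k.1, ?_⟩
  filter_upwards [h.2, k.2] with s hs ks using hs.add ks

theorem sub (h : IsPrim L f f') (k : IsPrim L g g') :
    IsPrim L (fun s => f s - g s) (fun s => f' s - g' s) := by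
  refine ⟨h.1.sub k.1, ?_⟩
  filter_upwards [h.2, k.2] with s hs ks using hs.sub ks

theorem mul (h : IsPrim L f f') (k : IsPrim L g g') :
    IsPrim L (fun s => f s * g s) (fun s => f' s * g s + f s * g' s) := by
  refine ⟨h.1.mul k.1, ?_⟩
  filter_upwards [h.2, k.2] with s hs ks using hs.mul ks

theorem const_mul (c : ℝ) (h : IsPrim L f f') :
    IsPrim L (fun s => c * f s) (fun s => c * f' s) := by
  refine ⟨h.1.const_mul c, ?_⟩
  filter_upwards [h.2] with s hs using hs.const_mul c

theorem congr_deriv (h : IsPrim L f f') (e : f' =ᵐ[volI L] g') : IsPrim L f g' := by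
  refine ⟨h.1, ?_⟩
  filter_upwards [h.2, e] with s hs es
  rwa [← es]

theorem of_contDiff (hf : ContDiff ℝ 1 f) (hd : ∀ s, HasDerivAt f (f' s) s) : IsPrim L f f' :=
  ⟨hf.contDiffOn.absolutelyContinuousOnInterval, Filter.Eventually.of_forall hd⟩

theorem of_integral (hL : 0 < L) (c : ℝ) (hg : IntegrableOn g (Ioo 0 L)) :
    IsPrim L (fun s => c + ∫ x in (0 : ℝ)..s, g x) g := by
  have hi : IntervalIntegrable g volume 0 L := by
    rw [intervalIntegrable_iff_integrableOn_Ioo_of_le hL.le]; exact hg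
  refine ⟨(of_contDiff (f := fun _ => c) (f' := fun _ => 0) contDiff_const
    fun s => hasDerivAt_const s c).1.add
    (hi.absolutelyContinuousOnInterval_intervalIntegral (by simp)), ?_⟩
  rw [ae_restrict_iff' measurableSet_Ioo]
  filter_upwards [hi.ae_hasDerivAt_integral] with s hs hs'
  have := hs (by rw [uIcc_of_le hL.le]; exact Ioo_subset_Icc_self hs') 0 (by simp)
  simpa using this.const_add c

theorem ae_eq_deriv (h : IsPrim L f f') : f' =ᵐ[volI L] deriv f := by
  filter_upwards [h.2] with s hs using hs.deriv.symm

theorem integrableOn (hL : 0 < L) (h : IsPrim L f f') : IntegrableOn f' (Ioo 0 L) := by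
  have := h.1.intervalIntegrable_deriv
  rw [intervalIntegrable_iff_integrableOn_Ioo_of_le hL.le] at this
  exact Integrable.congr this h.ae_eq_deriv.symm

theorem integral_eq (hL : 0 < L) (h : IsPrim L f f') : ∫ s in Ioo 0 L, f' s = f L - f 0 := by
  rw [← h.1.integral_deriv_eq_sub, intervalIntegral.integral_of_le hL.le,
    ← integral_Ioc_eq_integral_Ioo, integral_Ioc_eq_integral_Ioo, integral_Ioc_eq_integral_Ioo]
  exact integral_congr_ae h.ae_eq_deriv

theorem congr_fun (h : IsPrim L f f') (hL : 0 < L) (e : EqOn f g (Icc 0 L)) : IsPrim L g f' := by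
  refine ⟨?_, ?_⟩
  · have h1 := h.1
    rw [absolutelyContinuousOnInterval_iff] at h1 ⊢
    intro ε hε
    obtain ⟨δ, hδ, H⟩ := h1 ε hε
    refine ⟨δ, hδ, fun E hE hE' => ?_⟩
    convert H E hE hE' using 1
    refine Finset.sum_congr rfl fun i hi => ?_
    have := hE.1 i hi
    rw [uIcc_of_le hL.le] at this
    rw [e this.1, e this.2]
  · filter_upwards [h.2, ae_restrict_mem measurableSet_Ioo] with s hs hm
    refine hs.congr_of_eventuallyEq ?_
    filter_upwards [Ioo_mem_nhds hm.1 hm.2] with x hx using (e (Ioo_subset_Icc_self hx)).symm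

theorem deriv_unique (h : IsPrim L f f') (k : IsPrim L f g') : f' =ᵐ[volI L] g' := by
  filter_upwards [h.2, k.2] with s hs ks using hs.unique ks

end IsPrim

theorem eqOn_Icc_of_ae_eq {X : Type*} [TopologicalSpace X] [T2Space X] {L : ℝ} (hL : 0 < L)
    {f g : ℝ → X} (hf : ContinuousOn f (Icc 0 L)) (hg : ContinuousOn g (Icc 0 L))
    (h : f =ᵐ[volI L] g) : EqOn f g (Icc 0 L) := by
  refine Measure.eqOn_Icc_of_ae_eq volume hL.ne ?_ hf hg
  rwa [volI, Measure.restrict_congr_set Ioo_ae_eq_Icc] at h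

/-- The componentwise version of `IsPrim` for functions with values in three-space. -/
def IsPrimV (L : ℝ) (f f' : ℝ → E3) : Prop := ∀ i, IsPrim L (fun s => f s i) (fun s => f' s i)

namespace IsPrimV

variable {L : ℝ} {f f' g g' : ℝ → E3}

theorem continuousOn (hL : 0 < L) (h : IsPrimV L f f') : ContinuousOn f (Icc 0 L) := by
  have h1 : ContinuousOn (fun s => WithLp.ofLp (f s)) (Icc 0 L) :=
    continuousOn_pi.2 fun i => (h i).continuousOn hL
  exact (PiLp.continuous_toLp 2 _).comp_continuousOn h1

theorem add (h : IsPrimV L f f') (k : IsPrimV L g g') :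
    IsPrimV L (fun s => f s + g s) (fun s => f' s + g' s) := fun i => (h i).add (k i)

theorem sub (h : IsPrimV L f f') (k : IsPrimV L g g') :
    IsPrimV L (fun s => f s - g s) (fun s => f' s - g' s) := fun i => (h i).sub (k i)

theorem const_smul (c : ℝ) (h : IsPrimV L f f') :
    IsPrimV L (fun s => c • f s) (fun s => c • f' s) := fun i => (h i).const_mul c

theorem dot (h : IsPrimV L f f') (k : IsPrimV L g g') :
    IsPrim L (fun s => dot (f s) (g s)) (fun s => VFE.dot (f' s) (g s) + VFE.dot (f s) (g' s)) := by
  refine ((((h 0).mul (k 0)).add ((h 1).mul (k 1))).add ((h 2).mul (k 2))).congr_deriv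
    (Filter.Eventually.of_forall fun s => ?_)
  simp only [VFE.dot]; ring

theorem cross (h : IsPrimV L f f') (k : IsPrimV L g g') :
    IsPrimV L (fun s => cross (f s) (g s))
      (fun s => VFE.cross (f' s) (g s) + VFE.cross (f s) (g' s)) := by
  intro i
  fin_cases i
  · simpa using (((h 1).mul (k 2)).sub ((h 2).mul (k 1))).congr_deriv
      (Filter.Eventually.of_forall fun s => by simp; ring)
  · simpa using (((h 2).mul (k 0)).sub ((h 0).mul (k 2))).congr_deriv
      (Filter.Eventually.of_forall fun s => by simp; ring)
  · simpa using (((h 0).mul (k 1)).sub ((h 1).mul (k 0))).congr_deriv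
      (Filter.Eventually.of_forall fun s => by simp; ring)

theorem congr_deriv (h : IsPrimV L f f') (e : f' =ᵐ[volI L] g') : IsPrimV L f g' := fun i =>
  (h i).congr_deriv (by filter_upwards [e] with s hs; rw [hs])

theorem congr_fun (h : IsPrimV L f f') (hL : 0 < L) (e : EqOn f g (Icc 0 L)) : IsPrimV L g f' :=
  fun i => (h i).congr_fun hL fun s hs => by simp only [e hs]

theorem deriv_unique (h : IsPrimV L f f') (k : IsPrimV L f g') : f' =ᵐ[volI L] g' := by
  filter_upwards [(h 0).deriv_unique (k 0), (h 1).deriv_unique (k 1), (h 2).deriv_unique (k 2)]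
    with s h0 h1 h2 using ext3 h0 h1 h2

theorem of_contDiff (hf : ContDiff ℝ 1 f) (hd : ∀ s, HasDerivAt f (f' s) s) : IsPrimV L f f' := by
  intro i
  refine IsPrim.of_contDiff ?_ fun s => ?_
  · exact (contDiff_euclidean.1 hf) i
  · exact (EuclideanSpace.proj (𝕜 := ℝ) i : E3 →L[ℝ] ℝ).hasFDerivAt.comp_hasDerivAt s (hd s)

end IsPrimV

/-! ### From weak derivatives to absolutely continuous representatives. -/

/-- A smooth function with compact support in `(0, L)` and vanishing integral has a primitive which
is a test function on `(0, L)`. -/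
theorem exists_test_primitive {L : ℝ} {θ : ℝ → ℝ} (h1 : ContDiff ℝ ∞ θ)
    (h2 : HasCompactSupport θ) (h3 : tsupport θ ⊆ Ioo 0 L) (h0 : ∫ s in Ioo 0 L, θ s = 0) :
    ∃ η : ℝ → ℝ, ContDiff ℝ ∞ η ∧ HasCompactSupport η ∧ tsupport η ⊆ Ioo 0 L ∧ deriv η = θ := by
  rcases (tsupport θ).eq_empty_or_nonempty with he | hne
  · refine ⟨θ, h1, h2, h3, ?_⟩
    have : θ = 0 := tsupport_eq_empty_iff.1 he
    rw [this]; ext s; simp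
  have hK : IsCompact (tsupport θ) := h2
  obtain ⟨a, ha, hamin⟩ := hK.exists_isLeast hne
  obtain ⟨b, hb, hbmax⟩ := hK.exists_isGreatest hne
  have hz : ∀ s, s ∉ Icc a b → θ s = 0 := fun s hs => by
    by_contra hn
    have := subset_tsupport _ hn
    exact hs ⟨hamin this, hbmax this⟩
  have hd : ∀ s, HasDerivAt (fun s => ∫ x in (0 : ℝ)..s, θ x) (θ s) s := fun s =>
    intervalIntegral.integral_hasDerivAt_right (h1.continuous.intervalIntegrable _ _)
      (h1.continuous.stronglyMeasurableAtFilter _ _) h1.continuous.continuousAt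
  have hder : deriv (fun s => ∫ x in (0 : ℝ)..s, θ x) = θ := funext fun s => (hd s).deriv
  have hL : 0 ≤ L := ((h3 ha).1.trans (h3 ha).2).le
  have hint : ∫ x in (0 : ℝ)..L, θ x = 0 := by
    rw [intervalIntegral.integral_of_le hL, integral_Ioc_eq_integral_Ioo, h0]
  have hzero : ∀ s, s ∉ Icc a b → ∫ x in (0 : ℝ)..s, θ x = 0 := by
    intro s hs
    rcases lt_or_ge s a with hsa | hsa
    · refine (intervalIntegral.integral_congr (g := fun _ => 0) fun x hx => ?_).trans (by simp)
      refine hz x fun hx' => ?_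
      have : x ≤ max 0 s := hx.2
      rcases le_max_iff.1 this with h | h
      · exact absurd (h3 ha).1 (by linarith [hx'.1])
      · linarith [hx'.1]
    -- Right of the support the primitive has already collected the whole integral of `θ`; here the
    -- vanishing mean is needed.
    · have hsb : b < s := by
        by_contra h
        exact hs ⟨hsa, not_lt.1 h⟩
      rw [← intervalIntegral.integral_add_adjacent_intervals (b := L)
        (h1.continuous.intervalIntegrable _ _) (h1.continuous.intervalIntegrable _ _), hint, zero_add]
      refine (intervalIntegral.integral_congr (g := fun _ => 0) fun x hx => ?_).trans (by simp)
      refine hz x fun hx' => ?_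
      have : min L s ≤ x := hx.1
      rcases min_le_iff.1 this with h | h
      · exact absurd (h3 hb).2 (by linarith [hx'.2])
      · linarith [hx'.2]
  have hsupp : tsupport (fun s => ∫ x in (0 : ℝ)..s, θ x) ⊆ Icc a b := by
    refine closure_minimal (fun s hs => ?_) isClosed_Icc
    by_contra hn
    exact hs (hzero s hn)
  refine ⟨fun s => ∫ x in (0 : ℝ)..s, θ x, ?_, ?_, ?_, hder⟩
  · rw [contDiff_infty_iff_deriv, hder]
    exact ⟨fun s => (hd s).differentiableAt, h1⟩
  · exact isCompact_Icc.of_isClosed_subset (isClosed_tsupport _) hsupp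
  · exact hsupp.trans fun s hs => ⟨(h3 ha).1.trans_le hs.1, hs.2.trans_lt (h3 hb).2⟩

/-- The lemma of du Bois-Reymond. -/
theorem ae_eq_const_of_integral_deriv_mul {L : ℝ} (hL : 0 < L) {w : ℝ → ℝ}
    (hw : IntegrableOn w (Ioo 0 L))
    (h : ∀ η : ℝ → ℝ, ContDiff ℝ ∞ η → HasCompactSupport η → tsupport η ⊆ Ioo 0 L →
      ∫ s in Ioo 0 L, deriv η s * w s = 0) : ∃ c : ℝ, ∀ᵐ s ∂(volI L), w s = c := by
  obtain ⟨χ, hχ3, hχ2, hχ1, hχr, hχ0⟩ := exists_contDiff_tsupport_subset (n := ⊤)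
    (Ioo_mem_nhds (half_pos hL) (half_lt_self hL))
  have hnn : 0 ≤ χ := fun s => (hχr ⟨s, rfl⟩).1
  have hχc : Continuous χ := hχ1.continuous
  have hI : ∀ θ : ℝ → ℝ, tsupport θ ⊆ Ioo 0 L → ∫ s in Ioo 0 L, θ s = ∫ s, θ s := fun θ hθ =>
    setIntegral_eq_integral_of_forall_compl_eq_zero fun s hs => by
      by_contra hn
      exact hs (hθ (subset_tsupport _ hn))
  have hpos : 0 < ∫ s in Ioo 0 L, χ s := by
    rw [hI χ hχ3]
    exact hχc.integral_pos_of_hasCompactSupport_nonneg_nonzero hχ2 hnn (x := L / 2)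
      (by rw [hχ0]; exact one_ne_zero)
  set m := ∫ s in Ioo 0 L, χ s with hm
  -- Testing `w = c` against `χ` forces this value.
  set c := m⁻¹ * ∫ s in Ioo 0 L, χ s * w s with hc
  refine ⟨c, ?_⟩
  have hmulint : ∀ θ : ℝ → ℝ, Continuous θ → HasCompactSupport θ →
      IntegrableOn (fun s => θ s * w s) (Ioo 0 L) := fun θ hθ hθ' => by
    obtain ⟨C, hC⟩ := hθ'.exists_bound_of_continuous hθ
    exact hw.bdd_mul (c := C) hθ.aestronglyMeasurable (Filter.Eventually.of_forall hC)
  have key : ∀ᵐ s ∂(volume : Measure ℝ), s ∈ Ioo 0 L → w s - c = 0 := by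
    refine isOpen_Ioo.ae_eq_zero_of_integral_contDiff_smul_eq_zero
      (hw.sub (integrableOn_const (by simp))).locallyIntegrableOn fun θ h1 h2 h3 => ?_
    have hθi : IntegrableOn θ (Ioo 0 L) := (h1.continuous.integrable_of_hasCompactSupport h2).integrableOn
    have hχi : IntegrableOn χ (Ioo 0 L) := (hχc.integrable_of_hasCompactSupport hχ2).integrableOn
    -- Subtracting `k χ` gives an arbitrary `θ` mean zero, so that the difference is the derivative
    -- of a test function and the hypothesis applies.
    set k := m⁻¹ * ∫ s in Ioo 0 L, θ s with hk
    have e1 : ContDiff ℝ ∞ (fun s => θ s - k * χ s) := h1.sub (contDiff_const.mul hχ1)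
    have e2 : HasCompactSupport (fun s => θ s - k * χ s) := h2.sub hχ2.mul_left
    have e3 : tsupport (fun s => θ s - k * χ s) ⊆ Ioo 0 L :=
      (tsupport_sub _ _).trans (union_subset h3 ((tsupport_mul_subset_right).trans hχ3))
    have e0 : ∫ s in Ioo 0 L, (θ s - k * χ s) = 0 := by
      rw [integral_sub hθi (hχi.const_mul k), integral_const_mul, ← hm, hk]
      field_simp
      ring
    obtain ⟨η, a1, a2, a3, a4⟩ := exists_test_primitive e1 e2 e3 e0
    have := h η a1 a2 a3
    rw [a4] at this
    have t1 := hmulint θ h1.continuous h2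
    have t2 := hmulint χ hχc hχ2
    have e5 : ∫ s in Ioo 0 L, (θ s - k * χ s) * w s
        = (∫ s in Ioo 0 L, θ s * w s) - k * ∫ s in Ioo 0 L, χ s * w s := by
      rw [← integral_const_mul, ← integral_sub t1 (t2.const_mul k)]
      congr 1; ext s; ring
    rw [e5] at this
    have e6 : tsupport (fun s => θ s • (w s - c)) ⊆ Ioo 0 L := (tsupport_smul_subset_left _ _).trans h3
    rw [← hI _ e6]
    have e7 : ∫ s in Ioo 0 L, θ s • (w s - c)
        = (∫ s in Ioo 0 L, θ s * w s) - c * ∫ s in Ioo 0 L, θ s := by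
      rw [← integral_const_mul, ← integral_sub t1 (hθi.const_mul c)]
      congr 1; ext s; simp only [smul_eq_mul]; ring
    rw [e7, hc]
    rw [hk] at this
    linarith
  rw [ae_restrict_iff' measurableSet_Ioo]
  filter_upwards [key] with s hs hs' using sub_eq_zero.1 (hs hs')

/-- An integrable function with an integrable weak derivative is a primitive of the latter. -/
theorem exists_isPrim_of_weak {L : ℝ} (hL : 0 < L) {u g : ℝ → ℝ} (hu : IntegrableOn u (Ioo 0 L))
    (hg : IntegrableOn g (Ioo 0 L))
    (h : ∀ η : ℝ → ℝ, ContDiff ℝ ∞ η → HasCompactSupport η → tsupport η ⊆ Ioo 0 L →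
      ∫ s in Ioo 0 L, deriv η s * u s = - ∫ s in Ioo 0 L, η s * g s) :
    ∃ f : ℝ → ℝ, IsPrim L f g ∧ u =ᵐ[volI L] f := by
  have hG := IsPrim.of_integral hL 0 hg
  have hGc := hG.continuousOn hL
  have hGi : IntegrableOn (fun s => 0 + ∫ x in (0 : ℝ)..s, g x) (Ioo 0 L) :=
    (hGc.integrableOn_Icc).mono_set Ioo_subset_Icc_self
  -- The indefinite integral of `g` has the same weak derivative as `u`, so their difference is
  -- constant.
  obtain ⟨c, hc⟩ := ae_eq_const_of_integral_deriv_mul hL (hu.sub hGi) fun η h1 h2 h3 => by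
    have hη : IsPrim L η (deriv η) := IsPrim.of_contDiff (h1.of_le (by simp)) fun s =>
      ((h1.differentiable (by simp)) s).hasDerivAt
    have z : ∀ s, s ∉ Ioo 0 L → η s = 0 := fun s hs => by
      by_contra hne
      exact hs (h3 (subset_tsupport _ hne))
    have e := (hη.mul hG).integral_eq hL
    rw [z L (by simp), z 0 (by simp), zero_mul, zero_mul, sub_zero] at e
    have hb : ∀ θ v : ℝ → ℝ, Continuous θ → HasCompactSupport θ → IntegrableOn v (Ioo 0 L) →
        IntegrableOn (fun s => θ s * v s) (Ioo 0 L) := fun θ v hθ hθ' hv => by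
      obtain ⟨C, hC⟩ := hθ'.exists_bound_of_continuous hθ
      exact hv.bdd_mul (c := C) hθ.aestronglyMeasurable (Filter.Eventually.of_forall hC)
    have hηc : Continuous (deriv η) := h1.continuous_deriv (by simp)
    have i1 := hb _ _ hηc h2.deriv hGi
    have i2 := hb _ _ h1.continuous h2 hg
    rw [integral_add i1 i2] at e
    have i3 := hb _ _ hηc h2.deriv hu
    have := h η h1 h2 h3
    calc ∫ s in Ioo 0 L, deriv η s * (u - fun s => 0 + ∫ x in (0 : ℝ)..s, g x) s
        = ∫ s in Ioo 0 L, (deriv η s * u s - deriv η s * (0 + ∫ x in (0 : ℝ)..s, g x)) := by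
          congr 1; ext s; simp only [Pi.sub_apply]; ring
      _ = 0 := by rw [integral_sub i3 i1]; linarith
  refine ⟨fun s => c + ∫ x in (0 : ℝ)..s, g x, IsPrim.of_integral hL c hg, ?_⟩
  filter_upwards [hc] with s hs
  simp only [Pi.sub_apply] at hs
  linarith

theorem integrable_coe {L : ℝ} (u : L2 L) : IntegrableOn u (Ioo 0 L) :=
  (Lp.memLp u).integrable (by norm_num)

theorem IsWeakDeriv.exists_isPrimV {L : ℝ} (hL : 0 < L) {u g : L2 L} (h : IsWeakDeriv L u g) :
    ∃ f : ℝ → E3, IsPrimV L f g ∧ u =ᵐ[volI L] f := by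
  have comp : ∀ (i : Fin 3) (θ : ℝ → ℝ) (w : L2 L), Continuous θ → HasCompactSupport θ →
      (∫ s in Ioo 0 L, θ s • w s) i = ∫ s in Ioo 0 L, θ s * w s i := fun i θ w h1 h2 => by
    have := (EuclideanSpace.proj (𝕜 := ℝ) i : E3 →L[ℝ] ℝ).integral_comp_comm
      (integrable_test_smul w h1 h2)
    simpa using this.symm
  have key : ∀ i : Fin 3, ∃ f : ℝ → ℝ, IsPrim L f (fun s => g s i) ∧
      (fun s => u s i) =ᵐ[volI L] f := fun i => by
    refine exists_isPrim_of_weak hL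
      ((EuclideanSpace.proj (𝕜 := ℝ) i : E3 →L[ℝ] ℝ).integrable_comp (integrable_coe u))
      ((EuclideanSpace.proj (𝕜 := ℝ) i : E3 →L[ℝ] ℝ).integrable_comp (integrable_coe g))
      fun η h1 h2 h3 => ?_
    have := congrArg (fun x : E3 => x i) (h η h1 h2 h3)
    simp only [PiLp.neg_apply] at this
    rwa [comp i _ u (h1.continuous_deriv (by simp)) h2.deriv, comp i _ g h1.continuous h2] at this
  choose f hf hf' using key
  refine ⟨fun s => WithLp.toLp 2 fun i => f i s, fun i => hf i, ?_⟩
  filter_upwards [hf' 0, hf' 1, hf' 2] with s h0 h1 h2 using ext3 h0 h1 h2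

/-! ### Pointwise algebra for `v` and its derivatives `p`, `n`, `j` on the sphere. -/

section Algebra

theorem dot_comm (x y : E3) : dot x y = dot y x := by simp only [dot]; ring

theorem dot_add (x y z : E3) : dot x (y + z) = dot x y + dot x z := by
  simp only [dot, PiLp.add_apply]; ring

theorem add_dot (x y z : E3) : dot (x + y) z = dot x z + dot y z := by
  simp only [dot, PiLp.add_apply]; ring

theorem dot_sub (x y z : E3) : dot x (y - z) = dot x y - dot x z := by
  simp only [dot, PiLp.sub_apply]; ring

theorem sub_dot (x y z : E3) : dot (x - y) z = dot x z - dot y z := by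
  simp only [dot, PiLp.sub_apply]; ring

theorem dot_smul (c : ℝ) (x y : E3) : dot x (c • y) = c * dot x y := by
  simp only [dot, PiLp.smul_apply, smul_eq_mul]; ring

theorem smul_dot (c : ℝ) (x y : E3) : dot (c • x) y = c * dot x y := by
  simp only [dot, PiLp.smul_apply, smul_eq_mul]; ring

theorem dot_self_nonneg (x : E3) : 0 ≤ dot x x := by
  rw [dot_self]; positivity

theorem dot_cross_self_left (x y : E3) : dot x (cross x y) = 0 := by
  simp only [dot, cross_apply_zero, cross_apply_one, cross_apply_two]; ring

theorem dot_cross_self_right (x y : E3) : dot y (cross x y) = 0 := by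
  simp only [dot, cross_apply_zero, cross_apply_one, cross_apply_two]; ring

/-- Lagrange's identity. -/
theorem dot_cross_cross (x y : E3) :
    dot (cross x y) (cross x y) = dot x x * dot y y - dot x y ^ 2 := by
  simp only [dot, cross_apply_zero, cross_apply_one, cross_apply_two]; ring

theorem dot_sq_le (x y : E3) : dot x y ^ 2 ≤ dot x x * dot y y := by
  have := dot_self_nonneg (cross x y)
  rw [dot_cross_cross] at this
  linarith

theorem eq_smul_of_cross_eq_zero {x y : E3} (hx : dot x x = 1) (h : cross x y = 0) :
    y = dot x y • x := by
  have h0 := congrArg (fun z : E3 => z 0) h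
  have h1 := congrArg (fun z : E3 => z 1) h
  have h2 := congrArg (fun z : E3 => z 2) h
  simp only [cross_apply_zero, cross_apply_one, cross_apply_two, PiLp.zero_apply] at h0 h1 h2
  simp only [dot] at hx
  refine ext3 ?_ ?_ ?_ <;> simp only [dot, PiLp.smul_apply, smul_eq_mul]
  · linear_combination (-y 0) * hx + x 2 * h1 - x 1 * h2
  · linear_combination (-y 1) * hx + x 0 * h2 - x 2 * h0
  · linear_combination (-y 2) * hx + x 1 * h0 - x 0 * h1

theorem exists_unit_orthogonal (v : E3) : ∃ e : E3, dot e e = 1 ∧ dot v e = 0 := by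
  by_cases h : v 0 ^ 2 + v 1 ^ 2 = 0
  · have h0 : v 0 = 0 := by nlinarith [sq_nonneg (v 0), sq_nonneg (v 1)]
    exact ⟨!₂[1, 0, 0], by simp [dot], by simp [dot, h0]⟩
  · have hp : 0 < v 0 ^ 2 + v 1 ^ 2 := lt_of_le_of_ne (by positivity) (Ne.symm h)
    set r := Real.sqrt (v 0 ^ 2 + v 1 ^ 2) with hr
    have hr2 : r ^ 2 = v 0 ^ 2 + v 1 ^ 2 := Real.sq_sqrt hp.le
    have hr0 : r ≠ 0 := (Real.sqrt_pos.2 hp).ne'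
    refine ⟨!₂[-v 1 / r, v 0 / r, 0], ?_, ?_⟩
    · simp [dot]; field_simp; linarith
    · simp [dot]; field_simp; ring

/-- Every unit vector is the first vector of a positively oriented orthonormal frame. -/
theorem exists_frame {v : E3} (hv : dot v v = 1) : ∃ T : E3 →ₗ[ℝ] E3,
    (∀ x y, dot (T x) (T y) = dot x y) ∧ (∀ x y, cross (T x) (T y) = T (cross x y)) ∧
      T v = !₂[1, 0, 0] := by
  obtain ⟨e, he, hve⟩ := exists_unit_orthogonal v
  refine ⟨⟨⟨fun x => !₂[dot v x, dot e x, dot (cross v e) x], fun x y => ?_⟩, fun c x => ?_⟩,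
    fun x y => ?_, fun x y => ?_, ?_⟩
  · refine ext3 ?_ ?_ ?_ <;> simp [dot_add]
  · refine ext3 ?_ ?_ ?_ <;> simp [dot_smul]
  · change dot !₂[dot v x, dot e x, dot (cross v e) x] !₂[dot v y, dot e y, dot (cross v e) y] = _
    have gram : dot (cross v e) x * dot (cross v e) y
        = dot x y * (dot v v * dot e e - dot v e ^ 2)
          - dot v x * (dot v y * dot e e - dot v e * dot e y)
          + dot e x * (dot v y * dot v e - dot v v * dot e y) := by
      simp only [dot, cross_apply_zero, cross_apply_one, cross_apply_two]; ring
    rw [hv, he, hve] at gram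
    have : dot !₂[dot v x, dot e x, dot (cross v e) x] !₂[dot v y, dot e y, dot (cross v e) y]
      = dot v x * dot v y + dot e x * dot e y + dot (cross v e) x * dot (cross v e) y := by
        simp [dot]
    rw [this, gram]; ring
  · change cross !₂[dot v x, dot e x, dot (cross v e) x] !₂[dot v y, dot e y, dot (cross v e) y]
      = !₂[dot v (cross x y), dot e (cross x y), dot (cross v e) (cross x y)]
    have i0 : dot e x * dot (cross v e) y - dot (cross v e) x * dot e y
        = dot e e * dot v (cross x y) - dot v e * dot e (cross x y) := by
      simp only [dot, cross_apply_zero, cross_apply_one, cross_apply_two]; ring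
    have i1 : dot (cross v e) x * dot v y - dot v x * dot (cross v e) y
        = dot v v * dot e (cross x y) - dot v e * dot v (cross x y) := by
      simp only [dot, cross_apply_zero, cross_apply_one, cross_apply_two]; ring
    have i2 : dot v x * dot e y - dot e x * dot v y = dot (cross v e) (cross x y) := by
      simp only [dot, cross_apply_zero, cross_apply_one, cross_apply_two]; ring
    rw [hv, hve] at i1
    rw [he, hve] at i0
    refine ext3 ?_ ?_ ?_
    · simpa using i0
    · simpa using i1
    · simpa using i2
  · change (!₂[dot v v, dot e v, dot (cross v e) v] : E3) = _
    rw [hv, dot_comm e v, hve, dot_comm _ v, dot_cross_self_left]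

variable {v p n j : E3}

/-- For `v = e₁` the constraints solve for the first components of `p`, `n` and `j`; after
substitution the claim is a polynomial identity in the remaining free components. -/
theorem second_law_identity_aux (v0 : v 0 = 1) (v1 : v 1 = 0) (v2 : v 2 = 0) (h2 : dot v p = 0)
    (h3 : dot v n = - dot p p) (h4 : dot v j = -3 * dot p n) :
    2 * dot (cross p n + cross v j) j + 5 * dot p p * dot (cross p n + cross v j) p
      = 3 * (2 * dot p n * dot p (cross v n) + dot p p * dot p (cross p n + cross v j)) := by
  simp only [dot, cross_apply_zero, cross_apply_one, cross_apply_two, PiLp.add_apply, v0, v1, v2,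
    one_mul, zero_mul, add_zero, sub_zero, zero_sub] at h2 h3 h4 ⊢
  rw [h2] at h3 h4
  rw [h3] at h4
  rw [h2, h3, h4]
  ring

/-- The pointwise identity behind the second conservation law. -/
theorem second_law_identity (h1 : dot v v = 1) (h2 : dot v p = 0) (h3 : dot v n = - dot p p)
    (h4 : dot v j = -3 * dot p n) :
    2 * dot (cross p n + cross v j) j + 5 * dot p p * dot (cross p n + cross v j) p
      = 3 * (2 * dot p n * dot p (cross v n) + dot p p * dot p (cross p n + cross v j)) := by
  -- Both sides are built from scalar and vector products, so a rotation reduces the claim to `v =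
  -- e₁`.
  obtain ⟨T, hd, hc, hT⟩ := exists_frame h1
  have v0 : T v 0 = 1 := by rw [hT]; rfl
  have v1 : T v 1 = 0 := by rw [hT]; rfl
  have v2 : T v 2 = 0 := by rw [hT]; rfl
  rw [← hd] at h2
  rw [← hd, ← hd p] at h3
  rw [← hd, ← hd p] at h4
  have key := second_law_identity_aux v0 v1 v2 h2 h3 h4
  simpa only [hc, ← map_add, hd] using key

theorem third_law_identity_aux (v0 : v 0 = 1) (v1 : v 1 = 0) (v2 : v 2 = 0) (h2 : dot v p = 0)
    (h3 : dot v n = - dot p p) (h4 : dot v j = -3 * dot p n) :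
    2 * dot (cross p n + cross v j) (cross (cross v n) j)
      - 5 / 2 * (2 * dot n n * dot (cross p n + cross v j) p
        - 4 * dot p n * dot (cross p n + cross v j) n
        - 2 * dot p p * dot (cross p n + cross v j) j)
      + 63 / 4 * dot p p ^ 2 * dot (cross p n + cross v j) p
      = 23 / 4 * (4 * dot p p * dot p n * dot p (cross v n)
          + dot p p ^ 2 * dot p (cross p n + cross v j))
        - (2 * dot (cross v n) (cross p n + cross v j) * dot p (cross v n)
          + dot (cross v n) (cross v n) * dot p (cross p n + cross v j)) := by
  simp only [dot, cross_apply_zero, cross_apply_one, cross_apply_two, PiLp.add_apply, v0, v1, v2,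
    one_mul, zero_mul, add_zero, zero_add, sub_zero, zero_sub] at h2 h3 h4 ⊢
  rw [h2] at h3 h4
  rw [h3] at h4
  rw [h2, h3, h4]
  ring

/-- The pointwise identity behind the third conservation law. -/
theorem third_law_identity (h1 : dot v v = 1) (h2 : dot v p = 0) (h3 : dot v n = - dot p p)
    (h4 : dot v j = -3 * dot p n) :
    2 * dot (cross p n + cross v j) (cross (cross v n) j)
      - 5 / 2 * (2 * dot n n * dot (cross p n + cross v j) p
        - 4 * dot p n * dot (cross p n + cross v j) n
        - 2 * dot p p * dot (cross p n + cross v j) j)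
      + 63 / 4 * dot p p ^ 2 * dot (cross p n + cross v j) p
      = 23 / 4 * (4 * dot p p * dot p n * dot p (cross v n)
          + dot p p ^ 2 * dot p (cross p n + cross v j))
        - (2 * dot (cross v n) (cross p n + cross v j) * dot p (cross v n)
          + dot (cross v n) (cross v n) * dot p (cross p n + cross v j)) := by
  obtain ⟨T, hd, hc, hT⟩ := exists_frame h1
  have v0 : T v 0 = 1 := by rw [hT]; rfl
  have v1 : T v 1 = 0 := by rw [hT]; rfl
  have v2 : T v 2 = 0 := by rw [hT]; rfl
  rw [← hd] at h2
  rw [← hd, ← hd p] at h3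
  rw [← hd, ← hd p] at h4
  have key := third_law_identity_aux v0 v1 v2 h2 h3 h4
  simpa only [hc, ← map_add, hd] using key

theorem dot_velocity_self (h1 : dot v v = 1) (h3 : dot v n = - dot p p) :
    dot (cross v n) (cross v n) = dot n n - dot p p ^ 2 := by
  rw [dot_cross_cross, h1, h3]; ring

/-- The component of `n` along `v` is `-|p|²` and its orthogonal component has length `|v × n|`. On
the arc `n + κ v = 0`, so with `κ = R⁻²` the left side measures `φ_ss + κ φ`. -/
theorem dot_add_smul_self (h1 : dot v v = 1) (h3 : dot v n = - dot p p) (κ : ℝ) :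
    dot (n + κ • v) (n + κ • v) = dot (cross v n) (cross v n) + (dot p p - κ) ^ 2 := by
  rw [dot_velocity_self h1 h3]
  simp only [dot_add, add_dot, dot_smul, smul_dot, dot_comm n v, h1, h3]; ring

/-- Adding `κ v` to `n` and `κ p` to `j` changes nothing, because `p × v + v × p = 0`. The bound is
thus in terms of quantities that vanish on the arc. -/
theorem dot_velocity_deriv_le (h1 : dot v v = 1) (κ : ℝ) :
    dot (cross p n + cross v j) (cross p n + cross v j)
      ≤ 2 * (dot p p * dot (n + κ • v) (n + κ • v) + dot (j + κ • p) (j + κ • p)) := by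
  have e : cross p n + cross v j = cross p (n + κ • v) + cross v (j + κ • p) := by
    refine ext3 ?_ ?_ ?_ <;> simp <;> ring
  rw [e]
  generalize n + κ • v = a
  generalize j + κ • p = b
  have l1 := dot_cross_cross p a
  have l2 := dot_cross_cross v b
  have l3 := dot_self_nonneg (cross p a - cross v b)
  rw [h1] at l2
  simp only [dot_add, add_dot, dot_sub, sub_dot] at l3 ⊢
  nlinarith [sq_nonneg (dot p a), sq_nonneg (dot v b)]

/-- The vector `j + κ p` is split into its part along `v`, which is `-3 p · n`, and the part seen by
`v ×`. The latter is expressed by the derivative of the velocity, up to terms containing `q = n +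
|p|² v`, the tangential part of `n`, or `|p|² - κ`. -/
theorem dot_third_deriv_le (h1 : dot v v = 1) (h2 : dot v p = 0) (h3 : dot v n = - dot p p)
    (h4 : dot v j = -3 * dot p n) (κ : ℝ) :
    dot (j + κ • p) (j + κ • p) ≤ 12 * dot p p * dot (cross v n) (cross v n)
      + 3 * dot (cross p n + cross v j) (cross p n + cross v j)
      + 3 * (dot p p - κ) ^ 2 * dot p p := by
  have l0 := dot_cross_cross v (j + κ • p)
  have e : cross v (j + κ • p) = (cross p n + cross v j) - cross p (n + dot p p • v)
      - (dot p p - κ) • cross v p := by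
    refine ext3 ?_ ?_ ?_ <;> simp <;> ring
  set w := cross p n + cross v j
  set q := n + dot p p • v with hq
  have hvj : dot v (j + κ • p) = -3 * dot p n := by
    rw [dot_add, dot_smul, h2, h4]; ring
  rw [h1, hvj] at l0
  have hqq : dot q q = dot (cross v n) (cross v n) := by
    rw [dot_add_smul_self h1 h3, sub_self]; ring
  have hpq : dot p q = dot p n := by
    rw [hq, dot_add, dot_smul, dot_comm p v, h2]; ring
  have l1 := dot_cross_cross p q
  have l2 := dot_cross_cross v p
  have l3 := dot_sq_le p q
  rw [h1, h2] at l2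
  rw [hpq, hqq] at l3
  rw [hqq, hpq] at l1
  have tri : ∀ x y z : E3, dot (x - y - z) (x - y - z) ≤ 3 * (dot x x + dot y y + dot z z) := by
    intro x y z
    have a1 := dot_self_nonneg (x + y)
    have a2 := dot_self_nonneg (x + z)
    have a3 := dot_self_nonneg (y - z)
    simp only [dot_add, add_dot, dot_sub, sub_dot, dot_comm y x, dot_comm z x, dot_comm z y]
      at a1 a2 a3 ⊢
    linarith
  have l4 := tri w (cross p q) ((dot p p - κ) • cross v p)
  rw [← e, l0, dot_smul, smul_dot, l1, l2] at l4
  nlinarith [sq_nonneg (dot p n)]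

end Algebra

/-! ### Sphere-valued `H³` curves and their integral identities. -/

/-- The vector product as a continuous bilinear map. -/
def crossL : E3 →L[ℝ] E3 →L[ℝ] E3 :=
  LinearMap.toContinuousLinearMap (LinearMap.toContinuousLinearMap.toLinearMap ∘ₗ
    LinearMap.mk₂ ℝ cross
      (fun x y z => ext3 (by simp; ring) (by simp; ring) (by simp; ring))
      (fun c x y => ext3 (by simp; ring) (by simp; ring) (by simp; ring))
      (fun x y z => ext3 (by simp; ring) (by simp; ring) (by simp; ring))
      (fun c x y => ext3 (by simp; ring) (by simp; ring) (by simp; ring)))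

@[simp] theorem crossL_apply (x y : E3) : crossL x y = cross x y := rfl

theorem continuousOn_dot {S : Set ℝ} {f g : ℝ → E3} (hf : ContinuousOn f S)
    (hg : ContinuousOn g S) : ContinuousOn (fun s => dot (f s) (g s)) S := by
  simp only [← inner_eq_dot]
  exact hf.inner hg

theorem continuousOn_cross {S : Set ℝ} {f g : ℝ → E3} (hf : ContinuousOn f S)
    (hg : ContinuousOn g S) : ContinuousOn (fun s => cross (f s) (g s)) S := by
  simp only [← crossL_apply]
  exact (crossL.continuous.comp_continuousOn hf).clm_apply hg

theorem memLp_of_continuousOn {F : Type*} [NormedAddCommGroup F] {L : ℝ} {q : ENNReal}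
    {f : ℝ → F} (hf : ContinuousOn f (Icc 0 L)) : MemLp f q (volI L) := by
  obtain ⟨c, hc⟩ := isCompact_Icc.exists_bound_of_continuousOn hf
  have hm : AEStronglyMeasurable f (volI L) :=
    (hf.aestronglyMeasurable_of_isCompact isCompact_Icc measurableSet_Icc).mono_measure
      (Measure.restrict_mono Ioo_subset_Icc_self le_rfl)
  refine MemLp.of_bound hm c ?_
  filter_upwards [ae_restrict_mem measurableSet_Ioo] with s hs
  exact hc s (Ioo_subset_Icc_self hs)

theorem integrable_of_continuousOn {L : ℝ} {f : ℝ → ℝ} (hf : ContinuousOn f (Icc 0 L)) :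
    Integrable f (volI L) := memLp_one_iff_integrable.1 (memLp_of_continuousOn hf)

theorem integrable_dot {L : ℝ} {f g : ℝ → E3} (hf : MemLp f 2 (volI L)) (hg : MemLp g 2 (volI L)) :
    Integrable (fun s => dot (f s) (g s)) (volI L) := by
  simp only [← inner_eq_dot]
  exact memLp_one_iff_integrable.1 ((innerSL ℝ (E := E3)).memLp_of_bilin 1 hf hg)

theorem memLp_cross_left {L : ℝ} {f g : ℝ → E3} (hf : ContinuousOn f (Icc 0 L))
    (hg : MemLp g 2 (volI L)) : MemLp (fun s => cross (f s) (g s)) 2 (volI L) :=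
  crossL.memLp_of_bilin 2 (memLp_of_continuousOn (q := ⊤) hf) hg

/-- A curve of class `H³` on `[0, L]` in the unit sphere: `v` and its first two derivatives `p`, `n`
are absolutely continuous, and the third derivative `j` is square integrable. -/
structure IsCurve (L : ℝ) (v p n j : ℝ → E3) : Prop where
  hv : IsPrimV L v p
  hp : IsPrimV L p n
  hn : IsPrimV L n j
  hj : MemLp j 2 (volI L)
  unit : ∀ s ∈ Icc 0 L, dot (v s) (v s) = 1

namespace IsCurve

variable {L : ℝ} {v p n j : ℝ → E3}

theorem cont_v (hL : 0 < L) (h : IsCurve L v p n j) : ContinuousOn v (Icc 0 L) :=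
  h.hv.continuousOn hL

theorem cont_p (hL : 0 < L) (h : IsCurve L v p n j) : ContinuousOn p (Icc 0 L) :=
  h.hp.continuousOn hL

theorem cont_n (hL : 0 < L) (h : IsCurve L v p n j) : ContinuousOn n (Icc 0 L) :=
  h.hn.continuousOn hL

/-- Differentiation of `|v|² = 1`, with continuity turning the almost everywhere identity into one
on all of `[0, L]`. Two more differentiations give `dot_vn` and `dot_vj`; the last remains almost
everywhere because `j` is only square integrable. -/
theorem dot_vp (hL : 0 < L) (h : IsCurve L v p n j) : ∀ s ∈ Icc 0 L, dot (v s) (p s) = 0 := by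
  have h1 := (h.hv.dot h.hv).congr_fun hL (g := fun _ => 1) h.unit
  have h2 : IsPrim L (fun _ => (1 : ℝ)) (fun _ => 0) :=
    IsPrim.of_contDiff contDiff_const fun s => hasDerivAt_const s 1
  refine eqOn_Icc_of_ae_eq hL (continuousOn_dot (h.cont_v hL) (h.cont_p hL)) continuousOn_const ?_
  filter_upwards [h1.deriv_unique h2] with s hs
  rw [dot_comm (p s)] at hs
  linarith

theorem dot_vn (hL : 0 < L) (h : IsCurve L v p n j) :
    ∀ s ∈ Icc 0 L, dot (v s) (n s) = - dot (p s) (p s) := by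
  have h1 := (h.hv.dot h.hp).congr_fun hL (g := fun _ => 0) (h.dot_vp hL)
  have h2 : IsPrim L (fun _ => (0 : ℝ)) (fun _ => 0) :=
    IsPrim.of_contDiff contDiff_const fun s => hasDerivAt_const s 0
  refine eqOn_Icc_of_ae_eq hL (continuousOn_dot (h.cont_v hL) (h.cont_n hL))
    (continuousOn_dot (h.cont_p hL) (h.cont_p hL)).neg ?_
  filter_upwards [h1.deriv_unique h2] with s hs
  linarith

theorem dot_vj (hL : 0 < L) (h : IsCurve L v p n j) :
    ∀ᵐ s ∂(volI L), dot (v s) (j s) = -3 * dot (p s) (n s) := by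
  have h1 := (h.hv.dot h.hn).congr_fun hL (h.dot_vn hL)
  have h2 := (h.hp.dot h.hp).const_mul (-1)
  have h3 := h2.congr_fun hL (g := fun s => - dot (p s) (p s)) fun s _ => by simp
  filter_upwards [h1.deriv_unique h3] with s hs
  rw [dot_comm (n s)] at hs
  linarith

/-- The velocity `v × v_ss` of the filament, with its derivative. -/
theorem velocity (h : IsCurve L v p n j) :
    IsPrimV L (fun s => cross (v s) (n s)) (fun s => cross (p s) (n s) + cross (v s) (j s)) :=
  h.hv.cross h.hn

theorem memLp_velocity_deriv (hL : 0 < L) (h : IsCurve L v p n j) :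
    MemLp (fun s => cross (p s) (n s) + cross (v s) (j s)) 2 (volI L) :=
  (memLp_of_continuousOn (continuousOn_cross (h.cont_p hL) (h.cont_n hL))).add
    (memLp_cross_left (h.cont_v hL) h.hj)

/-- The integrand is the derivative of `U · p`, as `U · n = 0` for `U = v × n`. -/
theorem integral_first_law (hL : 0 < L) (h : IsCurve L v p n j) (b0 : cross (v 0) (n 0) = 0)
    (bL : cross (v L) (n L) = 0) :
    ∫ s in Ioo 0 L, dot (cross (p s) (n s) + cross (v s) (j s)) (p s) = 0 := by
  have := (h.velocity.dot h.hp).integral_eq hL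
  simp only [b0, bL] at this
  calc _ = _ := integral_congr_ae (Filter.Eventually.of_forall fun s => ?_)
    _ = _ := this
    _ = 0 := by simp [dot]
  simp only [dot_comm (cross (v s) (n s)) (n s), dot_cross_self_right, add_zero]

/-- The integrand is the derivative of `3 |p|² (p · U)`, which vanishes at the ends together with `U
= v × n`. -/
theorem integral_second_law (hL : 0 < L) (h : IsCurve L v p n j) (b0 : cross (v 0) (n 0) = 0)
    (bL : cross (v L) (n L) = 0) :
    ∫ s in Ioo 0 L, (2 * dot (cross (p s) (n s) + cross (v s) (j s)) (j s)
      + 5 * dot (p s) (p s) * dot (cross (p s) (n s) + cross (v s) (j s)) (p s)) = 0 := by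
  have := (((h.hp.dot h.hp).mul (h.hp.dot h.velocity)).const_mul 3).integral_eq hL
  simp only [b0, bL] at this
  calc _ = _ := integral_congr_ae ?_
    _ = _ := this
    _ = 0 := by simp [dot]
  filter_upwards [h.dot_vj hL, ae_restrict_mem measurableSet_Ioo] with s h4 hs
  have hs' := Ioo_subset_Icc_self hs
  rw [second_law_identity (h.unit s hs') (h.dot_vp hL s hs') (h.dot_vn hL s hs') h4,
    dot_comm (n s) (p s), dot_cross_self_right]
  ring

/-- The integrand is the derivative of `(23/4) |p|⁴ (p · U) - |U|² (p · U)` with `U = v × n`. -/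
theorem integral_third_law (hL : 0 < L) (h : IsCurve L v p n j) (b0 : cross (v 0) (n 0) = 0)
    (bL : cross (v L) (n L) = 0) :
    ∫ s in Ioo 0 L, (2 * dot (cross (p s) (n s) + cross (v s) (j s)) (cross (cross (v s) (n s)) (j s))
      - 5 / 2 * (2 * dot (n s) (n s) * dot (cross (p s) (n s) + cross (v s) (j s)) (p s)
        - 4 * dot (p s) (n s) * dot (cross (p s) (n s) + cross (v s) (j s)) (n s)
        - 2 * dot (p s) (p s) * dot (cross (p s) (n s) + cross (v s) (j s)) (j s))
      + 63 / 4 * dot (p s) (p s) ^ 2 * dot (cross (p s) (n s) + cross (v s) (j s)) (p s)) = 0 := by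
  have hpp := h.hp.dot h.hp
  have hpu := h.hp.dot h.velocity
  have huu := h.velocity.dot h.velocity
  have := ((((hpp.mul hpp).mul hpu).const_mul (23 / 4)).sub (huu.mul hpu)).integral_eq hL
  simp only [b0, bL] at this
  calc _ = _ := integral_congr_ae ?_
    _ = _ := this
    _ = 0 := by simp [dot]
  filter_upwards [h.dot_vj hL, ae_restrict_mem measurableSet_Ioo] with s h4 hs
  have hs' := Ioo_subset_Icc_self hs
  rw [third_law_identity (h.unit s hs') (h.dot_vp hL s hs') (h.dot_vn hL s hs') h4,
    dot_comm (n s) (p s), dot_cross_self_right,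
    dot_comm (cross (p s) (n s) + cross (v s) (j s)) (cross (v s) (n s))]
  ring

section TwoCurves

variable {v' p' n' j' : ℝ → E3}

/-- At an end point where both curves have the same value and vanishing velocity, the difference of
the tangents is orthogonal to the sum of the second derivatives. -/
theorem boundary_orthogonal (hL : 0 < L) (h : IsCurve L v p n j) (h' : IsCurve L v' p' n' j')
    {s : ℝ} (hs : s ∈ Icc 0 L) (e : v' s = v s) (b : cross (v s) (n s) = 0)
    (b' : cross (v' s) (n' s) = 0) : dot (p' s - p s) (n' s + n s) = 0 := by
  have a := h.dot_vp hL s hs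
  have a' := h'.dot_vp hL s hs
  rw [eq_smul_of_cross_eq_zero (h.unit s hs) b, eq_smul_of_cross_eq_zero (h'.unit s hs) b', e]
  rw [e] at a'
  rw [dot_add, dot_smul, dot_smul, dot_comm _ (v s), dot_sub, a, a']
  ring

/-- Integration by parts of `(p' - p) · (n' + n)`, whose boundary values vanish by
`boundary_orthogonal`. The increment `n' - n` is traded for `p' - p`, the one that can be
differentiated in time. -/
theorem integral_second_deriv_sub (hL : 0 < L) (h : IsCurve L v p n j)
    (h' : IsCurve L v' p' n' j')
    (e0 : v' 0 = v 0) (b0 : cross (v 0) (n 0) = 0) (b0' : cross (v' 0) (n' 0) = 0)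
    (eL : v' L = v L) (bL : cross (v L) (n L) = 0) (bL' : cross (v' L) (n' L) = 0) :
    ∫ s in Ioo 0 L, (dot (n' s) (n' s) - dot (n s) (n s))
      = ∫ s in Ioo 0 L, dot (p' s - p s) (- (j' s + j s)) := by
  have q0 := h.boundary_orthogonal hL h' ⟨le_rfl, hL.le⟩ e0 b0 b0'
  have qL := h.boundary_orthogonal hL h' ⟨hL.le, le_rfl⟩ eL bL bL'
  have Q := (h'.hp.sub h.hp).dot (h'.hn.add h.hn)
  have hQ := Q.integral_eq hL
  rw [q0, qL, sub_zero] at hQ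
  have i1 : Integrable (fun s => dot (n' s) (n' s) - dot (n s) (n s)) (volI L) :=
    integrable_of_continuousOn ((continuousOn_dot (h'.cont_n hL) (h'.cont_n hL)).sub
      (continuousOn_dot (h.cont_n hL) (h.cont_n hL)))
  have hI := integral_sub i1 (Q.integrableOn hL)
  rw [hQ, sub_zero] at hI
  rw [← hI]
  congr 1; ext s
  simp only [dot, PiLp.add_apply, PiLp.sub_apply, PiLp.neg_apply]; ring

/-- The same integration by parts with the weight `|p|²`, after writing the increment as `(|p'|² -
|p|²) |n'|² + |p|² (|n'|² - |n|²)`. -/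
theorem integral_weighted_sub (hL : 0 < L) (h : IsCurve L v p n j) (h' : IsCurve L v' p' n' j')
    (e0 : v' 0 = v 0) (b0 : cross (v 0) (n 0) = 0) (b0' : cross (v' 0) (n' 0) = 0)
    (eL : v' L = v L) (bL : cross (v L) (n L) = 0) (bL' : cross (v' L) (n' L) = 0) :
    ∫ s in Ioo 0 L, (dot (p' s) (p' s) * dot (n' s) (n' s) - dot (p s) (p s) * dot (n s) (n s))
      = ∫ s in Ioo 0 L, dot (p' s - p s) (dot (n' s) (n' s) • (p' s + p s)
          - (2 * dot (p s) (n s)) • (n' s + n s) - dot (p s) (p s) • (j' s + j s)) := by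
  have q0 := h.boundary_orthogonal hL h' ⟨le_rfl, hL.le⟩ e0 b0 b0'
  have qL := h.boundary_orthogonal hL h' ⟨hL.le, le_rfl⟩ eL bL bL'
  have Q := (h.hp.dot h.hp).mul ((h'.hp.sub h.hp).dot (h'.hn.add h.hn))
  have hQ := Q.integral_eq hL
  rw [q0, qL, mul_zero, mul_zero, sub_zero] at hQ
  have i1 : Integrable (fun s => dot (p' s) (p' s) * dot (n' s) (n' s)
      - dot (p s) (p s) * dot (n s) (n s)) (volI L) :=
    integrable_of_continuousOn (((continuousOn_dot (h'.cont_p hL) (h'.cont_p hL)).mul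
      (continuousOn_dot (h'.cont_n hL) (h'.cont_n hL))).sub
      ((continuousOn_dot (h.cont_p hL) (h.cont_p hL)).mul
      (continuousOn_dot (h.cont_n hL) (h.cont_n hL))))
  have hI := integral_sub i1 (Q.integrableOn hL)
  rw [hQ, sub_zero] at hI
  rw [← hI]
  congr 1; ext s
  simp only [dot, PiLp.add_apply, PiLp.sub_apply, PiLp.smul_apply, smul_eq_mul]; ring

/-- With bars for arithmetic means, `v' × n' - v × n = (v' - v) × n̄ + v̄ × (n' - n)`. After
integration by parts the last term is paired with `n' - n` and drops out, and so does `(p' - p) ×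
n̄` paired with `p' - p`. No increment of a derivative above the first survives. -/
theorem integral_increment (hL : 0 < L) (h : IsCurve L v p n j) (h' : IsCurve L v' p' n' j')
    (e0 : v' 0 = v 0) (b0 : cross (v 0) (n 0) = 0) (b0' : cross (v' 0) (n' 0) = 0)
    (eL : v' L = v L) (bL : cross (v L) (n L) = 0) (bL' : cross (v' L) (n' L) = 0) :
    ∫ s in Ioo 0 L, dot (p' s - p s) ((cross (p' s) (n' s) + cross (v' s) (j' s))
        - (cross (p s) (n s) + cross (v s) (j s)))
      = ∫ s in Ioo 0 L, dot (p' s - p s) (cross (v' s - v s) ((1 / 2 : ℝ) • (j' s + j s))) := by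
  have Q1 := (h'.hp.sub h.hp).dot (h'.velocity.sub h.velocity)
  have Q2 := (h'.hp.sub h.hp).dot ((h'.hv.sub h.hv).cross ((h'.hn.add h.hn).const_smul (1 / 2)))
  have hQ := (Q1.sub Q2).integral_eq hL
  rw [e0] at b0'
  rw [eL] at bL'
  have e : (fun s => dot (p' s - p s) (cross (v' s) (n' s) - cross (v s) (n s))
      - dot (p' s - p s) (cross (v' s - v s) ((1 / 2 : ℝ) • (n' s + n s)))) 0 = 0 := by
    simp [e0, b0, b0', dot]
  have e' : (fun s => dot (p' s - p s) (cross (v' s) (n' s) - cross (v s) (n s))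
      - dot (p' s - p s) (cross (v' s - v s) ((1 / 2 : ℝ) • (n' s + n s)))) L = 0 := by
    simp [eL, bL, bL', dot]
  simp only [] at e e'
  rw [e, e', sub_zero] at hQ
  have i1 : Integrable (fun s => dot (p' s - p s)
      (cross (v' s - v s) ((1 / 2 : ℝ) • (j' s + j s)))) (volI L) :=
    integrable_dot (memLp_of_continuousOn ((h'.cont_p hL).sub (h.cont_p hL)))
      (memLp_cross_left ((h'.cont_v hL).sub (h.cont_v hL)) ((h'.hj.add h.hj).const_smul (1 / 2 : ℝ)))
  have hI := integral_add i1 ((Q1.sub Q2).integrableOn hL)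
  rw [hQ, add_zero] at hI
  rw [← hI]
  congr 1; ext s
  simp only [dot, PiLp.add_apply, PiLp.sub_apply, PiLp.smul_apply, smul_eq_mul, cross_apply_zero,
    cross_apply_one, cross_apply_two]; ring

end TwoCurves

end IsCurve

/-! ### Agmon's inequality and the norms of `H^m(I_L)`. -/

theorem integral_abs_dot_le {L A B : ℝ} {f g : ℝ → E3} (hf : MemLp f 2 (volI L))
    (hg : MemLp g 2 (volI L)) (hA : 0 ≤ A) (hB : 0 ≤ B)
    (eA : ∫ s in Ioo 0 L, dot (f s) (f s) = A ^ 2) (eB : ∫ s in Ioo 0 L, dot (g s) (g s) = B ^ 2) :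
    ∫ s in Ioo 0 L, |dot (f s) (g s)| ≤ A * B := by
  have h := integral_mul_le_Lp_mul_Lq_of_nonneg (μ := volI L) (p := 2) (q := 2)
    (f := fun s => ‖f s‖) (g := fun s => ‖g s‖) Real.HolderConjugate.two_two
    (Filter.Eventually.of_forall fun s => norm_nonneg _)
    (Filter.Eventually.of_forall fun s => norm_nonneg _) (by simpa using hf.norm)
    (by simpa using hg.norm)
  have e1 : ∫ s in Ioo 0 L, ‖f s‖ ^ (2 : ℝ) = A ^ 2 := by
    rw [← eA]; congr 1; ext s; rw [dot_self]; norm_cast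
  have e2 : ∫ s in Ioo 0 L, ‖g s‖ ^ (2 : ℝ) = B ^ 2 := by
    rw [← eB]; congr 1; ext s; rw [dot_self]; norm_cast
  rw [e1, e2, ← Real.sqrt_eq_rpow, ← Real.sqrt_eq_rpow, Real.sqrt_sq hA, Real.sqrt_sq hB] at h
  refine le_trans (integral_mono_ae (integrable_dot hf hg).abs ?_ ?_) h
  · exact hf.norm.integrable_mul hg.norm
  · refine Filter.Eventually.of_forall fun s => ?_
    simp only [← inner_eq_dot]
    exact abs_real_inner_le_norm _ _

/-- Agmon's inequality on an interval. -/
theorem dot_self_le_of_isPrimV {L A B : ℝ} (hL : 0 < L) {f f' : ℝ → E3} (h : IsPrimV L f f')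
    (hf' : MemLp f' 2 (volI L)) (hA : 0 ≤ A) (hB : 0 ≤ B)
    (eA : ∫ s in Ioo 0 L, dot (f s) (f s) = A ^ 2)
    (eB : ∫ s in Ioo 0 L, dot (f' s) (f' s) = B ^ 2) {s : ℝ} (hs : s ∈ Icc 0 L) :
    dot (f s) (f s) ≤ A ^ 2 / L + 2 * A * B := by
  have hc := h.continuousOn hL
  have hf : MemLp f 2 (volI L) := memLp_of_continuousOn hc
  have hab := integral_abs_dot_le hf hf' hA hB eA eB
  have hq := h.dot h
  set I := ∫ s in Ioo 0 L, |dot (f s) (f' s)| with hI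
  -- Integrating the derivative of `|f|²` compares any two points; averaging over `x` then yields
  -- the claim.
  have key : ∀ x ∈ Icc 0 L, dot (f s) (f s) ≤ dot (f x) (f x) + 2 * I := by
    intro x hx
    have hsub : uIcc x s ⊆ uIcc 0 L := by
      rw [uIcc_of_le hL.le]
      exact uIcc_subset_Icc hx hs
    have e := (hq.1.mono hsub).integral_deriv_eq_sub
    have b := intervalIntegral.norm_integral_le_integral_norm_uIoc
      (f := deriv fun s => dot (f s) (f s)) (a := x) (b := s) (μ := volume)
    rw [e, Real.norm_eq_abs] at b
    have hint : IntegrableOn (fun s => ‖deriv (fun s => dot (f s) (f s)) s‖) (Ioc 0 L) := by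
      have := hq.1.intervalIntegrable_deriv
      rw [intervalIntegrable_iff_integrableOn_Ioc_of_le hL.le] at this
      exact this.norm
    have b2 : ∫ s in uIoc x s, ‖deriv (fun s => dot (f s) (f s)) s‖
        ≤ ∫ s in Ioc 0 L, ‖deriv (fun s => dot (f s) (f s)) s‖ := by
      refine setIntegral_mono_set hint (Filter.Eventually.of_forall fun _ => norm_nonneg _) ?_
      refine LE.le.eventuallyLE ?_
      exact Ioc_subset_Ioc (le_min hx.1 hs.1) (max_le hx.2 hs.2)
    have b3 : ∫ s in Ioc 0 L, ‖deriv (fun s => dot (f s) (f s)) s‖ = 2 * I := by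
      rw [integral_Ioc_eq_integral_Ioo, hI, ← integral_const_mul]
      refine integral_congr_ae ?_
      filter_upwards [hq.ae_eq_deriv] with y hy
      rw [← hy, dot_comm (f' y), Real.norm_eq_abs, ← two_mul, abs_mul, abs_two]
    have := (le_abs_self _).trans (b.trans (b2.trans_eq b3))
    linarith
  have i1 : Integrable (fun x => dot (f x) (f x)) (volI L) :=
    integrable_of_continuousOn (continuousOn_dot hc hc)
  have hm : ∫ _ in Ioo 0 L, dot (f s) (f s) ≤ ∫ x in Ioo 0 L, (dot (f x) (f x) + 2 * I) := by
    refine setIntegral_mono_on (integrableOn_const (by simp)) (i1.add (integrable_const _))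
      measurableSet_Ioo fun x hx => key x (Ioo_subset_Icc_self hx)
  rw [integral_add i1 (integrable_const _), eA] at hm
  simp only [integral_const, measureReal_restrict_apply_univ, Real.volume_real_Ioo, sub_zero,
    max_eq_left hL.le, smul_eq_mul] at hm
  rw [div_add' _ _ _ hL.ne', le_div_iff₀ hL]
  nlinarith

/-- The derivative operator `D^k` as a continuous linear map. -/
def DL (L : ℝ) {m : ℕ} (k : Fin (m + 1)) : H L m →L[ℝ] L2 L :=
  (PiLp.proj (𝕜 := ℝ) 2 (fun _ : Fin (m + 1) => L2 L) k).comp (sobolev L m).subtypeL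

@[simp] theorem DL_apply {L : ℝ} {m : ℕ} (k : Fin (m + 1)) (x : H L m) : DL L k x = D k x := rfl

theorem norm_D_le {L : ℝ} {m : ℕ} (k : Fin (m + 1)) (x : H L m) : ‖D k x‖ ≤ ‖x‖ :=
  PiLp.norm_apply_le x.1 k

theorem isWeakDeriv_D {L : ℝ} {m : ℕ} (k : Fin m) (x : H L m) :
    IsWeakDeriv L (D k.castSucc x) (D k.succ x) := x.2 k

theorem inner_eq_integral {L : ℝ} (x y : L2 L) : inner ℝ x y = ∫ s in Ioo 0 L, dot (x s) (y s) := by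
  rw [L2.inner_def]
  congr 1; ext s; rw [inner_eq_dot]

theorem norm_sq_eq_integral {L : ℝ} (x : L2 L) : ‖x‖ ^ 2 = ∫ s in Ioo 0 L, dot (x s) (x s) := by
  rw [← inner_eq_integral, real_inner_self_eq_norm_sq]

theorem integral_dot_congr {L : ℝ} {x y f g : ℝ → E3} (h : x =ᵐ[volI L] f) (k : y =ᵐ[volI L] g) :
    ∫ s in Ioo 0 L, dot (x s) (y s) = ∫ s in Ioo 0 L, dot (f s) (g s) := by
  refine integral_congr_ae ?_
  filter_upwards [h, k] with s hs ks
  rw [hs, ks]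

/-- Pointwise bound for the continuous representative. -/
theorem norm_rep_le {L : ℝ} (hL : 0 < L) {u g : L2 L} (h : IsWeakDeriv L u g) {f : ℝ → E3}
    (hf : ContinuousOn f (Icc 0 L)) (e : u =ᵐ[volI L] f) {s : ℝ} (hs : s ∈ Icc 0 L) :
    ‖f s‖ ≤ (1 / L + 1) * (‖u‖ + ‖g‖) := by
  obtain ⟨f₁, h1, e1⟩ := h.exists_isPrimV hL
  have heq : EqOn f f₁ (Icc 0 L) := eqOn_Icc_of_ae_eq hL hf (h1.continuousOn hL) (e.symm.trans e1)
  have b := dot_self_le_of_isPrimV hL h1 (Lp.memLp g) (norm_nonneg u) (norm_nonneg g)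
    (by rw [norm_sq_eq_integral]; exact integral_dot_congr e1.symm e1.symm)
    (by rw [norm_sq_eq_integral]) hs
  rw [heq hs]
  rw [dot_self] at b
  have hL' : 0 < 1 / L := by positivity
  have n1 := norm_nonneg u
  have n2 := norm_nonneg g
  refine le_of_sq_le_sq ?_ (by positivity)
  refine b.trans ?_
  have : ‖u‖ ^ 2 / L = (1 / L) * ‖u‖ ^ 2 := by ring
  rw [this]
  nlinarith [mul_nonneg n1 n2, mul_nonneg hL'.le (mul_nonneg n1 n2), sq_nonneg (1 / L),
    mul_nonneg (sq_nonneg (1 / L)) (sq_nonneg (‖u‖ + ‖g‖)), mul_nonneg hL'.le (sq_nonneg ‖g‖),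
    mul_nonneg hL'.le (sq_nonneg ‖u‖), sq_nonneg ‖u‖, sq_nonneg ‖g‖]

theorem IsWeakDeriv.ae_norm_le {L : ℝ} (hL : 0 < L) {u g : L2 L} (h : IsWeakDeriv L u g) :
    ∀ᵐ s ∂(volI L), ‖u s‖ ≤ (1 / L + 1) * (‖u‖ + ‖g‖) := by
  obtain ⟨f, h1, e1⟩ := h.exists_isPrimV hL
  filter_upwards [e1, ae_restrict_mem measurableSet_Ioo] with s hs hm
  rw [hs]
  exact norm_rep_le hL h (h1.continuousOn hL) e1 (Ioo_subset_Icc_self hm)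

/-! ### Products of bounded and square integrable fields. -/

open Classical in
/-- A bounded element of `L²` as an element of `L^∞` (and `0` for unbounded elements). -/
def linf {L : ℝ} (u : L2 L) : Lp E3 ⊤ (volI L) :=
  if h : MemLp u ⊤ (volI L) then h.toLp u else 0

theorem IsWeakDeriv.memLp_top {L : ℝ} (hL : 0 < L) {u g : L2 L} (h : IsWeakDeriv L u g) :
    MemLp u ⊤ (volI L) := memLp_top_of_bound (Lp.aestronglyMeasurable u) _ (h.ae_norm_le hL)

theorem coeFn_linf {L : ℝ} (hL : 0 < L) {u g : L2 L} (h : IsWeakDeriv L u g) :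
    linf u =ᵐ[volI L] u := by
  rw [linf, dif_pos (h.memLp_top hL)]
  exact MemLp.coeFn_toLp _

/-- The Sobolev embedding applied to `u' - u`. The default value makes `linf` nonlinear on `L²`, but
on fields with a weak derivative in `L²` it agrees almost everywhere with its argument. -/
theorem norm_linf_sub_le {L : ℝ} (hL : 0 < L) {u g u' g' : L2 L} (h : IsWeakDeriv L u g)
    (h' : IsWeakDeriv L u' g') :
    ‖linf u' - linf u‖ ≤ (1 / L + 1) * (‖u' - u‖ + ‖g' - g‖) := by
  have hs : IsWeakDeriv L (u' - u) (g' - g) := by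
    have := h'.add (h.smul (-1))
    simpa only [neg_smul, one_smul, ← sub_eq_add_neg] using this
  have hL' : 0 < 1 / L := by positivity
  have hb : ∀ᵐ s ∂(volI L), ‖(linf u' - linf u) s‖ ≤ (1 / L + 1) * (‖u' - u‖ + ‖g' - g‖) := by
    filter_upwards [hs.ae_norm_le hL, coeFn_linf hL h, coeFn_linf hL h', Lp.coeFn_sub u' u,
      Lp.coeFn_sub (linf u') (linf u)] with s a b c d e
    rw [e, Pi.sub_apply, b, c, ← Pi.sub_apply, ← d]
    exact a
  have := Lp.norm_le_of_ae_bound (by positivity) hb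
  simpa using this

theorem tendsto_linf {L : ℝ} (hL : 0 < L) {α : Type*} {l : Filter α} {u g : α → L2 L}
    {u₀ g₀ : L2 L} (h : ∀ᶠ a in l, IsWeakDeriv L (u a) (g a)) (h₀ : IsWeakDeriv L u₀ g₀)
    (hu : Filter.Tendsto u l (nhds u₀)) (hg : Filter.Tendsto g l (nhds g₀)) :
    Filter.Tendsto (fun a => linf (u a)) l (nhds (linf u₀)) := by
  rw [tendsto_iff_norm_sub_tendsto_zero] at hu hg ⊢
  have hb : Filter.Tendsto (fun a => (1 / L + 1) * (‖u a - u₀‖ + ‖g a - g₀‖)) l (nhds 0) := by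
    simpa using (hu.add hg).const_mul (1 / L + 1)
  refine squeeze_zero' (Filter.Eventually.of_forall fun _ => norm_nonneg _) ?_ hb
  filter_upwards [h] with a ha using norm_linf_sub_le hL h₀ ha

/-- Multiplication of an `L²` field by a bounded function. -/
def smulL (L : ℝ) : Lp ℝ ⊤ (volI L) →L[ℝ] L2 L →L[ℝ] L2 L :=
  (ContinuousLinearMap.lsmul ℝ ℝ (E := E3)).holderL (volI L) ⊤ 2 2

/-- Pointwise scalar product of bounded fields. -/
def dotL (L : ℝ) : Lp E3 ⊤ (volI L) →L[ℝ] Lp E3 ⊤ (volI L) →L[ℝ] Lp ℝ ⊤ (volI L) :=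
  (innerSL ℝ (E := E3)).holderL (volI L) ⊤ ⊤ ⊤

/-- Pointwise product of bounded functions. -/
def mulL (L : ℝ) : Lp ℝ ⊤ (volI L) →L[ℝ] Lp ℝ ⊤ (volI L) →L[ℝ] Lp ℝ ⊤ (volI L) :=
  (ContinuousLinearMap.lsmul ℝ ℝ (E := ℝ)).holderL (volI L) ⊤ ⊤ ⊤

/-- Pointwise vector product of a bounded field and an `L²` field. -/
def crossLp (L : ℝ) : Lp E3 ⊤ (volI L) →L[ℝ] L2 L →L[ℝ] L2 L :=
  crossL.holderL (volI L) ⊤ 2 2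

theorem coeFn_smulL {L : ℝ} (c : Lp ℝ ⊤ (volI L)) (x : L2 L) :
    smulL L c x =ᵐ[volI L] fun s => c s • x s :=
  (ContinuousLinearMap.lsmul ℝ ℝ (E := E3)).coeFn_holder c x

theorem coeFn_dotL {L : ℝ} (x y : Lp E3 ⊤ (volI L)) :
    dotL L x y =ᵐ[volI L] fun s => dot (x s) (y s) := by
  filter_upwards [(innerSL ℝ (E := E3)).coeFn_holder (r := ⊤) x y] with s hs
  rw [← inner_eq_dot]
  exact hs

theorem coeFn_mulL {L : ℝ} (x y : Lp ℝ ⊤ (volI L)) :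
    mulL L x y =ᵐ[volI L] fun s => x s * y s :=
  (ContinuousLinearMap.lsmul ℝ ℝ (E := ℝ)).coeFn_holder x y

theorem coeFn_crossLp {L : ℝ} (x : Lp E3 ⊤ (volI L)) (y : L2 L) :
    crossLp L x y =ᵐ[volI L] fun s => cross (x s) (y s) :=
  crossL.coeFn_holder x y

theorem tendsto_clm₂ {E F G α : Type*} [NormedAddCommGroup E] [NormedAddCommGroup F]
    [NormedAddCommGroup G] [NormedSpace ℝ E] [NormedSpace ℝ F] [NormedSpace ℝ G]
    (B : E →L[ℝ] F →L[ℝ] G) {l : Filter α} {f : α → E} {g : α → F} {x : E} {y : F}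
    (hf : Filter.Tendsto f l (nhds x)) (hg : Filter.Tendsto g l (nhds y)) :
    Filter.Tendsto (fun a => B (f a) (g a)) l (nhds (B x y)) :=
  (B.continuous₂.tendsto (x, y)).comp (hf.prodMk_nhds hg)

/-! ### Differentiation in time under limited regularity. -/

/-- A functional whose increments are represented by an inner product with the increments of a
differentiable curve is differentiable. -/
theorem hasDerivAt_of_inner_increment {E : Type*} [NormedAddCommGroup E] [InnerProductSpace ℝ E]
    {F : ℝ → ℝ} {f g : ℝ → E} {t : ℝ} {f' : E} (hf : HasDerivAt f f' t) (hg : ContinuousAt g t)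
    (h : ∀ᶠ t' in nhds t, F t' - F t = inner ℝ (f t' - f t) (g t')) :
    HasDerivAt F (inner ℝ f' (g t)) t := by
  rw [hasDerivAt_iff_tendsto_slope] at hf ⊢
  refine (hf.inner (hg.tendsto.mono_left nhdsWithin_le_nhds)).congr' ?_
  filter_upwards [nhdsWithin_le_nhds h] with t' ht'
  simp only [slope, vsub_eq_sub, smul_eq_mul, ht', real_inner_smul_left]

/-- The difference quotients of a continuously differentiable curve converge locally uniformly. -/
theorem tendsto_difference_quotient {E : Type*} [NormedAddCommGroup E] [NormedSpace ℝ E]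
    {f f' : ℝ → E} {t : ℝ} (hf : ∀ᶠ y in nhds t, HasDerivAt f (f' y) y)
    (hc : ContinuousAt f' t) :
    Filter.Tendsto (fun x : ℝ × ℝ => x.1⁻¹ • (f (x.2 + x.1) - f x.2))
      (nhdsWithin 0 {0}ᶜ ×ˢ nhds t) (nhds (f' t)) := by
  have h := (hasStrictDerivAt_of_hasDerivAt_of_continuousAt hf hc).isLittleO
  have hT : Filter.Tendsto (fun x : ℝ × ℝ => (x.2 + x.1, x.2)) (nhdsWithin 0 {0}ᶜ ×ˢ nhds t)
      (nhds (t, t)) := by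
    have : Filter.Tendsto (fun x : ℝ × ℝ => (x.2 + x.1, x.2)) (nhds (0, t)) (nhds (t, t)) := by
      have hc : Continuous (fun x : ℝ × ℝ => (x.2 + x.1, x.2)) := by fun_prop
      simpa using hc.tendsto (0, t)
    refine this.mono_left ?_
    rw [nhds_prod_eq]
    exact Filter.prod_mono nhdsWithin_le_nhds le_rfl
  have h2 := h.comp_tendsto hT
  rw [tendsto_iff_norm_sub_tendsto_zero]
  have h3 := h2.norm_left.norm_right.tendsto_div_nhds_zero
  refine h3.congr' ?_
  have hne : ∀ᶠ x : ℝ × ℝ in nhdsWithin 0 {0}ᶜ ×ˢ nhds t, x.1 ≠ 0 :=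
    Filter.tendsto_fst.eventually (self_mem_nhdsWithin)
  filter_upwards [hne] with x hx
  have e : x.1⁻¹ • (f (x.2 + x.1) - f x.2) - f' t
      = x.1⁻¹ • (f (x.2 + x.1) - f x.2 - x.1 • f' t) := by
    rw [smul_sub x.1⁻¹ _ (x.1 • f' t), smul_smul, inv_mul_cancel₀ hx, one_smul]
  rw [e, norm_smul, norm_inv]
  simp [div_eq_inv_mul]

/-! ### Sphere-valued flows and their boundary behaviour. -/

/-- Representatives of an `H³` map `x` with values in the sphere and of its velocity
`y = x × x_ss`, together with the boundary values `a`, `b` of `x`. -/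
structure IsRep (L : ℝ) (a b : E3) (x : H L 3) (y : H L 1) (v p n : ℝ → E3) : Prop where
  curve : IsCurve L v p n (D 3 x)
  e0 : D 0 x =ᵐ[volI L] v
  e1 : D 1 x =ᵐ[volI L] p
  e2 : D 2 x =ᵐ[volI L] n
  v0 : v 0 = a
  vL : v L = b
  b0 : cross (v 0) (n 0) = 0
  bL : cross (v L) (n L) = 0
  eu : D 0 y =ᵐ[volI L] fun s => cross (v s) (n s)
  ew : D 1 y =ᵐ[volI L] fun s => cross (p s) (n s) + cross (v s) (D 3 x s)

theorem exists_isCurve {L : ℝ} (hL : 0 < L) {x : H L 3} (h : ∀ᵐ s ∂(volI L), ‖D 0 x s‖ = 1) :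
    ∃ v p n : ℝ → E3, IsCurve L v p n (D 3 x) ∧ D 0 x =ᵐ[volI L] v ∧ D 1 x =ᵐ[volI L] p ∧
      D 2 x =ᵐ[volI L] n := by
  obtain ⟨v, hv, ev⟩ := (isWeakDeriv_D 0 x).exists_isPrimV hL
  obtain ⟨p, hp, ep⟩ := (isWeakDeriv_D 1 x).exists_isPrimV hL
  obtain ⟨n, hn, en⟩ := (isWeakDeriv_D 2 x).exists_isPrimV hL
  have hvc := hv.continuousOn hL
  refine ⟨v, p, n, ⟨hv.congr_deriv ep, hp.congr_deriv en, hn, Lp.memLp _, ?_⟩, ev, ep, en⟩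
  refine eqOn_Icc_of_ae_eq hL (continuousOn_dot hvc hvc) continuousOn_const ?_
  filter_upwards [h, ev] with s hs es
  have es' : D 0 x s = v s := es
  rw [← es', dot_self, hs, one_pow]

/-- A sphere-valued solution with fixed boundary values, for positive times. -/
structure IsFlow (L : ℝ) (a b : E3) (v : ℝ → H L 3) (vt : ℝ → H L 1) : Prop where
  cont : ∀ t, 0 < t → ContinuousAt v t
  cont_deriv : ∀ t, 0 < t → ContinuousAt vt t
  deriv : ∀ t, 0 < t → HasDerivAt (fun τ => toH1 (v τ)) (vt t) t
  eq : ∀ t, 0 < t → ∀ᵐ s ∂(volI L), D 0 (vt t) s = cross (D 0 (v t) s) (D 2 (v t) s)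
  unit : ∀ t, 0 < t → ∀ᵐ s ∂(volI L), ‖D 0 (v t) s‖ = 1
  bdry : ∀ t, 0 < t → HasBoundaryValues L (D 0 (v t)) a b

/-- The derivative of a curve in `H¹` whose value at a fixed point is constant vanishes there. -/
theorem rep_deriv_eq_zero {L : ℝ} (hL : 0 < L) {x : ℝ → H L 1} {x' : H L 1} {t : ℝ} {s : ℝ}
    (hs : s ∈ Icc 0 L) (hx : HasDerivAt x x' t) {c : E3}
    (hc : ∀ᶠ τ in nhds t, ∃ f : ℝ → E3, IsContRep L (D 0 (x τ)) f ∧ f s = c)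
    {g : ℝ → E3} (hg : IsContRep L (D 0 x') g) : g s = 0 := by
  obtain ⟨f₀, hf₀, e₀⟩ := hc.self_of_nhds
  rw [hasDerivAt_iff_tendsto_slope, tendsto_iff_norm_sub_tendsto_zero] at hx
  have hx2 := hx.const_mul ((1 / L + 1) * 2)
  rw [mul_zero] at hx2
  -- The difference quotient has value zero at `s`, so there its error against `x'` is exactly `-g
  -- s`, which the `H¹` norm of the error controls.
  have hb : ∀ᶠ τ in nhdsWithin t {t}ᶜ, ‖g s‖ ≤ (1 / L + 1) * 2 * ‖slope x t τ - x'‖ := by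
    filter_upwards [nhdsWithin_le_nhds hc] with τ hτ
    obtain ⟨f, hf, e⟩ := hτ
    set y := slope x t τ - x' with hy
    have hrep : D 0 y =ᵐ[volI L] fun s => (τ - t)⁻¹ • (f s - f₀ s) - g s := by
      have : D 0 y = (τ - t)⁻¹ • (D 0 (x τ) - D 0 (x t)) - D 0 x' := by
        simp only [← DL_apply, hy, slope, vsub_eq_sub, map_sub, map_smul]
      rw [this]
      filter_upwards [hf.2, hf₀.2, hg.2, Lp.coeFn_sub ((τ - t)⁻¹ • (D 0 (x τ) - D 0 (x t))) (D 0 x'),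
        Lp.coeFn_smul (τ - t)⁻¹ (D 0 (x τ) - D 0 (x t)), Lp.coeFn_sub (D 0 (x τ)) (D 0 (x t))]
        with r a1 a2 a3 a4 a5 a6
      rw [a4, Pi.sub_apply, a5, Pi.smul_apply, a6, Pi.sub_apply, a1, a2, a3]
    have := norm_rep_le hL (isWeakDeriv_D 0 y)
      (((hf.1.sub hf₀.1).const_smul ((τ - t)⁻¹)).sub hg.1) hrep hs
    simp only [Pi.sub_apply, Pi.smul_apply, e, e₀, sub_self, smul_zero, zero_sub, norm_neg] at this
    refine this.trans ?_
    have hL' : 0 < 1 / L + 1 := by positivity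
    rw [mul_assoc]
    refine mul_le_mul_of_nonneg_left ?_ hL'.le
    have h2 : ‖D (Fin.castSucc 0) y‖ ≤ ‖y‖ := norm_D_le _ y
    have h3 : ‖D (Fin.succ 0) y‖ ≤ ‖y‖ := norm_D_le _ y
    linarith
  have := ge_of_tendsto hx2 hb
  exact norm_eq_zero.1 (le_antisymm this (norm_nonneg _))

namespace IsFlow

variable {L : ℝ} {a b : E3} {v : ℝ → H L 3} {vt : ℝ → H L 1}

/-- The velocity is the time derivative of a curve with fixed end values, so `v × v_ss` vanishes at
the ends at every positive time. -/
theorem exists_isRep (hL : 0 < L) (h : IsFlow L a b v vt) {t : ℝ} (ht : 0 < t) :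
    ∃ v₀ p n : ℝ → E3, IsRep L a b (v t) (vt t) v₀ p n := by
  obtain ⟨v₀, p, n, hc, e0, e1, e2⟩ := exists_isCurve hL (h.unit t ht)
  obtain ⟨f, hf, fa, fb⟩ := h.bdry t ht
  have hfv : EqOn f v₀ (Icc 0 L) := eqOn_Icc_of_ae_eq hL hf.1 (hc.cont_v hL) (hf.2.symm.trans e0)
  have eu : D 0 (vt t) =ᵐ[volI L] fun s => cross (v₀ s) (n s) := by
    filter_upwards [h.eq t ht, e0, e2] with s h1 h2 h3
    rw [h1, h2, h3]
  obtain ⟨U, hU, eU⟩ := (isWeakDeriv_D 0 (vt t)).exists_isPrimV hL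
  have huc := continuousOn_cross (hc.cont_v hL) (hc.cont_n hL)
  have hUe : EqOn U (fun s => cross (v₀ s) (n s)) (Icc 0 L) :=
    eqOn_Icc_of_ae_eq hL (hU.continuousOn hL) huc (eU.symm.trans eu)
  have hev : ∀ᶠ τ in nhds t, 0 < τ := lt_mem_nhds ht
  refine ⟨v₀, p, n, hc, e0, e1, e2, ?_, ?_, ?_, ?_, eu, ?_⟩
  · rw [← hfv ⟨le_rfl, hL.le⟩, fa]
  · rw [← hfv ⟨hL.le, le_rfl⟩, fb]
  · refine rep_deriv_eq_zero hL ⟨le_rfl, hL.le⟩ (h.deriv t ht) (c := a) ?_ ⟨huc, eu⟩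
    filter_upwards [hev] with τ hτ
    obtain ⟨f, hf, fa, fb⟩ := h.bdry τ hτ
    exact ⟨f, hf, fa⟩
  · refine rep_deriv_eq_zero hL ⟨hL.le, le_rfl⟩ (h.deriv t ht) (c := b) ?_ ⟨huc, eu⟩
    filter_upwards [hev] with τ hτ
    obtain ⟨f, hf, fa, fb⟩ := h.bdry τ hτ
    exact ⟨f, hf, fb⟩
  · exact (hU.congr_fun hL hUe).deriv_unique hc.velocity

theorem continuousAt_D (h : IsFlow L a b v vt) {t : ℝ} (ht : 0 < t) (k : Fin 4) :
    ContinuousAt (fun τ => D k (v τ)) t :=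
  (DL L k).continuous.continuousAt.comp (h.cont t ht)

theorem hasDerivAt_D_one (h : IsFlow L a b v vt) {t : ℝ} (ht : 0 < t) :
    HasDerivAt (fun τ => D 1 (v τ)) (D 1 (vt t)) t :=
  (DL L 1).hasFDerivAt.comp_hasDerivAt t (h.deriv t ht)

theorem continuousAt_linf_one (hL : 0 < L) (h : IsFlow L a b v vt) {t : ℝ} (ht : 0 < t) :
    ContinuousAt (fun τ => linf (D 1 (v τ))) t :=
  tendsto_linf hL (Filter.Eventually.of_forall fun τ => isWeakDeriv_D 1 (v τ))
    (isWeakDeriv_D 1 (v t)) (h.continuousAt_D ht 1) (h.continuousAt_D ht 2)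

theorem continuousAt_linf_two (hL : 0 < L) (h : IsFlow L a b v vt) {t : ℝ} (ht : 0 < t) :
    ContinuousAt (fun τ => linf (D 2 (v τ))) t :=
  tendsto_linf hL (Filter.Eventually.of_forall fun τ => isWeakDeriv_D 2 (v τ))
    (isWeakDeriv_D 2 (v t)) (h.continuousAt_D ht 2) (h.continuousAt_D ht 3)

end IsFlow

/-! ### Energies and the fields representing their increments. -/

section Energies

variable {L : ℝ}

/-- The bounded function `x_s · x_s`. -/
def sqOne (x : H L 3) : Lp ℝ ⊤ (volI L) := dotL L (linf (D 1 x)) (linf (D 1 x))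

/-- The bounded function `x_ss · x_ss`. -/
def sqTwo (x : H L 3) : Lp ℝ ⊤ (volI L) := dotL L (linf (D 2 x)) (linf (D 2 x))

/-- The bounded function `x_s · x_ss`. -/
def mixed (x : H L 3) : Lp ℝ ⊤ (volI L) := dotL L (linf (D 1 x)) (linf (D 2 x))

/-- `∫ |x_s|² |x_ss|²`. -/
def weightedEnergy (x : H L 3) : ℝ :=
  ∫ s in Ioo 0 L, dot (D 1 x s) (D 1 x s) * dot (D 2 x s) (D 2 x s)

/-- `∫ |x_s|⁴`. -/
def quarticEnergy (x : H L 3) : ℝ := ∫ s in Ioo 0 L, dot (D 1 x s) (D 1 x s) ^ 2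

/-- `∫ |x_s|⁶`. -/
def sexticEnergy (x : H L 3) : ℝ := ∫ s in Ioo 0 L, dot (D 1 x s) (D 1 x s) ^ 3

/-- The field representing the increments of `weightedEnergy`. -/
def weightedGrad (x x' : H L 3) : L2 L :=
  smulL L (sqTwo x') (D 1 x' + D 1 x) - (2 : ℝ) • smulL L (mixed x) (D 2 x' + D 2 x)
    - smulL L (sqOne x) (D 3 x' + D 3 x)

/-- The field representing the increments of `quarticEnergy`. -/
def quarticGrad (x x' : H L 3) : L2 L := smulL L (sqOne x' + sqOne x) (D 1 x' + D 1 x)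

/-- The field representing the increments of `sexticEnergy`. -/
def sexticGrad (x x' : H L 3) : L2 L :=
  smulL L (mulL L (sqOne x') (sqOne x') + mulL L (sqOne x') (sqOne x)
    + mulL L (sqOne x) (sqOne x)) (D 1 x' + D 1 x)

theorem coeFn_sqOne (hL : 0 < L) (x : H L 3) :
    sqOne x =ᵐ[volI L] fun s => dot (D 1 x s) (D 1 x s) := by
  filter_upwards [coeFn_dotL (linf (D 1 x)) (linf (D 1 x)), coeFn_linf hL (isWeakDeriv_D 1 x)]
    with s h1 h2
  have h2' : linf (D 1 x) s = D 1 x s := h2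
  rw [sqOne, h1, h2']

theorem coeFn_sqTwo (hL : 0 < L) (x : H L 3) :
    sqTwo x =ᵐ[volI L] fun s => dot (D 2 x s) (D 2 x s) := by
  filter_upwards [coeFn_dotL (linf (D 2 x)) (linf (D 2 x)), coeFn_linf hL (isWeakDeriv_D 2 x)]
    with s h1 h2
  have h2' : linf (D 2 x) s = D 2 x s := h2
  rw [sqTwo, h1, h2']

theorem coeFn_mixed (hL : 0 < L) (x : H L 3) :
    mixed x =ᵐ[volI L] fun s => dot (D 1 x s) (D 2 x s) := by
  filter_upwards [coeFn_dotL (linf (D 1 x)) (linf (D 2 x)), coeFn_linf hL (isWeakDeriv_D 1 x),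
    coeFn_linf hL (isWeakDeriv_D 2 x)] with s h1 h2 h3
  have h2' : linf (D 1 x) s = D 1 x s := h2
  have h3' : linf (D 2 x) s = D 2 x s := h3
  rw [mixed, h1, h2', h3']

theorem coeFn_weightedGrad (hL : 0 < L) (x x' : H L 3) : weightedGrad x x' =ᵐ[volI L] fun s =>
    dot (D 2 x' s) (D 2 x' s) • (D 1 x' s + D 1 x s)
      - (2 * dot (D 1 x s) (D 2 x s)) • (D 2 x' s + D 2 x s)
      - dot (D 1 x s) (D 1 x s) • (D 3 x' s + D 3 x s) := by
  rw [weightedGrad]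
  filter_upwards [coeFn_sqTwo hL x', coeFn_mixed hL x, coeFn_sqOne hL x,
    Lp.coeFn_add (D 1 x') (D 1 x), Lp.coeFn_add (D 2 x') (D 2 x), Lp.coeFn_add (D 3 x') (D 3 x),
    coeFn_smulL (sqTwo x') (D 1 x' + D 1 x), coeFn_smulL (mixed x) (D 2 x' + D 2 x),
    coeFn_smulL (sqOne x) (D 3 x' + D 3 x),
    Lp.coeFn_sub (smulL L (sqTwo x') (D 1 x' + D 1 x)
      - (2 : ℝ) • smulL L (mixed x) (D 2 x' + D 2 x)) (smulL L (sqOne x) (D 3 x' + D 3 x)),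
    Lp.coeFn_sub (smulL L (sqTwo x') (D 1 x' + D 1 x))
      ((2 : ℝ) • smulL L (mixed x) (D 2 x' + D 2 x)),
    Lp.coeFn_smul (2 : ℝ) (smulL L (mixed x) (D 2 x' + D 2 x))]
    with s h1 h2 h3 h4 h5 h6 h7 h8 h9 h10 h11 h12
  rw [h10, Pi.sub_apply, h11, Pi.sub_apply, h12, Pi.smul_apply, h7, h8, h9, h4, h5, h6, h1, h2, h3,
    smul_smul]
  rfl

theorem coeFn_quarticGrad (hL : 0 < L) (x x' : H L 3) : quarticGrad x x' =ᵐ[volI L] fun s =>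
    (dot (D 1 x' s) (D 1 x' s) + dot (D 1 x s) (D 1 x s)) • (D 1 x' s + D 1 x s) := by
  rw [quarticGrad]
  filter_upwards [coeFn_sqOne hL x', coeFn_sqOne hL x, Lp.coeFn_add (D 1 x') (D 1 x),
    Lp.coeFn_add (sqOne x') (sqOne x), coeFn_smulL (sqOne x' + sqOne x) (D 1 x' + D 1 x)]
    with s h1 h2 h3 h4 h5
  rw [h5, h4, h3, Pi.add_apply, Pi.add_apply, h1, h2]

theorem coeFn_sexticGrad (hL : 0 < L) (x x' : H L 3) : sexticGrad x x' =ᵐ[volI L] fun s =>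
    (dot (D 1 x' s) (D 1 x' s) * dot (D 1 x' s) (D 1 x' s)
      + dot (D 1 x' s) (D 1 x' s) * dot (D 1 x s) (D 1 x s)
      + dot (D 1 x s) (D 1 x s) * dot (D 1 x s) (D 1 x s)) • (D 1 x' s + D 1 x s) := by
  rw [sexticGrad]
  filter_upwards [coeFn_sqOne hL x', coeFn_sqOne hL x, Lp.coeFn_add (D 1 x') (D 1 x),
    Lp.coeFn_add (mulL L (sqOne x') (sqOne x') + mulL L (sqOne x') (sqOne x))
      (mulL L (sqOne x) (sqOne x)),
    Lp.coeFn_add (mulL L (sqOne x') (sqOne x')) (mulL L (sqOne x') (sqOne x)),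
    coeFn_mulL (sqOne x') (sqOne x'), coeFn_mulL (sqOne x') (sqOne x),
    coeFn_mulL (sqOne x) (sqOne x),
    coeFn_smulL (mulL L (sqOne x') (sqOne x') + mulL L (sqOne x') (sqOne x)
    + mulL L (sqOne x) (sqOne x)) (D 1 x' + D 1 x)]
    with s h1 h2 h3 h4 h5 h6 h7 h8 h9
  rw [h9, h4, Pi.add_apply, h5, Pi.add_apply, h6, h7, h8, h3, Pi.add_apply, h1, h2]

variable {a b : E3} {x x' : H L 3} {y y' : H L 1} {v p n v' p' n' : ℝ → E3}

theorem integrable_quartic (hL : 0 < L) (h : IsRep L a b x y v p n) (k : ℕ) :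
    Integrable (fun s => dot (D 1 x s) (D 1 x s) ^ k) (volI L) := by
  refine (integrable_of_continuousOn ((continuousOn_dot (h.curve.cont_p hL)
    (h.curve.cont_p hL)).pow k)).congr ?_
  filter_upwards [h.e1] with s hs
  rw [hs]
  rfl

theorem integrable_weighted (hL : 0 < L) (h : IsRep L a b x y v p n) :
    Integrable (fun s => dot (D 1 x s) (D 1 x s) * dot (D 2 x s) (D 2 x s)) (volI L) := by
  refine (integrable_of_continuousOn ((continuousOn_dot (h.curve.cont_p hL)
    (h.curve.cont_p hL)).mul (continuousOn_dot (h.curve.cont_n hL) (h.curve.cont_n hL)))).congr ?_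
  filter_upwards [h.e1, h.e2] with s hs hs'
  rw [hs, hs']
  rfl

theorem quarticEnergy_sub (hL : 0 < L) (h : IsRep L a b x y v p n)
    (h' : IsRep L a b x' y' v' p' n') :
    quarticEnergy x' - quarticEnergy x = inner ℝ (D 1 x' - D 1 x) (quarticGrad x x') := by
  rw [quarticEnergy, quarticEnergy, ← integral_sub (integrable_quartic hL h' 2)
    (integrable_quartic hL h 2), inner_eq_integral]
  refine integral_congr_ae ?_
  filter_upwards [coeFn_quarticGrad hL x x', Lp.coeFn_sub (D 1 x') (D 1 x)] with s h1 h2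
  rw [h1, h2, Pi.sub_apply, dot_smul, dot_add, sub_dot, sub_dot, dot_comm (D 1 x s) (D 1 x' s)]
  ring

theorem sexticEnergy_sub (hL : 0 < L) (h : IsRep L a b x y v p n)
    (h' : IsRep L a b x' y' v' p' n') :
    sexticEnergy x' - sexticEnergy x = inner ℝ (D 1 x' - D 1 x) (sexticGrad x x') := by
  rw [sexticEnergy, sexticEnergy, ← integral_sub (integrable_quartic hL h' 3)
    (integrable_quartic hL h 3), inner_eq_integral]
  refine integral_congr_ae ?_
  filter_upwards [coeFn_sexticGrad hL x x', Lp.coeFn_sub (D 1 x') (D 1 x)] with s h1 h2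
  rw [h1, h2, Pi.sub_apply, dot_smul, dot_add, sub_dot, sub_dot, dot_comm (D 1 x s) (D 1 x' s)]
  ring

theorem weightedEnergy_sub (hL : 0 < L) (h : IsRep L a b x y v p n)
    (h' : IsRep L a b x' y' v' p' n') :
    weightedEnergy x' - weightedEnergy x = inner ℝ (D 1 x' - D 1 x) (weightedGrad x x') := by
  have key := h.curve.integral_weighted_sub hL h'.curve (h'.v0.trans h.v0.symm) h.b0 h'.b0
    (h'.vL.trans h.vL.symm) h.bL h'.bL
  rw [weightedEnergy, weightedEnergy, ← integral_sub (integrable_weighted hL h')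
    (integrable_weighted hL h), inner_eq_integral]
  refine Eq.trans (integral_congr_ae ?_) (key.trans (integral_congr_ae ?_))
  · filter_upwards [h.e1, h.e2, h'.e1, h'.e2] with s h1 h2 h3 h4
    rw [h1, h2, h3, h4]
  · filter_upwards [h.e1, h.e2, h'.e1, h'.e2, coeFn_weightedGrad hL x x',
      Lp.coeFn_sub (D 1 x') (D 1 x)] with s h1 h2 h3 h4 h5 h6
    rw [h5, h6, Pi.sub_apply, h1, h2, h3, h4]

theorem norm_sq_D_two_sub (hL : 0 < L) (h : IsRep L a b x y v p n)
    (h' : IsRep L a b x' y' v' p' n') :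
    ‖D 2 x'‖ ^ 2 - ‖D 2 x‖ ^ 2 = inner ℝ (D 1 x' - D 1 x) (- (D 3 x' + D 3 x)) := by
  have key := h.curve.integral_second_deriv_sub hL h'.curve (h'.v0.trans h.v0.symm) h.b0 h'.b0
    (h'.vL.trans h.vL.symm) h.bL h'.bL
  rw [norm_sq_eq_integral, norm_sq_eq_integral, ← integral_sub
    (integrable_dot (Lp.memLp _) (Lp.memLp _)) (integrable_dot (Lp.memLp _) (Lp.memLp _)),
    inner_eq_integral]
  refine Eq.trans (integral_congr_ae ?_) (key.trans (integral_congr_ae ?_))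
  · filter_upwards [h.e2, h'.e2] with s h2 h4
    rw [h2, h4]
  · filter_upwards [h.e1, h'.e1, Lp.coeFn_neg (D 3 x' + D 3 x), Lp.coeFn_add (D 3 x') (D 3 x),
      Lp.coeFn_sub (D 1 x') (D 1 x)] with s h1 h2 h3 h4 h5
    rw [h3, h5, Pi.sub_apply, Pi.neg_apply, h4, Pi.add_apply, h1, h2]

theorem inner_increment (hL : 0 < L) (h : IsRep L a b x y v p n)
    (h' : IsRep L a b x' y' v' p' n') :
    inner ℝ (D 1 x' - D 1 x) (D 1 y' - D 1 y) = inner ℝ (D 1 x' - D 1 x)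
      (crossLp L (linf (D 0 (toH1 x' - toH1 x))) ((1 / 2 : ℝ) • (D 3 x' + D 3 x))) := by
  have key := h.curve.integral_increment hL h'.curve (h'.v0.trans h.v0.symm) h.b0 h'.b0
    (h'.vL.trans h.vL.symm) h.bL h'.bL
  rw [inner_eq_integral, inner_eq_integral]
  refine Eq.trans (integral_congr_ae ?_) (key.trans (integral_congr_ae ?_))
  · filter_upwards [h.e1, h'.e1, Lp.coeFn_sub (D 1 x') (D 1 x), Lp.coeFn_sub (D 1 y') (D 1 y),
      h.ew, h'.ew] with s h1 h2 h3 h4 h5 h6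
    rw [h3, h4, Pi.sub_apply, Pi.sub_apply, h1, h2, h5, h6]
  · have e : D 0 (toH1 x' - toH1 x) = D 0 x' - D 0 x := rfl
    filter_upwards [h.e0, h'.e0, h.e1, h'.e1, Lp.coeFn_sub (D 1 x') (D 1 x),
      coeFn_linf hL (isWeakDeriv_D 0 (toH1 x' - toH1 x)), Lp.coeFn_sub (D 0 x') (D 0 x),
      coeFn_crossLp (linf (D 0 (toH1 x' - toH1 x))) ((1 / 2 : ℝ) • (D 3 x' + D 3 x)),
      Lp.coeFn_smul (1 / 2 : ℝ) (D 3 x' + D 3 x), Lp.coeFn_add (D 3 x') (D 3 x)]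
      with s h1 h2 h3 h4 h5 h6 h7 h8 h9 h10
    have h6' : linf (D 0 (toH1 x' - toH1 x)) s = (D 0 x' - D 0 x : L2 L) s := h6
    rw [h5, h8, h6', h7, h9, Pi.smul_apply, h10, Pi.sub_apply, Pi.sub_apply, Pi.add_apply,
      h1, h2, h3, h4]

end Energies

/-! ### Time derivatives of the energies and the conservation laws. -/

theorem eq_of_hasDerivAt_zero {F : ℝ → ℝ} (h : ∀ t, 0 < t → HasDerivAt F 0 t) {t t' : ℝ}
    (ht : 0 < t) (ht' : 0 < t') : F t = F t' :=
  isOpen_Ioi.is_const_of_deriv_eq_zero isPreconnected_Ioi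
    (fun s hs => (h s hs).differentiableAt.differentiableWithinAt) (fun s hs => (h s hs).deriv) ht ht'

namespace IsFlow

variable {L : ℝ} {a b : E3} {v : ℝ → H L 3} {vt : ℝ → H L 1}

section Continuity

variable (hL : 0 < L) (h : IsFlow L a b v vt) {t : ℝ} (ht : 0 < t)
include hL h ht

theorem continuousAt_sqOne : ContinuousAt (fun τ => sqOne (v τ)) t :=
  tendsto_clm₂ (dotL L) (h.continuousAt_linf_one hL ht) (h.continuousAt_linf_one hL ht)

theorem continuousAt_sqTwo : ContinuousAt (fun τ => sqTwo (v τ)) t :=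
  tendsto_clm₂ (dotL L) (h.continuousAt_linf_two hL ht) (h.continuousAt_linf_two hL ht)

theorem continuousAt_weightedGrad : ContinuousAt (fun τ => weightedGrad (v t) (v τ)) t := by
  have c1 := h.continuousAt_D ht 1
  have c2 := h.continuousAt_D ht 2
  have c3 := h.continuousAt_D ht 3
  have a1 : ContinuousAt (fun τ => smulL L (sqTwo (v τ)) (D 1 (v τ) + D 1 (v t))) t :=
    tendsto_clm₂ (smulL L) (h.continuousAt_sqTwo hL ht) (c1.add continuousAt_const)
  have a2 : ContinuousAt (fun τ => smulL L (mixed (v t)) (D 2 (v τ) + D 2 (v t))) t :=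
    tendsto_clm₂ (smulL L) tendsto_const_nhds (c2.add continuousAt_const)
  have a3 : ContinuousAt (fun τ => smulL L (sqOne (v t)) (D 3 (v τ) + D 3 (v t))) t :=
    tendsto_clm₂ (smulL L) tendsto_const_nhds (c3.add continuousAt_const)
  exact (a1.sub (a2.const_smul (2 : ℝ))).sub a3

theorem continuousAt_quarticGrad : ContinuousAt (fun τ => quarticGrad (v t) (v τ)) t :=
  tendsto_clm₂ (smulL L) ((h.continuousAt_sqOne hL ht).add continuousAt_const)
    ((h.continuousAt_D ht 1).add continuousAt_const)

theorem continuousAt_sexticGrad : ContinuousAt (fun τ => sexticGrad (v t) (v τ)) t := by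
  have c := h.continuousAt_sqOne hL ht
  have m1 : ContinuousAt (fun τ => mulL L (sqOne (v τ)) (sqOne (v τ))) t :=
    tendsto_clm₂ (mulL L) c c
  have m2 : ContinuousAt (fun τ => mulL L (sqOne (v τ)) (sqOne (v t))) t :=
    tendsto_clm₂ (mulL L) c tendsto_const_nhds
  exact tendsto_clm₂ (smulL L) ((m1.add m2).add continuousAt_const)
    ((h.continuousAt_D ht 1).add continuousAt_const)

end Continuity

section Derivatives

variable (hL : 0 < L) (h : IsFlow L a b v vt) {t : ℝ} (ht : 0 < t)
include hL h ht

/-- No time derivative of `D 2 (v τ)` is needed: the increment of the square is paired with that of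
`D 1 (v τ)`, which has a derivative in `L²`. -/
theorem hasDerivAt_norm_sq_D_two : HasDerivAt (fun τ => ‖D 2 (v τ)‖ ^ 2)
    (inner ℝ (D 1 (vt t)) (- (D 3 (v t) + D 3 (v t)))) t := by
  obtain ⟨v₀, p, n, hr⟩ := h.exists_isRep hL ht
  refine hasDerivAt_of_inner_increment (h.hasDerivAt_D_one ht)
    (g := fun τ => - (D 3 (v τ) + D 3 (v t)))
    ((h.continuousAt_D ht 3).add continuousAt_const).neg ?_
  filter_upwards [lt_mem_nhds ht] with τ hτ
  obtain ⟨v', p', n', hr'⟩ := h.exists_isRep hL hτ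
  exact norm_sq_D_two_sub hL hr hr'

theorem hasDerivAt_weightedEnergy : HasDerivAt (fun τ => weightedEnergy (v τ))
    (inner ℝ (D 1 (vt t)) (weightedGrad (v t) (v t))) t := by
  obtain ⟨v₀, p, n, hr⟩ := h.exists_isRep hL ht
  refine hasDerivAt_of_inner_increment (h.hasDerivAt_D_one ht)
    (g := fun τ => weightedGrad (v t) (v τ)) (h.continuousAt_weightedGrad hL ht) ?_
  filter_upwards [lt_mem_nhds ht] with τ hτ
  obtain ⟨v', p', n', hr'⟩ := h.exists_isRep hL hτ
  exact weightedEnergy_sub hL hr hr'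

theorem hasDerivAt_quarticEnergy : HasDerivAt (fun τ => quarticEnergy (v τ))
    (inner ℝ (D 1 (vt t)) (quarticGrad (v t) (v t))) t := by
  obtain ⟨v₀, p, n, hr⟩ := h.exists_isRep hL ht
  refine hasDerivAt_of_inner_increment (h.hasDerivAt_D_one ht)
    (g := fun τ => quarticGrad (v t) (v τ)) (h.continuousAt_quarticGrad hL ht) ?_
  filter_upwards [lt_mem_nhds ht] with τ hτ
  obtain ⟨v', p', n', hr'⟩ := h.exists_isRep hL hτ
  exact quarticEnergy_sub hL hr hr'

theorem hasDerivAt_sexticEnergy : HasDerivAt (fun τ => sexticEnergy (v τ))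
    (inner ℝ (D 1 (vt t)) (sexticGrad (v t) (v t))) t := by
  obtain ⟨v₀, p, n, hr⟩ := h.exists_isRep hL ht
  refine hasDerivAt_of_inner_increment (h.hasDerivAt_D_one ht)
    (g := fun τ => sexticGrad (v t) (v τ)) (h.continuousAt_sexticGrad hL ht) ?_
  filter_upwards [lt_mem_nhds ht] with τ hτ
  obtain ⟨v', p', n', hr'⟩ := h.exists_isRep hL hτ
  exact sexticEnergy_sub hL hr hr'

/-- The energy identity for the velocity, obtained from its difference quotients. -/
theorem hasDerivAt_norm_sq_velocity : HasDerivAt (fun τ => ‖D 1 (vt τ)‖ ^ 2)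
    (2 * inner ℝ (D 1 (vt t)) (crossLp L (linf (D 0 (vt t))) (D 3 (v t)))) t := by
  -- `D 1 (vt τ)` need not be differentiable in time. Its difference-quotient approximations `D 1 (q
  -- k τ)` are, since `D 1 (v τ)` is.
  set q : ℝ → ℝ → H L 1 := fun k τ => k⁻¹ • (toH1 (v (τ + k)) - toH1 (v τ)) with hq
  set M : ℝ → ℝ → L2 L := fun k τ => (1 / 2 : ℝ) • (D 3 (v (τ + k)) + D 3 (v τ)) with hM
  have hTadd : Filter.Tendsto (fun x : ℝ × ℝ => x.2 + x.1) (nhdsWithin 0 {0}ᶜ ×ˢ nhds t)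
      (nhds t) := by
    have : Filter.Tendsto (fun x : ℝ × ℝ => x.2 + x.1) (nhds (0, t)) (nhds t) := by
      have hc : Continuous (fun x : ℝ × ℝ => x.2 + x.1) := by fun_prop
      simpa using hc.tendsto (0, t)
    refine this.mono_left ?_
    rw [nhds_prod_eq]
    exact Filter.prod_mono nhdsWithin_le_nhds le_rfl
  have hTq : Filter.Tendsto (fun x : ℝ × ℝ => q x.1 x.2) (nhdsWithin 0 {0}ᶜ ×ˢ nhds t)
      (nhds (vt t)) := by
    refine tendsto_difference_quotient (f := fun τ => toH1 (v τ)) ?_ (h.cont_deriv t ht)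
    filter_upwards [lt_mem_nhds ht] with τ hτ using h.deriv τ hτ
  have hTM : Filter.Tendsto (fun x : ℝ × ℝ => M x.1 x.2) (nhdsWithin 0 {0}ᶜ ×ˢ nhds t)
      (nhds (D 3 (v t))) := by
    have c := (h.continuousAt_D ht 3).tendsto
    have := ((c.comp hTadd).add (c.comp Filter.tendsto_snd)).const_smul (1 / 2 : ℝ)
    have e : (1 / 2 : ℝ) • (D 3 (v t) + D 3 (v t)) = D 3 (v t) := by
      rw [← two_smul ℝ (D 3 (v t)), smul_smul]
      norm_num
    rw [e] at this
    exact this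
  have hTD : ∀ k : Fin 2, Filter.Tendsto (fun x : ℝ × ℝ => D k (q x.1 x.2))
      (nhdsWithin 0 {0}ᶜ ×ˢ nhds t) (nhds (D k (vt t))) := fun k =>
    ((DL L k).continuous.tendsto _).comp hTq
  have hTl := tendsto_linf hL (Filter.Eventually.of_forall fun x : ℝ × ℝ =>
    isWeakDeriv_D 0 (q x.1 x.2)) (isWeakDeriv_D 0 (vt t)) (hTD 0) (hTD 1)
  have hlim : Filter.Tendsto (fun x : ℝ × ℝ =>
      2 * inner ℝ (D 1 (q x.1 x.2)) (crossLp L (linf (D 0 (q x.1 x.2))) (M x.1 x.2)))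
      (nhdsWithin 0 {0}ᶜ ×ˢ nhds t)
      (nhds (2 * inner ℝ (D 1 (vt t)) (crossLp L (linf (D 0 (vt t))) (D 3 (v t))))) :=
    ((hTD 1).inner (tendsto_clm₂ (crossLp L) hTl hTM)).const_mul 2
  -- Letting `k → 0`, the squared norms converge pointwise and their derivatives locally uniformly;
  -- the limit of the derivatives at `t` may be used as a constant `g'`.
  refine hasDerivAt_of_tendstoUniformlyOnFilter (l := nhdsWithin (0 : ℝ) {0}ᶜ)
    (f := fun k τ => ‖D 1 (q k τ)‖ ^ 2)
    (f' := fun k τ => 2 * inner ℝ (D 1 (q k τ)) (crossLp L (linf (D 0 (q k τ))) (M k τ)))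
    (g' := fun _ => 2 * inner ℝ (D 1 (vt t)) (crossLp L (linf (D 0 (vt t))) (D 3 (v t))))
    ?_ ?_ ?_
  · rw [tendstoUniformlyOnFilter_iff_tendsto]
    exact Uniform.tendsto_nhds_right.1 hlim
  · have hne : ∀ᶠ x : ℝ × ℝ in nhdsWithin 0 {0}ᶜ ×ˢ nhds t, x.1 ≠ 0 :=
      Filter.tendsto_fst.eventually (self_mem_nhdsWithin)
    have hpos : ∀ᶠ x : ℝ × ℝ in nhdsWithin 0 {0}ᶜ ×ˢ nhds t, 0 < x.2 :=
      Filter.tendsto_snd.eventually (lt_mem_nhds ht)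
    have hpos' : ∀ᶠ x : ℝ × ℝ in nhdsWithin 0 {0}ᶜ ×ˢ nhds t, 0 < x.2 + x.1 :=
      hTadd.eventually (lt_mem_nhds ht)
    filter_upwards [hne, hpos, hpos'] with ⟨k, τ⟩ hk hτ hτk
    simp only at hk hτ hτk
    obtain ⟨v₀, p, n, hr⟩ := h.exists_isRep hL hτ
    obtain ⟨v', p', n', hr'⟩ := h.exists_isRep hL hτk
    have hd : HasDerivAt (fun τ => D 1 (q k τ)) (k⁻¹ • (D 1 (vt (τ + k)) - D 1 (vt τ))) τ :=
      (((h.hasDerivAt_D_one hτk).comp_add_const τ k).sub (h.hasDerivAt_D_one hτ)).const_smul k⁻¹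
    refine hd.norm_sq.congr_deriv ?_
    have e1 : D 1 (q k τ) = k⁻¹ • (D 1 (v (τ + k)) - D 1 (v τ)) := rfl
    have e0 : D 0 (q k τ) = k⁻¹ • D 0 (toH1 (v (τ + k)) - toH1 (v τ)) := rfl
    have hw := isWeakDeriv_D 0 (toH1 (v (τ + k)) - toH1 (v τ))
    have e2 : linf (D 0 (q k τ)) = k⁻¹ • linf (D 0 (toH1 (v (τ + k)) - toH1 (v τ))) := by
      rw [e0]
      refine Lp.ext ?_
      filter_upwards [coeFn_linf hL (hw.smul k⁻¹), coeFn_linf hL hw,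
        Lp.coeFn_smul k⁻¹ (linf (D 0 (toH1 (v (τ + k)) - toH1 (v τ)))),
        Lp.coeFn_smul k⁻¹ (D 0 (toH1 (v (τ + k)) - toH1 (v τ)))] with s h1 h2 h3 h4
      have h1' : linf (k⁻¹ • D 0 (toH1 (v (τ + k)) - toH1 (v τ))) s
        = (k⁻¹ • D 0 (toH1 (v (τ + k)) - toH1 (v τ)) : L2 L) s := h1
      have h2' : linf (D 0 (toH1 (v (τ + k)) - toH1 (v τ))) s
        = D 0 (toH1 (v (τ + k)) - toH1 (v τ)) s := h2
      rw [h1', h4, h3, Pi.smul_apply, Pi.smul_apply, h2']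
    -- Both scalar products carry the factor `k⁻¹ * k⁻¹`, and `inner_increment` removes the
    -- increment of `D 1 (vt τ)`. This keeps the derivatives bounded as `k → 0`.
    rw [e2, e1, map_smul (crossLp L) k⁻¹, _root_.smul_apply, real_inner_smul_left,
      real_inner_smul_left, real_inner_smul_right, real_inner_smul_right,
      inner_increment hL hr hr']
  · filter_upwards [lt_mem_nhds ht] with τ hτ
    have h1 := (h.hasDerivAt_D_one hτ).tendsto_slope_zero
    exact (h1.norm).pow 2

end Derivatives

section Laws

variable (hL : 0 < L) (h : IsFlow L a b v vt)
include hL h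

theorem first_law {t t' : ℝ} (ht : 0 < t) (ht' : 0 < t') :
    ‖D 1 (v t)‖ ^ 2 = ‖D 1 (v t')‖ ^ 2 := by
  refine eq_of_hasDerivAt_zero (F := fun t => ‖D 1 (v t)‖ ^ 2) (fun t ht => ?_) ht ht'
  refine (h.hasDerivAt_D_one ht).norm_sq.congr_deriv ?_
  obtain ⟨v₀, p, n, hr⟩ := h.exists_isRep hL ht
  rw [real_inner_comm, inner_eq_integral, integral_dot_congr hr.ew hr.e1,
    hr.curve.integral_first_law hL hr.b0 hr.bL, mul_zero]

theorem second_law {t t' : ℝ} (ht : 0 < t) (ht' : 0 < t') :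
    ‖D 2 (v t)‖ ^ 2 - 5 / 4 * quarticEnergy (v t)
      = ‖D 2 (v t')‖ ^ 2 - 5 / 4 * quarticEnergy (v t') := by
  refine eq_of_hasDerivAt_zero (F := fun t => ‖D 2 (v t)‖ ^ 2 - 5 / 4 * quarticEnergy (v t))
    (fun t ht => ?_) ht ht'
  have hd := (h.hasDerivAt_norm_sq_D_two hL ht).sub
    ((h.hasDerivAt_quarticEnergy hL ht).const_mul (5 / 4))
  refine hd.congr_deriv ?_
  obtain ⟨v₀, p, n, hr⟩ := h.exists_isRep hL ht
  have e : ∀ (c : ℝ) (x y : L2 L), c * inner ℝ x y = inner ℝ x (c • y) :=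
    fun c x y => (real_inner_smul_right x y c).symm
  rw [e, ← inner_sub_right, inner_eq_integral]
  have key := hr.curve.integral_second_law hL hr.b0 hr.bL
  rw [← neg_eq_zero, ← integral_neg] at key
  refine (integral_congr_ae ?_).trans key
  filter_upwards [hr.ew, hr.e1, coeFn_quarticGrad hL (v t) (v t),
    Lp.coeFn_sub (- (D 3 (v t) + D 3 (v t))) ((5 / 4 : ℝ) • quarticGrad (v t) (v t)),
    Lp.coeFn_smul (5 / 4 : ℝ) (quarticGrad (v t) (v t)), Lp.coeFn_neg (D 3 (v t) + D 3 (v t)),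
    Lp.coeFn_add (D 3 (v t)) (D 3 (v t))] with s h1 h2 h3 h4 h5 h6 h7
  rw [h4, Pi.sub_apply, h5, Pi.smul_apply, h6, Pi.neg_apply, h7, Pi.add_apply, h3, h1, h2]
  simp only [dot, PiLp.add_apply, PiLp.sub_apply, PiLp.neg_apply, PiLp.smul_apply, smul_eq_mul]
  ring

theorem third_law {t t' : ℝ} (ht : 0 < t) (ht' : 0 < t') :
    ‖D 1 (vt t)‖ ^ 2 - 5 / 2 * weightedEnergy (v t) + 21 / 8 * sexticEnergy (v t)
      = ‖D 1 (vt t')‖ ^ 2 - 5 / 2 * weightedEnergy (v t') + 21 / 8 * sexticEnergy (v t') := by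
  refine eq_of_hasDerivAt_zero (F := fun t => ‖D 1 (vt t)‖ ^ 2 - 5 / 2 * weightedEnergy (v t)
    + 21 / 8 * sexticEnergy (v t)) (fun t ht => ?_) ht ht'
  have hd := ((h.hasDerivAt_norm_sq_velocity hL ht).sub
    ((h.hasDerivAt_weightedEnergy hL ht).const_mul (5 / 2))).add
    ((h.hasDerivAt_sexticEnergy hL ht).const_mul (21 / 8))
  refine hd.congr_deriv ?_
  obtain ⟨v₀, p, n, hr⟩ := h.exists_isRep hL ht
  have e : ∀ (c : ℝ) (x y : L2 L), c * inner ℝ x y = inner ℝ x (c • y) :=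
    fun c x y => (real_inner_smul_right x y c).symm
  rw [e, e, e, ← inner_sub_right,
    ← inner_add_right, inner_eq_integral]
  set X := crossLp L (linf (D 0 (vt t))) (D 3 (v t)) with hX
  set W := weightedGrad (v t) (v t) with hW
  set S := sexticGrad (v t) (v t) with hS
  refine (integral_congr_ae ?_).trans (hr.curve.integral_third_law hL hr.b0 hr.bL)
  filter_upwards [hr.ew, hr.e1, hr.e2, hr.eu, coeFn_weightedGrad hL (v t) (v t),
    coeFn_sexticGrad hL (v t) (v t), coeFn_crossLp (linf (D 0 (vt t))) (D 3 (v t)),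
    coeFn_linf hL (isWeakDeriv_D 0 (vt t)),
    Lp.coeFn_add ((2 : ℝ) • X - (5 / 2 : ℝ) • W) ((21 / 8 : ℝ) • S),
    Lp.coeFn_sub ((2 : ℝ) • X) ((5 / 2 : ℝ) • W), Lp.coeFn_smul (2 : ℝ) X,
    Lp.coeFn_smul (5 / 2 : ℝ) W, Lp.coeFn_smul (21 / 8 : ℝ) S]
    with s h1 h2 h3 h4 h5 h6 h7 h8 h9 h10 h11 h12 h13
  have h8' : linf (D 0 (vt t)) s = D 0 (vt t) s := h8
  rw [← hW] at h5
  rw [← hS] at h6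
  rw [← hX] at h7
  rw [h9, Pi.add_apply, h10, Pi.sub_apply, h11, h12, h13, Pi.smul_apply, Pi.smul_apply,
    Pi.smul_apply, h5, h6, h7, h8', h1, h2, h3, h4]
  generalize cross (p s) (n s) + cross (v₀ s) (D 3 (v t) s) = w
  generalize cross (cross (v₀ s) (n s)) (D 3 (v t) s) = z
  simp only [dot, PiLp.add_apply, PiLp.sub_apply, PiLp.smul_apply, smul_eq_mul]
  ring

end Laws

end IsFlow

/-! ### The Poincaré inequality and the derivatives of the arc. -/

theorem IsPrim.of_contDiffOn {L : ℝ} (hL : 0 < L) {f f' : ℝ → ℝ} (hf : ContDiffOn ℝ 1 f (Icc 0 L))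
    (hd : ∀ s ∈ Ioo 0 L, HasDerivAt f (f' s) s) : IsPrim L f f' := by
  refine ⟨ContDiffOn.absolutelyContinuousOnInterval (by rwa [uIcc_of_le hL.le]), ?_⟩
  filter_upwards [ae_restrict_mem measurableSet_Ioo] with s hs using hd s hs

/-- The Poincaré inequality with the (almost) optimal constant. -/
theorem poincare {L r : ℝ} (hL : 0 < L) (hr : L < Real.pi * r) {f f' : ℝ → E3}
    (h : IsPrimV L f f') (hf' : MemLp f' 2 (volI L)) (h0 : f 0 = 0) (h1 : f L = 0) :
    ∫ s in Ioo 0 L, dot (f s) (f s) ≤ r ^ 2 * ∫ s in Ioo 0 L, dot (f' s) (f' s) := by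
  have hr0 : 0 < r := by
    by_contra hn
    nlinarith [Real.pi_pos]
  -- The shift centres `[0, L]` in an interval of length `π r`, so the sine below has no zero on the
  -- closed interval.
  set δ := (Real.pi * r - L) / 2 with hδ
  have hδ0 : 0 < δ := by rw [hδ]; linarith
  have hsin : ∀ s ∈ Icc 0 L, 0 < Real.sin ((s + δ) / r) := fun s hs => by
    refine Real.sin_pos_of_pos_of_lt_pi (div_pos (by linarith [hs.1]) hr0) ?_
    rw [div_lt_iff₀ hr0]
    linarith [hs.2]
  -- A solution of the Riccati equation `c' = -(r⁻² + c²)`. With it, `|f' - c f|² = |f'|² - r⁻² |f|²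
  -- - (c |f|²)'`, and the last term integrates to zero.
  set c : ℝ → ℝ := fun s => Real.cos ((s + δ) / r) / Real.sin ((s + δ) / r) / r with hc
  have hcp : IsPrim L c (fun s => - (1 / r ^ 2 + c s ^ 2)) := by
    refine IsPrim.of_contDiffOn hL ?_ fun s hs => ?_
    · refine ContDiffOn.div_const (ContDiffOn.div ?_ ?_ fun s hs => (hsin s hs).ne') r
      · exact ContDiff.contDiffOn (by fun_prop)
      · exact ContDiff.contDiffOn (by fun_prop)
    · have hne := (hsin s (Ioo_subset_Icc_self hs)).ne'
      have hl : HasDerivAt (fun s => (s + δ) / r) (1 / r) s :=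
        ((hasDerivAt_id s).add_const δ).div_const r
      have := (hl.cos.div hl.sin hne).div_const r
      refine this.congr_deriv ?_
      have hr' := hr0.ne'
      simp only [hc]
      field_simp
      ring
  have hfc := h.continuousOn hL
  have hQ := (h.dot h).mul hcp
  have hI := hQ.integral_eq hL
  have hz : dot (0 : E3) 0 = 0 := by simp [dot]
  rw [h0, h1, hz, zero_mul, zero_mul, sub_zero] at hI
  have i1 : Integrable (fun s => dot (f s) (f s)) (volI L) :=
    integrable_of_continuousOn (continuousOn_dot hfc hfc)
  have i2 := integrable_dot hf' hf'
  have hle : ∫ s in Ioo 0 L, (1 / r ^ 2 * dot (f s) (f s) + ((dot (f' s) (f s)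
      + dot (f s) (f' s)) * c s + dot (f s) (f s) * -(1 / r ^ 2 + c s ^ 2)))
      ≤ ∫ s in Ioo 0 L, dot (f' s) (f' s) := by
    refine integral_mono ((i1.const_mul _).add (hQ.integrableOn hL)) i2 fun s => ?_
    have := dot_self_nonneg (f' s - c s • f s)
    simp only [dot_sub, sub_dot, dot_smul, smul_dot] at this
    nlinarith
  rw [integral_add (i1.const_mul _) (hQ.integrableOn hL), hI, add_zero, integral_const_mul] at hle
  have hr2 : 0 < r ^ 2 := by positivity
  rw [one_div, inv_mul_le_iff₀ hr2] at hle
  exact hle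

theorem hasDerivAt_of_components {f : ℝ → E3} {f' : E3} {s : ℝ}
    (h : ∀ i, HasDerivAt (fun s => f s i) (f' i) s) : HasDerivAt f f' s := by
  have h1 : HasDerivAt (fun s => WithLp.ofLp (f s)) (WithLp.ofLp f') s := hasDerivAt_pi.2 h
  exact ((PiLp.continuousLinearEquiv 2 ℝ (fun _ : Fin 3 => ℝ)).symm.toContinuousLinearMap).hasFDerivAt.comp_hasDerivAt
    s h1

/-- The derivative of the arc. -/
def arcDeriv (R s : ℝ) : E3 := !₂[-(Real.sin (s / R) / R), -(Real.cos (s / R) / R), 0]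

theorem hasDerivAt_arc (R s : ℝ) : HasDerivAt (arc R) (arcDeriv R s) s := by
  refine hasDerivAt_of_components fun i => ?_
  have hl : HasDerivAt (fun s => s / R) (1 / R) s := (hasDerivAt_id s).div_const R
  fin_cases i
  · simpa [arc, arcDeriv, div_eq_mul_inv] using hl.cos
  · refine hl.sin.neg.congr_deriv ?_
    simp [arcDeriv, div_eq_mul_inv]
  · simpa [arc, arcDeriv] using hasDerivAt_const s (0 : ℝ)

theorem hasDerivAt_arcDeriv (R s : ℝ) : HasDerivAt (arcDeriv R) (-(R⁻¹ ^ 2) • arc R s) s := by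
  refine hasDerivAt_of_components fun i => ?_
  have hl : HasDerivAt (fun s => s / R) (1 / R) s := (hasDerivAt_id s).div_const R
  fin_cases i
  · refine (hl.sin.div_const R).neg.congr_deriv ?_
    simp [arc]; ring
  · refine (hl.cos.div_const R).neg.congr_deriv ?_
    simp [arc]; ring
  · simpa [arc, arcDeriv] using hasDerivAt_const s (0 : ℝ)

theorem iteratedDeriv_one_arc (R : ℝ) : iteratedDeriv 1 (arc R) = arcDeriv R := by
  rw [iteratedDeriv_one]
  exact funext fun s => (hasDerivAt_arc R s).deriv

theorem iteratedDeriv_two_arc (R : ℝ) :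
    iteratedDeriv 2 (arc R) = fun s => -(R⁻¹ ^ 2) • arc R s := by
  rw [iteratedDeriv_succ, iteratedDeriv_one_arc]
  exact funext fun s => (hasDerivAt_arcDeriv R s).deriv

theorem iteratedDeriv_three_arc (R : ℝ) :
    iteratedDeriv 3 (arc R) = fun s => -(R⁻¹ ^ 2) • arcDeriv R s := by
  rw [iteratedDeriv_succ, iteratedDeriv_two_arc]
  exact funext fun s => ((hasDerivAt_arc R s).const_smul (-(R⁻¹ ^ 2))).deriv

theorem coeFn_vR (L R : ℝ) (k : Fin 4) :
    D k (vR L R) =ᵐ[volI L] iteratedDeriv (k : ℕ) (arc R) :=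
  (memLp_of_continuous L ((contDiff_arc R).continuous_iteratedDeriv (k : ℕ)
    (by exact_mod_cast le_top))).coeFn_toLp

theorem isPrimV_arc (L R : ℝ) : IsPrimV L (arc R) (arcDeriv R) :=
  IsPrimV.of_contDiff ((contDiff_arc R).of_le (by simp)) (hasDerivAt_arc R)

theorem isPrimV_arcDeriv (L R : ℝ) :
    IsPrimV L (arcDeriv R) (fun s => -(R⁻¹ ^ 2) • arc R s) := by
  refine IsPrimV.of_contDiff ?_ (hasDerivAt_arcDeriv R)
  rw [← iteratedDeriv_one_arc, iteratedDeriv_one]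
  exact ((contDiff_infty_iff_deriv.1 (contDiff_arc R)).2).of_le (by simp)

theorem dot_arc (R s : ℝ) : dot (arc R s) (arc R s) = 1 := by
  simp [dot, arc]
  nlinarith [Real.sin_sq_add_cos_sq (s / R)]

theorem dot_arcDeriv (R s : ℝ) : dot (arcDeriv R s) (arcDeriv R s) = R⁻¹ ^ 2 := by
  simp [dot, arcDeriv, div_eq_mul_inv]
  linear_combination (R⁻¹ ^ 2) * Real.sin_sq_add_cos_sq (s * R⁻¹)

theorem arc_zero (R : ℝ) : arc R 0 = e₁ := by
  simp [arc, e₁]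

/-! ### Reduction of the stability estimate to real inequalities. -/

/-- Numerical relations, at a fixed time, between the norms `X`, `A`, `B`, `G` of the perturbation
and its derivatives and the integrals `u`, `w`, `r`, `q`, `m` entering the conservation laws. -/
structure StaticBounds (L κ μ X A B G u w r q m : ℝ) : Prop where
  X_nonneg : 0 ≤ X
  A_nonneg : 0 ≤ A
  B_nonneg : 0 ≤ B
  u_nonneg : 0 ≤ u
  r_nonneg : 0 ≤ r
  m_nonneg : 0 ≤ m
  poincare : X ^ 2 ≤ μ * A ^ 2
  interp : A ^ 2 ≤ X * B
  amplitude : X ^ 2 ≤ 4 * L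
  r_le : r ≤ (8 * κ + 2 * (A ^ 2 / L + 2 * A * B)) * A ^ 2
  B_le : B ^ 2 ≤ 2 * (u + r) + 2 * κ ^ 2 * X ^ 2
  u_le : u ≤ 2 * B ^ 2 + 2 * κ ^ 2 * X ^ 2
  q_le : |q| ≤ (2 * κ + 2 * (A ^ 2 / L + 2 * A * B)) * r
  m_le : m ≤ (2 * κ + 2 * (A ^ 2 / L + 2 * A * B)) * u
  w_le : w ≤ 2 * ((2 * κ + 2 * (A ^ 2 / L + 2 * A * B)) * (u + r)
    + (2 * G ^ 2 + 2 * κ ^ 2 * A ^ 2))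
  G_le : G ^ 2 ≤ 2 * (12 * (2 * κ + 2 * (A ^ 2 / L + 2 * A * B)) * u + 3 * w
    + 3 * (2 * κ + 2 * (A ^ 2 / L + 2 * A * B)) * r) + 2 * κ ^ 2 * A ^ 2

theorem dot_add_self_le (x y : E3) : dot (x + y) (x + y) ≤ 2 * dot x x + 2 * dot y y := by
  have := dot_self_nonneg (x - y)
  simp only [dot_add, add_dot, dot_sub, sub_dot, dot_comm y x] at this ⊢
  linarith

theorem coeFn_D_sub {L : ℝ} (x x' : H L 3) (k : Fin 4) :
    D k (x - x') =ᵐ[volI L] fun s => D k x s - D k x' s := Lp.coeFn_sub (D k x) (D k x')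

-- All analysis at a fixed time is collected here. Expanding the conserved integrals in powers of `ρ
-- = |v_s|² - κ` leaves, besides constants, only `∫ ρ = A² - κ X²` and the integrals `u`, `w`, `r`,
-- `q`, `m` of `|U|²`, `|U_s|²`, `ρ²`, `ρ³` and `|v_s|² |U|²`.
set_option maxHeartbeats 1600000 in
theorem exists_staticBounds {L R ℓ : ℝ} (hL : 0 < L) (hℓ : L < Real.pi * ℓ)
    {x : H L 3} {y : H L 1} {v p n : ℝ → E3} (h : IsRep L e₁ (arc R L) x y v p n) :
    ∃ u w r q m : ℝ, StaticBounds L (R⁻¹ ^ 2) (ℓ ^ 2) ‖D 0 (x - vR L R)‖ ‖D 1 (x - vR L R)‖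
        ‖D 2 (x - vR L R)‖ ‖D 3 (x - vR L R)‖ u w r q m ∧
      ‖D 1 x‖ ^ 2 = R⁻¹ ^ 2 * L + (‖D 1 (x - vR L R)‖ ^ 2 - R⁻¹ ^ 2 * ‖D 0 (x - vR L R)‖ ^ 2) ∧
      ‖D 2 x‖ ^ 2 - 5 / 4 * quarticEnergy x = u - 1 / 4 * ((R⁻¹ ^ 2) ^ 2 * L
        + 2 * R⁻¹ ^ 2 * (‖D 1 (x - vR L R)‖ ^ 2 - R⁻¹ ^ 2 * ‖D 0 (x - vR L R)‖ ^ 2) + r) ∧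
      ‖D 1 y‖ ^ 2 - 5 / 2 * weightedEnergy x + 21 / 8 * sexticEnergy x = w - 5 / 2 * m
        + 1 / 8 * ((R⁻¹ ^ 2) ^ 3 * L + 3 * (R⁻¹ ^ 2) ^ 2 * (‖D 1 (x - vR L R)‖ ^ 2
          - R⁻¹ ^ 2 * ‖D 0 (x - vR L R)‖ ^ 2) + 3 * R⁻¹ ^ 2 * r + q) := by
  set κ := R⁻¹ ^ 2 with hκ
  have hκ0 : 0 ≤ κ := by positivity
  have hc := h.curve
  have cv := hc.cont_v hL
  have cp := hc.cont_p hL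
  have cn := hc.cont_n hL
  -- the perturbation and its derivatives
  have pa := isPrimV_arc L R
  have pa1 := isPrimV_arcDeriv L R
  have pf0 := hc.hv.sub pa
  have pf1 := hc.hp.sub pa1
  have pf2 : IsPrimV L (fun s => n s - -κ • arc R s) (fun s => D 3 x s - -κ • arcDeriv R s) :=
    hc.hn.sub (pa.const_smul (-κ))
  set f0 : ℝ → E3 := fun s => v s - arc R s with hf0
  set f1 : ℝ → E3 := fun s => p s - arcDeriv R s with hf1
  set f2 : ℝ → E3 := fun s => n s - -κ • arc R s with hf2
  set f3 : ℝ → E3 := fun s => D 3 x s - -κ • arcDeriv R s with hf3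
  have c0 := pf0.continuousOn hL
  have c1 := pf1.continuousOn hL
  have c2 := pf2.continuousOn hL
  have ca1 := pa1.continuousOn hL
  have m3 : MemLp f3 2 (volI L) :=
    hc.hj.sub (memLp_of_continuousOn (ca1.const_smul (-κ)))
  have E0 : D 0 (x - vR L R) =ᵐ[volI L] f0 := by
    filter_upwards [coeFn_D_sub x (vR L R) 0, coeFn_vR L R 0, h.e0] with s h1 h2 h3
    rw [h1, h2, h3]; simp [hf0]
  have E1 : D 1 (x - vR L R) =ᵐ[volI L] f1 := by
    filter_upwards [coeFn_D_sub x (vR L R) 1, coeFn_vR L R 1, h.e1] with s h1 h2 h3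
    rw [h1, h2, h3, hf1, ← iteratedDeriv_one_arc]; rfl
  have E2 : D 2 (x - vR L R) =ᵐ[volI L] f2 := by
    filter_upwards [coeFn_D_sub x (vR L R) 2, coeFn_vR L R 2, h.e2] with s h1 h2 h3
    have e : ((2 : Fin 4) : ℕ) = 2 := rfl
    rw [h1, h2, h3, e, iteratedDeriv_two_arc]
  have E3' : D 3 (x - vR L R) =ᵐ[volI L] f3 := by
    filter_upwards [coeFn_D_sub x (vR L R) 3, coeFn_vR L R 3] with s h1 h2
    have e : ((3 : Fin 4) : ℕ) = 3 := rfl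
    rw [h1, h2, e, iteratedDeriv_three_arc]
  have N0 : ∫ s in Ioo 0 L, dot (f0 s) (f0 s) = ‖D 0 (x - vR L R)‖ ^ 2 := by
    rw [norm_sq_eq_integral]; exact (integral_dot_congr E0 E0).symm
  have N1 : ∫ s in Ioo 0 L, dot (f1 s) (f1 s) = ‖D 1 (x - vR L R)‖ ^ 2 := by
    rw [norm_sq_eq_integral]; exact (integral_dot_congr E1 E1).symm
  have N2 : ∫ s in Ioo 0 L, dot (f2 s) (f2 s) = ‖D 2 (x - vR L R)‖ ^ 2 := by
    rw [norm_sq_eq_integral]; exact (integral_dot_congr E2 E2).symm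
  have N3 : ∫ s in Ioo 0 L, dot (f3 s) (f3 s) = ‖D 3 (x - vR L R)‖ ^ 2 := by
    rw [norm_sq_eq_integral]; exact (integral_dot_congr E3' E3').symm
  have X0 := norm_nonneg (D 0 (x - vR L R))
  have A0 := norm_nonneg (D 1 (x - vR L R))
  have B0 := norm_nonneg (D 2 (x - vR L R))
  set X := ‖D 0 (x - vR L R)‖
  set A := ‖D 1 (x - vR L R)‖
  set B := ‖D 2 (x - vR L R)‖
  set G := ‖D 3 (x - vR L R)‖
  -- Agmon's bound for the supremum of `|φ_s|²`.
  set M := A ^ 2 / L + 2 * A * B with hM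
  have hM0 : 0 ≤ M := by positivity
  have hsup : ∀ s ∈ Icc 0 L, dot (f1 s) (f1 s) ≤ M := fun s hs =>
    dot_self_le_of_isPrimV hL pf1 (memLp_of_continuousOn c2) A0 B0 N1 N2 hs
  have z0 : f0 0 = 0 := by rw [hf0]; simp only [h.v0, arc_zero, sub_self]
  have zL : f0 L = 0 := by rw [hf0]; simp only [h.vL, sub_self]
  have hz : ∀ a : E3, dot a 0 = 0 := fun a => by simp [dot]
  -- velocity
  set U : ℝ → E3 := fun s => cross (v s) (n s) with hU
  set W : ℝ → E3 := fun s => cross (p s) (n s) + cross (v s) (D 3 x s) with hW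
  have cU : ContinuousOn U (Icc 0 L) := continuousOn_cross cv cn
  have mW : MemLp W 2 (volI L) := hc.memLp_velocity_deriv hL
  have iW := integrable_dot mW mW
  -- the quantity ρ
  set ρ : ℝ → ℝ := fun s => dot (p s) (p s) - κ with hρ
  have cpp := continuousOn_dot cp cp
  have cUU := continuousOn_dot cU cU
  have cρ : ContinuousOn ρ (Icc 0 L) := cpp.sub continuousOn_const
  have iρ := integrable_of_continuousOn cρ
  have iρ2 : Integrable (fun s => ρ s ^ 2) (volI L) := integrable_of_continuousOn (cρ.pow 2)
  have iρ3 : Integrable (fun s => ρ s ^ 3) (volI L) := integrable_of_continuousOn (cρ.pow 3)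
  have ip2 : Integrable (fun s => dot (p s) (p s) ^ 2) (volI L) :=
    integrable_of_continuousOn (cpp.pow 2)
  have ip3 : Integrable (fun s => dot (p s) (p s) ^ 3) (volI L) :=
    integrable_of_continuousOn (cpp.pow 3)
  have iU := integrable_of_continuousOn cUU
  have i0 := integrable_of_continuousOn (continuousOn_dot c0 c0)
  have i1 := integrable_of_continuousOn (continuousOn_dot c1 c1)
  have i2 := integrable_of_continuousOn (continuousOn_dot c2 c2)
  have i3 := integrable_dot m3 m3
  have iPU : Integrable (fun s => dot (p s) (p s) * dot (U s) (U s)) (volI L) :=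
    integrable_of_continuousOn (cpp.mul cUU)
  have hpf : ∀ s, dot (p s) (p s) = dot (f1 s) (f1 s) + 2 * dot (arcDeriv R s) (f1 s) + κ := by
    intro s
    have e : p s = f1 s + arcDeriv R s := by rw [hf1]; simp
    rw [e, dot_add, add_dot, add_dot, dot_arcDeriv, dot_comm (f1 s) (arcDeriv R s)]; ring
  have hρf : ∀ s, ρ s = dot (f1 s) (f1 s) + 2 * dot (arcDeriv R s) (f1 s) := fun s => by
    rw [hρ]; simp only [hpf s]; ring
  have hcs : ∀ s, dot (arcDeriv R s) (f1 s) ^ 2 ≤ κ * dot (f1 s) (f1 s) := fun s => by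
    have := dot_sq_le (arcDeriv R s) (f1 s)
    rwa [dot_arcDeriv] at this
  have hnn : ∀ s, 0 ≤ dot (f1 s) (f1 s) := fun s => dot_self_nonneg _
  have hpp0 : ∀ s, 0 ≤ dot (p s) (p s) := fun s => dot_self_nonneg _
  have hUU0 : ∀ s, 0 ≤ dot (U s) (U s) := fun s => dot_self_nonneg _
  have hp_le : ∀ s ∈ Icc 0 L, dot (p s) (p s) ≤ 2 * κ + 2 * M := fun s hs => by
    have e : p s = f1 s + arcDeriv R s := by rw [hf1]; simp
    have := dot_add_self_le (f1 s) (arcDeriv R s)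
    rw [← e, dot_arcDeriv] at this
    linarith [hsup s hs]
  have hρ_le : ∀ s ∈ Icc 0 L, |ρ s| ≤ 2 * κ + 2 * M := fun s hs => by
    have h1 := hp_le s hs
    rw [abs_le]
    constructor
    · change _ ≤ dot (p s) (p s) - κ
      linarith [hpp0 s]
    · change dot (p s) (p s) - κ ≤ _
      linarith
  -- From `ρ = |φ_s|² + 2 v^R_s · φ_s` one gets `ρ² ≤ 2 |φ_s|⁴ + 8 κ |φ_s|²`.
  have hρ2_le : ∀ s ∈ Icc 0 L, ρ s ^ 2 ≤ (8 * κ + 2 * M) * dot (f1 s) (f1 s) := fun s hs => by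
    rw [hρf]
    nlinarith [hcs s, hnn s, hsup s hs, sq_nonneg (dot (f1 s) (f1 s) - 2 * dot (arcDeriv R s) (f1 s)),
      mul_le_mul_of_nonneg_left (hsup s hs) (hnn s)]
  have hψ : ∀ s, f2 s + κ • f0 s = n s + κ • v s := fun s => by
    simp only [hf2, hf0, smul_sub, neg_smul]; abel
  have hψ' : ∀ s, f3 s + κ • f1 s = D 3 x s + κ • p s := fun s => by
    simp only [hf3, hf1, smul_sub, neg_smul]; abel
  have hψ2 : ∀ s ∈ Icc 0 L, dot (f2 s + κ • f0 s) (f2 s + κ • f0 s) = dot (U s) (U s) + ρ s ^ 2 :=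
    fun s hs => by rw [hψ, dot_add_smul_self (hc.unit s hs) (hc.dot_vn hL s hs)]
  have hn2 : ∀ s ∈ Icc 0 L, dot (n s) (n s) = dot (U s) (U s) + dot (p s) (p s) ^ 2 :=
    fun s hs => by
      have := dot_velocity_self (hc.unit s hs) (hc.dot_vn hL s hs)
      rw [hU]; linarith
  have hfa : ∀ s ∈ Icc 0 L, dot (arc R s) (f0 s) = - (1 / 2) * dot (f0 s) (f0 s) := fun s hs => by
    have h1 := hc.unit s hs
    have e : v s = f0 s + arc R s := by rw [hf0]; simp
    rw [e, dot_add, add_dot, add_dot, dot_arc, dot_comm (f0 s) (arc R s)] at h1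
    linarith
  have hreal : (volI L).real univ = L := by simp [hL.le]
  -- integrals
  have Iρ : ∫ s in Ioo 0 L, ρ s = A ^ 2 - κ * X ^ 2 := by
    have Q := (pa1.dot pf0).const_mul 2
    have hQ := Q.integral_eq hL
    simp only [z0, zL, hz, mul_zero, sub_zero] at hQ
    have e : ∫ s in Ioo 0 L, ρ s = ∫ s in Ioo 0 L, ((dot (f1 s) (f1 s) - κ * dot (f0 s) (f0 s))
        + 2 * (dot (-(R⁻¹ ^ 2) • arc R s) (f0 s) + dot (arcDeriv R s) (f1 s))) := by
      refine setIntegral_congr_fun measurableSet_Ioo fun s hs => ?_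
      rw [hρf s, smul_dot, hfa s (Ioo_subset_Icc_self hs), ← hκ]; ring
    rw [e, integral_add (Integrable.sub' i1 (i0.const_mul κ)) (Q.integrableOn hL), hQ, add_zero,
      integral_sub i1 (i0.const_mul κ), integral_const_mul, N0, N1]
  have Ip : ‖D 1 x‖ ^ 2 = κ * L + (A ^ 2 - κ * X ^ 2) := by
    rw [norm_sq_eq_integral, integral_dot_congr h.e1 h.e1, ← Iρ]
    have : ∫ s in Ioo 0 L, dot (p s) (p s) = ∫ s in Ioo 0 L, (κ + ρ s) := by
      congr 1; ext s; rw [hρ]; ring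
    rw [this, integral_add (integrable_const _) iρ, integral_const, hreal, smul_eq_mul]
    ring
  have Iq : quarticEnergy x = κ ^ 2 * L + 2 * κ * (A ^ 2 - κ * X ^ 2)
      + ∫ s in Ioo 0 L, ρ s ^ 2 := by
    have : quarticEnergy x = ∫ s in Ioo 0 L, (κ ^ 2 + 2 * κ * ρ s + ρ s ^ 2) := by
      refine integral_congr_ae ?_
      filter_upwards [h.e1] with s hs
      rw [hs, hρ]; ring
    rw [this, integral_add (Integrable.fun_add (integrable_const _) (iρ.const_mul _)) iρ2,
      integral_add (integrable_const _) (iρ.const_mul _), integral_const, hreal, smul_eq_mul,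
      integral_const_mul, Iρ]
    ring
  have Is : sexticEnergy x = κ ^ 3 * L + 3 * κ ^ 2 * (A ^ 2 - κ * X ^ 2)
      + 3 * κ * (∫ s in Ioo 0 L, ρ s ^ 2) + ∫ s in Ioo 0 L, ρ s ^ 3 := by
    have : sexticEnergy x = ∫ s in Ioo 0 L, (κ ^ 3 + 3 * κ ^ 2 * ρ s + 3 * κ * ρ s ^ 2 + ρ s ^ 3) := by
      refine integral_congr_ae ?_
      filter_upwards [h.e1] with s hs
      rw [hs, hρ]; ring
    rw [this, integral_add (Integrable.fun_add (Integrable.fun_add (integrable_const _)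
        (iρ.const_mul _)) (iρ2.const_mul _)) iρ3,
      integral_add (Integrable.fun_add (integrable_const _) (iρ.const_mul _)) (iρ2.const_mul _),
      integral_add (integrable_const _) (iρ.const_mul _), integral_const, hreal, smul_eq_mul,
      integral_const_mul, integral_const_mul, Iρ]
    ring
  have In : ‖D 2 x‖ ^ 2 = (∫ s in Ioo 0 L, dot (U s) (U s)) + quarticEnergy x := by
    have e : quarticEnergy x = ∫ s in Ioo 0 L, dot (p s) (p s) ^ 2 := by
      refine integral_congr_ae ?_
      filter_upwards [h.e1] with s hs
      rw [hs]
    rw [norm_sq_eq_integral, integral_dot_congr h.e2 h.e2, e,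
      ← integral_add iU ip2]
    exact setIntegral_congr_fun measurableSet_Ioo fun s hs => hn2 s (Ioo_subset_Icc_self hs)
  have Iw : weightedEnergy x = (∫ s in Ioo 0 L, dot (p s) (p s) * dot (U s) (U s))
      + sexticEnergy x := by
    have e : sexticEnergy x = ∫ s in Ioo 0 L, dot (p s) (p s) ^ 3 := by
      refine integral_congr_ae ?_
      filter_upwards [h.e1] with s hs
      rw [hs]
    rw [e]
    refine Eq.trans ?_ (integral_add iPU ip3)
    refine integral_congr_ae ?_
    filter_upwards [h.e1, h.e2, ae_restrict_mem measurableSet_Ioo] with s h1 h2 hs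
    rw [h1, h2, hn2 s (Ioo_subset_Icc_self hs)]
    ring
  have Iy : ‖D 1 y‖ ^ 2 = ∫ s in Ioo 0 L, dot (W s) (W s) := by
    rw [norm_sq_eq_integral]; exact integral_dot_congr h.ew h.ew
  set u := ∫ s in Ioo 0 L, dot (U s) (U s) with hu
  set w := ∫ s in Ioo 0 L, dot (W s) (W s) with hw
  set r := ∫ s in Ioo 0 L, ρ s ^ 2 with hr
  set q := ∫ s in Ioo 0 L, ρ s ^ 3 with hq
  set m := ∫ s in Ioo 0 L, dot (p s) (p s) * dot (U s) (U s) with hm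
  have cψ : ContinuousOn (fun s => f2 s + κ • f0 s) (Icc 0 L) := c2.add (c0.const_smul κ)
  have iψ := integrable_of_continuousOn (continuousOn_dot cψ cψ)
  have Iψ : ∫ s in Ioo 0 L, dot (f2 s + κ • f0 s) (f2 s + κ • f0 s) = u + r := by
    rw [hu, hr, ← integral_add iU iρ2]
    exact setIntegral_congr_fun measurableSet_Ioo fun s hs => hψ2 s (Ioo_subset_Icc_self hs)
  have mψ' : MemLp (fun s => f3 s + κ • f1 s) 2 (volI L) :=
    m3.add (memLp_of_continuousOn (c1.const_smul κ))
  have iψ' := integrable_dot mψ' mψ'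
  set Ψ := ∫ s in Ioo 0 L, dot (f3 s + κ • f1 s) (f3 s + κ • f1 s) with hΨ
  have hΨ_le : Ψ ≤ 2 * G ^ 2 + 2 * κ ^ 2 * A ^ 2 := by
    have : Ψ ≤ ∫ s in Ioo 0 L, (2 * dot (f3 s) (f3 s) + 2 * κ ^ 2 * dot (f1 s) (f1 s)) := by
      refine integral_mono iψ' ((i3.const_mul 2).add (i1.const_mul _)) fun s => ?_
      have := dot_add_self_le (f3 s) (κ • f1 s)
      rw [dot_smul, smul_dot] at this
      simp only
      linarith
    rwa [integral_add (i3.const_mul 2) (i1.const_mul _), integral_const_mul, integral_const_mul,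
      N3, N1] at this
  have hΨ_ge : G ^ 2 ≤ 2 * Ψ + 2 * κ ^ 2 * A ^ 2 := by
    rw [← N3, ← N1, hΨ, ← integral_const_mul, ← integral_const_mul,
      ← integral_add (iψ'.const_mul 2) (i1.const_mul _)]
    refine integral_mono i3 ((iψ'.const_mul 2).add (i1.const_mul _)) fun s => ?_
    have := dot_add_self_le (f3 s + κ • f1 s) (-(κ • f1 s))
    rw [add_neg_cancel_right, ← neg_smul, dot_smul, smul_dot] at this
    simp only
    linarith
  have hpw : ∀ᵐ s ∂(volI L), s ∈ Icc 0 L ∧ dot (v s) (D 3 x s) = -3 * dot (p s) (n s) := by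
    filter_upwards [hc.dot_vj hL, ae_restrict_mem measurableSet_Ioo] with s h1 h2
      using ⟨Ioo_subset_Icc_self h2, h1⟩
  refine ⟨u, w, r, q, m, ⟨X0, A0, B0, ?_, ?_, ?_, ?_, ?_, ?_, ?_, ?_, ?_, ?_, ?_, ?_, ?_⟩,
    Ip, ?_, ?_⟩
  · exact integral_nonneg hUU0
  · exact integral_nonneg fun s => sq_nonneg _
  · exact integral_nonneg fun s => mul_nonneg (hpp0 s) (hUU0 s)
  · have := poincare hL hℓ pf0 (memLp_of_continuousOn c1) z0 zL
    rwa [N0, N1] at this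
  -- Interpolation: `φ` vanishes at the ends, so `‖φ_s‖² = -∫ φ · φ_ss`.
  · have Q := pf0.dot pf1
    have hQ := Q.integral_eq hL
    rw [z0, zL] at hQ
    have iA := integrable_of_continuousOn (continuousOn_dot c0 c2)
    rw [integral_add i1 iA, N1] at hQ
    have hb := integral_abs_dot_le (memLp_of_continuousOn c0) (memLp_of_continuousOn c2) X0 B0 N0 N2
    have hb2 := (neg_le_abs _).trans (abs_integral_le_integral_abs
      (f := fun s => dot (f0 s) (f2 s)) (μ := volI L))
    have hz' : ∀ a : E3, dot 0 a = 0 := fun a => by simp [dot]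
    rw [hz', hz', sub_zero] at hQ
    linarith
  -- Two unit vectors differ by at most `2`; in terms of `φ`, Cauchy–Schwarz in `v^R · φ = -|φ|²/2`
  -- gives `|φ|² ≤ 4`.
  · rw [← N0]
    have : ∫ s in Ioo 0 L, dot (f0 s) (f0 s) ≤ ∫ s in Ioo 0 L, (4 : ℝ) := by
      refine setIntegral_mono_on i0 (integrableOn_const (by simp)) measurableSet_Ioo fun s hs => ?_
      have h1 := hfa s (Ioo_subset_Icc_self hs)
      have h2 := dot_sq_le (arc R s) (f0 s)
      rw [dot_arc, h1] at h2
      nlinarith [dot_self_nonneg (f0 s)]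
    rwa [integral_const, hreal, smul_eq_mul, mul_comm] at this
  · have := setIntegral_mono_on iρ2 (i1.const_mul (8 * κ + 2 * M)) measurableSet_Ioo fun s hs =>
      hρ2_le s (Ioo_subset_Icc_self hs)
    rwa [integral_const_mul, N1] at this
  · rw [← N2, ← N0, ← Iψ, ← integral_const_mul, ← integral_const_mul,
      ← integral_add (iψ.const_mul 2) (i0.const_mul _)]
    refine integral_mono i2 ((iψ.const_mul 2).add (i0.const_mul _)) fun s => ?_
    have := dot_add_self_le (f2 s + κ • f0 s) (-(κ • f0 s))
    rw [add_neg_cancel_right, ← neg_smul, dot_smul, smul_dot] at this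
    simp only
    linarith
  · rw [← N2, ← N0, ← integral_const_mul, ← integral_const_mul,
      ← integral_add (i2.const_mul 2) (i0.const_mul _)]
    refine setIntegral_mono_on iU ((i2.const_mul 2).add (i0.const_mul _)) measurableSet_Ioo
      fun s hs => ?_
    have h1 := dot_add_self_le (f2 s) (κ • f0 s)
    rw [dot_smul, smul_dot, hψ2 s (Ioo_subset_Icc_self hs)] at h1
    nlinarith [sq_nonneg (ρ s)]
  · refine abs_integral_le_integral_abs.trans ?_
    rw [hr, ← integral_const_mul]
    refine setIntegral_mono_on iρ3.abs (iρ2.const_mul _) measurableSet_Ioo fun s hs => ?_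
    have h1 := hρ_le s (Ioo_subset_Icc_self hs)
    change |ρ s ^ 3| ≤ _ * ρ s ^ 2
    rw [pow_succ, abs_mul, abs_of_nonneg (sq_nonneg (ρ s)), mul_comm]
    exact mul_le_mul_of_nonneg_right h1 (sq_nonneg _)
  · rw [hu, ← integral_const_mul]
    exact setIntegral_mono_on iPU (iU.const_mul _) measurableSet_Ioo fun s hs =>
      mul_le_mul_of_nonneg_right (hp_le s (Ioo_subset_Icc_self hs)) (hUU0 s)
  · have : w ≤ ∫ s in Ioo 0 L, (2 * (2 * κ + 2 * M) * dot (f2 s + κ • f0 s) (f2 s + κ • f0 s)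
        + 2 * dot (f3 s + κ • f1 s) (f3 s + κ • f1 s)) := by
      refine integral_mono_ae iW ((iψ.const_mul _).add (iψ'.const_mul _)) ?_
      filter_upwards [hpw] with s hs
      have h1 := dot_velocity_deriv_le (v := v s) (p := p s) (n := n s) (j := D 3 x s)
        (hc.unit s hs.1) κ
      rw [← hψ, ← hψ'] at h1
      have h2 := mul_le_mul_of_nonneg_right (hp_le s hs.1)
        (dot_self_nonneg (f2 s + κ • f0 s))
      change dot (W s) (W s) ≤ _ at h1
      linarith
    rw [integral_add (iψ.const_mul _) (iψ'.const_mul _), integral_const_mul, integral_const_mul,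
      Iψ] at this
    linarith
  · have : Ψ ≤ ∫ s in Ioo 0 L, (12 * (2 * κ + 2 * M) * dot (U s) (U s) + 3 * dot (W s) (W s)
        + 3 * (2 * κ + 2 * M) * ρ s ^ 2) := by
      refine integral_mono_ae iψ' (((iU.const_mul _).add (iW.const_mul _)).add (iρ2.const_mul _)) ?_
      filter_upwards [hpw] with s hs
      have h1 := dot_third_deriv_le (hc.unit s hs.1) (hc.dot_vp hL s hs.1) (hc.dot_vn hL s hs.1)
        hs.2 κ
      rw [← hψ'] at h1
      have h2 := mul_le_mul_of_nonneg_right (hp_le s hs.1) (hUU0 s)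
      have h3 := mul_le_mul_of_nonneg_right (hp_le s hs.1) (sq_nonneg (ρ s))
      have h4 : dot (f3 s + κ • f1 s) (f3 s + κ • f1 s) ≤ 12 * dot (p s) (p s) * dot (U s) (U s)
        + 3 * dot (W s) (W s) + 3 * ρ s ^ 2 * dot (p s) (p s) := h1
      linarith
    rw [integral_add (Integrable.fun_add (iU.const_mul _) (iW.const_mul _)) (iρ2.const_mul _),
      integral_add (iU.const_mul _) (iW.const_mul _), integral_const_mul, integral_const_mul,
      integral_const_mul] at this
    linarith
  · rw [In, Iq]; ring
  · rw [Iw, Is, Iy]; ring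

-- The laws are used in the order `A`, `B`, `G`, each bound feeding the next. With constants
-- depending only on `K`, the powers of `N` are: `A²` is bounded both by `N²` and by `N`, `B²` by
-- `N² (1 + N)` and `G²` by `N² (1 + N)⁴`.
set_option maxHeartbeats 1600000 in
theorem energy_le_of_conserved {L κ μ K N X A B G u w r q m X₀ A₀ B₀ G₀ u₀ w₀ r₀ q₀ m₀ : ℝ}
    (hL : 0 < L) (hκ : 0 ≤ κ) (hμκ : κ * μ < 1) (hK1 : 1 ≤ K) (hKL : L ≤ K) (hKL' : 1 / L ≤ K)
    (hKκ : κ ≤ K) (hKμ : μ ≤ K) (hKc : 1 / (1 - κ * μ) ≤ K) (hN : 0 ≤ N)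
    (hN2 : N ^ 2 = X₀ ^ 2 + A₀ ^ 2 + B₀ ^ 2 + G₀ ^ 2)
    (h₀ : StaticBounds L κ μ X₀ A₀ B₀ G₀ u₀ w₀ r₀ q₀ m₀)
    (h : StaticBounds L κ μ X A B G u w r q m)
    (c1 : A ^ 2 - κ * X ^ 2 = A₀ ^ 2 - κ * X₀ ^ 2)
    (c2 : u - 1 / 4 * r = u₀ - 1 / 4 * r₀)
    (c3 : w - 5 / 2 * m + 3 / 8 * κ * r + 1 / 8 * q
      = w₀ - 5 / 2 * m₀ + 3 / 8 * κ * r₀ + 1 / 8 * q₀) :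
    X ^ 2 + A ^ 2 + B ^ 2 + G ^ 2 ≤ (1500 * K ^ 5 * (N * (1 + N) ^ 2)) ^ 2 := by
  have hK0 : 0 ≤ K := by linarith
  -- As `K` and `T` are at least `1`, the monomials `K^i T^k N²` increase in both exponents and can
  -- be compared by `mono`.
  obtain ⟨T, hT⟩ : ∃ T, T = 1 + N := ⟨_, rfl⟩
  have hT1 : 1 ≤ T := by linarith
  have hT0 : 0 ≤ T := by linarith
  have hNT : N ≤ T := by linarith
  have mono : ∀ {i k i' k' : ℕ}, i ≤ i' → k ≤ k' → K ^ i * T ^ k * N ^ 2 ≤ K ^ i' * T ^ k' * N ^ 2 :=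
    fun hi hk => by
      have h1 := pow_le_pow_right₀ hK1 hi
      have h2 := pow_le_pow_right₀ hT1 hk
      gcongr
  have monoK : ∀ {i i' : ℕ}, i ≤ i' → K ^ i ≤ K ^ i' := fun hi => pow_le_pow_right₀ hK1 hi
  have hX0 := h₀.X_nonneg
  have hA0 := h₀.A_nonneg
  have hB0 := h₀.B_nonneg
  have hX := h.X_nonneg
  have hA := h.A_nonneg
  have hB := h.B_nonneg
  have hu := h.u_nonneg
  have hr := h.r_nonneg
  have hu0 := h₀.u_nonneg
  have hr0 := h₀.r_nonneg
  -- the initial configuration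
  have X2 : X₀ ^ 2 ≤ N ^ 2 := by linarith [sq_nonneg A₀, sq_nonneg B₀, sq_nonneg G₀]
  have A2 : A₀ ^ 2 ≤ N ^ 2 := by linarith [sq_nonneg X₀, sq_nonneg B₀, sq_nonneg G₀]
  have B2 : B₀ ^ 2 ≤ N ^ 2 := by linarith [sq_nonneg A₀, sq_nonneg X₀, sq_nonneg G₀]
  have G2 : G₀ ^ 2 ≤ N ^ 2 := by linarith [sq_nonneg A₀, sq_nonneg B₀, sq_nonneg X₀]
  have B1 : B₀ ≤ N := abs_le_of_sq_le_sq' B2 hN |>.2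
  have κ2 : κ ^ 2 ≤ K ^ 2 := by gcongr
  obtain ⟨M₀, hM₀⟩ : ∃ M, M = A₀ ^ 2 / L + 2 * A₀ * B₀ := ⟨_, rfl⟩
  obtain ⟨M, hM⟩ : ∃ M, M = A ^ 2 / L + 2 * A * B := ⟨_, rfl⟩
  have hdiv : ∀ a : ℝ, 0 ≤ a → a / L ≤ K * a := fun a ha => by
    rw [div_eq_mul_one_div, mul_comm]; gcongr
  have M0 : M₀ ≤ 3 * K * N ^ 2 := by
    have h1 := hdiv _ (sq_nonneg A₀)
    have h2 : K * A₀ ^ 2 ≤ K * N ^ 2 := by gcongr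
    have h3 : 1 * N ^ 2 ≤ K * N ^ 2 := by gcongr
    linarith [two_mul_le_add_sq A₀ B₀]
  have hM0' : 0 ≤ M₀ := by rw [hM₀]; positivity
  have hM' : 0 ≤ M := by rw [hM]; positivity
  have P0 : 2 * κ + 2 * M₀ ≤ 6 * K * T ^ 2 := by
    have : 6 * K * T ^ 2 = 6 * K + 12 * K * N + 6 * K * N ^ 2 := by rw [hT]; ring
    have : 0 ≤ K * N := by positivity
    linarith
  have r0 : r₀ ≤ 8 * (K ^ 1 * T ^ 2 * N ^ 2) := by
    have h1 := h₀.r_le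
    rw [← hM₀] at h1
    have h2 : 8 * κ + 2 * M₀ ≤ 8 * K * T ^ 2 := by
      have : 8 * K * T ^ 2 = 8 * K + 16 * K * N + 8 * K * N ^ 2 := by rw [hT]; ring
      have : 0 ≤ K * N := by positivity
      have : 0 ≤ K * N ^ 2 := by positivity
      linarith
    calc r₀ ≤ (8 * κ + 2 * M₀) * A₀ ^ 2 := h1
      _ ≤ (8 * K * T ^ 2) * N ^ 2 := by gcongr
      _ = _ := by ring
  have q0 : |q₀| ≤ 48 * (K ^ 2 * T ^ 4 * N ^ 2) := by
    have h1 := h₀.q_le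
    rw [← hM₀] at h1
    calc |q₀| ≤ (2 * κ + 2 * M₀) * r₀ := h1
      _ ≤ (6 * K * T ^ 2) * (8 * (K ^ 1 * T ^ 2 * N ^ 2)) := by gcongr
      _ = _ := by ring
  have u0 : u₀ ≤ 4 * (K ^ 2 * T ^ 0 * N ^ 2) := by
    have h1 : κ ^ 2 * X₀ ^ 2 ≤ K ^ 2 * N ^ 2 := by gcongr
    have h2 := mono (i := 0) (i' := 2) (k := 0) (k' := 0) (by norm_num) le_rfl
    simp only [pow_zero, one_mul, mul_one] at h2 ⊢
    linarith [h₀.u_le]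
  have w0 : w₀ ≤ 152 * (K ^ 3 * T ^ 4 * N ^ 2) := by
    have h1 := h₀.w_le
    rw [← hM₀] at h1
    have h2 : (2 * κ + 2 * M₀) * (u₀ + r₀) ≤ (6 * K * T ^ 2) * (4 * (K ^ 2 * T ^ 0 * N ^ 2)
      + 8 * (K ^ 1 * T ^ 2 * N ^ 2)) := by gcongr
    have h3 : κ ^ 2 * A₀ ^ 2 ≤ K ^ 2 * T ^ 0 * N ^ 2 := by rw [pow_zero, mul_one]; gcongr
    have e : (6 * K * T ^ 2) * (4 * (K ^ 2 * T ^ 0 * N ^ 2) + 8 * (K ^ 1 * T ^ 2 * N ^ 2))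
      = 24 * (K ^ 3 * T ^ 2 * N ^ 2) + 48 * (K ^ 2 * T ^ 4 * N ^ 2) := by ring
    have m1 := mono (i := 3) (i' := 3) (k := 2) (k' := 4) le_rfl (by norm_num)
    have m2 := mono (i := 2) (i' := 3) (k := 4) (k' := 4) (by norm_num) le_rfl
    have m3 := mono (i := 2) (i' := 3) (k := 0) (k' := 4) (by norm_num) (by norm_num)
    have m4 := mono (i := 0) (i' := 3) (k := 0) (k' := 4) (by norm_num) (by norm_num)
    have e4 : K ^ 0 * T ^ 0 * N ^ 2 = N ^ 2 := by ring
    linarith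
  -- first derivative
  have hc : 0 < 1 - κ * μ := by linarith
  have a1 : A ^ 2 ≤ K * A₀ ^ 2 := by
    -- Coercivity: Poincaré leaves the positive fraction `1 - κ μ` of `A²` in the first conserved
    -- quantity.
    have h1 : κ * X ^ 2 ≤ κ * (μ * A ^ 2) := mul_le_mul_of_nonneg_left h.poincare hκ
    have h2 : 0 ≤ κ * X₀ ^ 2 := by positivity
    have h3 : A ^ 2 * (1 - κ * μ) ≤ A₀ ^ 2 := by linarith
    calc A ^ 2 ≤ A₀ ^ 2 / (1 - κ * μ) := by rwa [le_div_iff₀ hc]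
      _ = 1 / (1 - κ * μ) * A₀ ^ 2 := by ring
      _ ≤ _ := by gcongr
  have a2 : A ^ 2 ≤ K * N ^ 2 := a1.trans (by gcongr)
  -- Interpolation and the bound on `X₀` make this bound linear in `N`. It keeps the powers of `A`
  -- below from raising the final degree above three.
  have a3 : A ^ 2 ≤ 2 * K ^ 2 * N := by
    have h1 : X₀ ≤ 2 * K := by
      have := h₀.amplitude
      refine (abs_le_of_sq_le_sq' (?_ : X₀ ^ 2 ≤ (2 * K) ^ 2) (by positivity)).2
      have h2 : K * 1 ≤ K * K := by gcongr
      linarith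
    calc A ^ 2 ≤ K * (X₀ * B₀) := a1.trans (by gcongr; exact h₀.interp)
      _ ≤ K * (2 * K * N) := by gcongr
      _ = _ := by ring
  have x2 : X ^ 2 ≤ K ^ 2 * T ^ 0 * N ^ 2 := by
    calc X ^ 2 ≤ μ * A ^ 2 := h.poincare
      _ ≤ K * (K * N ^ 2) := by gcongr
      _ = _ := by ring
  -- second derivative
  have b2 : B ^ 2 ≤ 820 * (K ^ 6 * T ^ 1 * N ^ 2) := by
    have h1 : κ ^ 2 * X ^ 2 ≤ K ^ 2 * (K ^ 2 * T ^ 0 * N ^ 2) := by gcongr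
    have h2 : 8 * κ * A ^ 2 ≤ 8 * K * (K * N ^ 2) := by gcongr
    have h3 : A ^ 2 / L * A ^ 2 ≤ (K * (K * N ^ 2)) * (2 * K ^ 2 * N) := by
      have := (hdiv _ (sq_nonneg A)).trans (mul_le_mul_of_nonneg_left a2 hK0)
      gcongr
    have h4 : A ^ 2 * A ^ 2 * A ^ 2 ≤ (2 * K ^ 2 * N) * (2 * K ^ 2 * N) * (2 * K ^ 2 * N) := by
      gcongr
    have h5 : 10 * (A ^ 3 * B) ≤ B ^ 2 / 2 + 50 * (A ^ 2 * A ^ 2 * A ^ 2) := by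
      linarith [sq_nonneg (B - 10 * A ^ 3)]
    have h6 := h.r_le
    have e6 : (8 * κ + 2 * (A ^ 2 / L + 2 * A * B)) * A ^ 2
      = 8 * κ * A ^ 2 + 2 * (A ^ 2 / L * A ^ 2) + 4 * (A ^ 3 * B) := by ring
    have h7 := h.B_le
    have e1 : K ^ 2 * (K ^ 2 * T ^ 0 * N ^ 2) = K ^ 4 * T ^ 0 * N ^ 2 := by ring
    have e2 : 8 * K * (K * N ^ 2) = 8 * (K ^ 2 * T ^ 0 * N ^ 2) := by ring
    have e3 : (K * (K * N ^ 2)) * (2 * K ^ 2 * N) = 2 * (K ^ 4 * N ^ 3) := by ring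
    have e4 : (2 * K ^ 2 * N) * (2 * K ^ 2 * N) * (2 * K ^ 2 * N) = 8 * (K ^ 6 * N ^ 3) := by ring
    have m1 := mono (i := 4) (i' := 6) (k := 0) (k' := 0) (by norm_num) le_rfl
    have m2 := mono (i := 2) (i' := 6) (k := 0) (k' := 0) (by norm_num) le_rfl
    have m3 : K ^ 4 * N ^ 3 ≤ K ^ 6 * N ^ 3 :=
      mul_le_mul_of_nonneg_right (monoK (by norm_num)) (by positivity)
    have e5 : K ^ 6 * T ^ 1 * N ^ 2 = K ^ 6 * T ^ 0 * N ^ 2 + K ^ 6 * N ^ 3 := by rw [hT]; ring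
    have m4 : 0 ≤ K ^ 6 * N ^ 3 := by positivity
    have m5 : 0 ≤ K ^ 6 * T ^ 0 * N ^ 2 := by positivity
    linarith
  have ab : A * B ≤ 41 * K ^ 4 * (N * T) := by
    refine (abs_le_of_sq_le_sq' (?_ : (A * B) ^ 2 ≤ _) (by positivity)).2
    calc (A * B) ^ 2 = A ^ 2 * B ^ 2 := by ring
      _ ≤ (2 * K ^ 2 * N) * (820 * (K ^ 6 * T ^ 1 * N ^ 2)) := by gcongr
      _ = 1640 * (K ^ 8 * T * N ^ 2) * N := by ring
      -- The constant `1640` is rounded up to `41²` so that a square root can be taken.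
      _ ≤ 1681 * (K ^ 8 * T * N ^ 2) * T := by gcongr; norm_num
      _ = _ := by ring
  have hMle : M ≤ 84 * K ^ 4 * (N * T) := by
    have h1 := (hdiv _ (sq_nonneg A)).trans (mul_le_mul_of_nonneg_left a3 hK0)
    have h2 : K ^ 3 * (N * 1) ≤ K ^ 4 * (N * T) := by
      have := monoK (i := 3) (i' := 4) (by norm_num)
      gcongr
    rw [hM]
    linarith
  have r1 : r ≤ 344 * (K ^ 6 * T ^ 1 * N ^ 2) := by
    have h1 := h.r_le
    rw [← hM] at h1
    have h2 : 8 * κ * A ^ 2 ≤ 8 * K * (K * N ^ 2) := by gcongr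
    have h3 : M * A ^ 2 ≤ (84 * K ^ 4 * (N * T)) * (2 * K ^ 2 * N) := by gcongr
    have m1 := mono (i := 2) (i' := 6) (k := 0) (k' := 1) (by norm_num) (by norm_num)
    have e1 : 8 * K * (K * N ^ 2) = 8 * (K ^ 2 * T ^ 0 * N ^ 2) := by ring
    have e2 : (84 * K ^ 4 * (N * T)) * (2 * K ^ 2 * N) = 168 * (K ^ 6 * T ^ 1 * N ^ 2) := by ring
    linarith
  have u1 : u ≤ 90 * (K ^ 6 * T ^ 1 * N ^ 2) := by
    have m1 := mono (i := 2) (i' := 6) (k := 0) (k' := 1) (by norm_num) (by norm_num)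
    linarith
  have P1 : 2 * κ + 2 * M ≤ 168 * K ^ 4 * T ^ 2 := by
    have h1 : K ^ 1 ≤ K ^ 4 := monoK (by norm_num)
    have e : 168 * K ^ 4 * T ^ 2 = 168 * K ^ 4 * (N * T) + 168 * K ^ 4 * 1 + 168 * K ^ 4 * N := by
      rw [hT]; ring
    have : 0 ≤ K ^ 4 * N := by positivity
    have : 0 ≤ K ^ 4 := by positivity
    linarith
  -- third derivative
  have pu : (2 * κ + 2 * M) * u ≤ 15120 * (K ^ 10 * T ^ 3 * N ^ 2) := by
    calc _ ≤ (168 * K ^ 4 * T ^ 2) * (90 * (K ^ 6 * T ^ 1 * N ^ 2)) := by gcongr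
      _ = _ := by ring
  have pr : (2 * κ + 2 * M) * r ≤ 57792 * (K ^ 10 * T ^ 3 * N ^ 2) := by
    calc _ ≤ (168 * K ^ 4 * T ^ 2) * (344 * (K ^ 6 * T ^ 1 * N ^ 2)) := by gcongr
      _ = _ := by ring
  have m1 := mono (i := 10) (i' := 10) (k := 3) (k' := 4) le_rfl (by norm_num)
  have w1 : w ≤ 45185 * (K ^ 10 * T ^ 4 * N ^ 2) := by
    have h1 := h.m_le
    have h2 := h.q_le
    rw [← hM] at h1 h2
    have h3 : κ * r₀ ≤ K * (8 * (K ^ 1 * T ^ 2 * N ^ 2)) := by gcongr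
    have e3 : K * (8 * (K ^ 1 * T ^ 2 * N ^ 2)) = 8 * (K ^ 2 * T ^ 2 * N ^ 2) := by ring
    -- The term `(3/8) κ r` has the favourable sign in the third law and is dropped.
    have h4 : 0 ≤ κ * r := by positivity
    have m2 := mono (i := 2) (i' := 10) (k := 2) (k' := 4) (by norm_num) (by norm_num)
    have m3 := mono (i := 2) (i' := 10) (k := 4) (k' := 4) (by norm_num) le_rfl
    have m4 := mono (i := 3) (i' := 10) (k := 4) (k' := 4) (by norm_num) le_rfl
    linarith [neg_abs_le q, le_abs_self q₀, h₀.m_nonneg]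
  have g2 : G ^ 2 ≤ 980744 * (K ^ 10 * T ^ 4 * N ^ 2) := by
    have h1 := h.G_le
    rw [← hM] at h1
    have h2 : κ ^ 2 * A ^ 2 ≤ K ^ 2 * (K * N ^ 2) := by gcongr
    have e2 : K ^ 2 * (K * N ^ 2) = K ^ 3 * T ^ 0 * N ^ 2 := by ring
    have m2 := mono (i := 3) (i' := 10) (k := 0) (k' := 4) (by norm_num) (by norm_num)
    linarith
  have m2 := mono (i := 2) (i' := 10) (k := 0) (k' := 4) (by norm_num) (by norm_num)
  have m3 := mono (i := 1) (i' := 10) (k := 0) (k' := 4) (by norm_num) (by norm_num)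
  have m4 := mono (i := 6) (i' := 10) (k := 1) (k' := 4) (by norm_num) (by norm_num)
  have e3 : K ^ 1 * T ^ 0 * N ^ 2 = K * N ^ 2 := by ring
  have e : (1500 * K ^ 5 * (N * (1 + N) ^ 2)) ^ 2 = 2250000 * (K ^ 10 * T ^ 4 * N ^ 2) := by
    rw [hT]; ring
  have : 0 ≤ K ^ 10 * T ^ 4 * N ^ 2 := by positivity
  rw [e]
  linarith

/-! ### Preservation of the unit length. -/

/-- The deviation `∫ (|x|² - 1)²` of a map from the sphere. -/
def sphereDefect {L : ℝ} (x : H L 3) : ℝ :=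
  ∫ s in Ioo 0 L, (dot (D 0 x s) (D 0 x s) - 1) ^ 2

/-- The bounded function `x · x`. -/
def sqZero {L : ℝ} (x : H L 3) : Lp ℝ ⊤ (volI L) := dotL L (linf (D 0 x)) (linf (D 0 x))

/-- The field representing the increments of `sphereDefect`. -/
def defectGrad {L : ℝ} (x x' : H L 3) : L2 L :=
  smulL L (sqZero x' + sqZero x) (D 0 x' + D 0 x) - (2 : ℝ) • (D 0 x' + D 0 x)

section SphereDefect

variable {L : ℝ}

theorem coeFn_sqZero (hL : 0 < L) (x : H L 3) :
    sqZero x =ᵐ[volI L] fun s => dot (D 0 x s) (D 0 x s) := by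
  filter_upwards [coeFn_dotL (linf (D 0 x)) (linf (D 0 x)), coeFn_linf hL (isWeakDeriv_D 0 x)]
    with s h1 h2
  have h2' : linf (D 0 x) s = D 0 x s := h2
  rw [sqZero, h1, h2']

theorem coeFn_defectGrad (hL : 0 < L) (x x' : H L 3) : defectGrad x x' =ᵐ[volI L] fun s =>
    (dot (D 0 x' s) (D 0 x' s) + dot (D 0 x s) (D 0 x s) - 2) • (D 0 x' s + D 0 x s) := by
  rw [defectGrad]
  filter_upwards [coeFn_sqZero hL x', coeFn_sqZero hL x, Lp.coeFn_add (D 0 x') (D 0 x),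
    Lp.coeFn_add (sqZero x') (sqZero x), coeFn_smulL (sqZero x' + sqZero x) (D 0 x' + D 0 x),
    Lp.coeFn_smul (2 : ℝ) (D 0 x' + D 0 x),
    Lp.coeFn_sub (smulL L (sqZero x' + sqZero x) (D 0 x' + D 0 x)) ((2 : ℝ) • (D 0 x' + D 0 x))]
    with s h1 h2 h3 h4 h5 h6 h7
  rw [h7, Pi.sub_apply, h5, h6, Pi.smul_apply, h4, h3, Pi.add_apply, Pi.add_apply, h1, h2, sub_smul]

theorem integrable_sphereDefect (hL : 0 < L) (x : H L 3) :
    Integrable (fun s => (dot (D 0 x s) (D 0 x s) - 1) ^ 2) (volI L) := by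
  obtain ⟨v, hv, ev⟩ := (isWeakDeriv_D 0 x).exists_isPrimV hL
  have hc := hv.continuousOn hL
  have hi : Integrable (fun s => (dot (v s) (v s) - 1) ^ 2) (volI L) :=
    integrable_of_continuousOn (((continuousOn_dot hc hc).sub continuousOn_const).pow 2)
  refine hi.congr ?_
  filter_upwards [ev] with s hs
  have hs' : D 0 x s = v s := hs
  rw [hs']

theorem sphereDefect_sub (hL : 0 < L) (x x' : H L 3) :
    sphereDefect x' - sphereDefect x = inner ℝ (D 0 x' - D 0 x) (defectGrad x x') := by
  rw [sphereDefect, sphereDefect, ← integral_sub (integrable_sphereDefect hL x')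
    (integrable_sphereDefect hL x), inner_eq_integral]
  refine integral_congr_ae ?_
  filter_upwards [coeFn_defectGrad hL x x', Lp.coeFn_sub (D 0 x') (D 0 x)] with s h1 h2
  rw [h1, h2, Pi.sub_apply, dot_smul, dot_add, sub_dot, sub_dot, dot_comm (D 0 x s) (D 0 x' s)]
  ring

theorem sphereDefect_eq_zero_iff (hL : 0 < L) (x : H L 3) :
    sphereDefect x = 0 ↔ ∀ᵐ s ∂(volI L), ‖D 0 x s‖ = 1 := by
  rw [sphereDefect, integral_eq_zero_iff_of_nonneg (fun s => sq_nonneg _)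
    (integrable_sphereDefect hL x)]
  refine Filter.eventually_congr (Filter.Eventually.of_forall fun s => ?_)
  change (dot (D 0 x s) (D 0 x s) - 1) ^ 2 = 0 ↔ _
  rw [dot_self, sq_eq_zero_iff, sub_eq_zero]
  exact pow_eq_one_iff_of_nonneg (norm_nonneg _) two_ne_zero

theorem tendsto_defectGrad (hL : 0 < L) {v : ℝ → H L 3} {l : Filter ℝ} {t : ℝ}
    (h : Filter.Tendsto v l (nhds (v t))) :
    Filter.Tendsto (fun τ => defectGrad (v t) (v τ)) l (nhds (defectGrad (v t) (v t))) := by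
  have hD : ∀ k : Fin 4, Filter.Tendsto (fun τ => D k (v τ)) l (nhds (D k (v t))) := fun k =>
    ((DL L k).continuous.tendsto _).comp h
  have hl := tendsto_linf hL (Filter.Eventually.of_forall fun τ => isWeakDeriv_D 0 (v τ))
    (isWeakDeriv_D 0 (v t)) (hD 0) (hD 1)
  have hs : Filter.Tendsto (fun τ => sqZero (v τ)) l (nhds (sqZero (v t))) :=
    tendsto_clm₂ (dotL L) hl hl
  have ha := (hD 0).add (tendsto_const_nhds (x := D 0 (v t)))
  exact (tendsto_clm₂ (smulL L) (hs.add tendsto_const_nhds) ha).sub (ha.const_smul (2 : ℝ))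

theorem tendsto_sphereDefect (hL : 0 < L) {v : ℝ → H L 3} {l : Filter ℝ} {t : ℝ}
    (h : Filter.Tendsto v l (nhds (v t))) :
    Filter.Tendsto (fun τ => sphereDefect (v τ)) l (nhds (sphereDefect (v t))) := by
  have hD : Filter.Tendsto (fun τ => D 0 (v τ) - D 0 (v t)) l (nhds (D 0 (v t) - D 0 (v t))) :=
    (((DL L 0).continuous.tendsto _).comp h).sub tendsto_const_nhds
  have hi := hD.inner (𝕜 := ℝ) (tendsto_defectGrad hL h)
  rw [sub_self, inner_zero_left] at hi
  have := hi.add_const (sphereDefect (v t))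
  rw [zero_add] at this
  refine this.congr fun τ => ?_
  rw [← sphereDefect_sub hL, sub_add_cancel]

end SphereDefect

/-- A solution whose initial value lies on the sphere is a sphere-valued flow. -/
theorem IsSolution.exists_isFlow {L : ℝ} (hL : 0 < L) {b : E3} {v₀ : H L 3} {v : ℝ → H L 3}
    (h : IsSolution L b v₀ v) (hu : ∀ᵐ s ∂(volI L), ‖D 0 v₀ s‖ = 1) :
    ∃ vt : ℝ → H L 1, IsFlow L e₁ b v vt := by
  obtain ⟨vt, hvt, hd, heq⟩ := h.equation
  have cont : ∀ t, 0 < t → ContinuousAt v t := fun t ht =>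
    h.continuousOn.continuousAt (Ici_mem_nhds ht)
  have deriv : ∀ t, 0 < t → HasDerivAt (fun τ => toH1 (v τ)) (vt t) t := fun t ht =>
    (hd t ht.le).hasDerivAt (Ici_mem_nhds ht)
  -- The gradient field at `v t` is pointwise parallel to `v`, while the velocity `v × v_ss` is
  -- orthogonal to it.
  have hF : ∀ t, 0 < t → HasDerivAt (fun τ => sphereDefect (v τ)) 0 t := fun t ht => by
    have hD : HasDerivAt (fun τ => D 0 (v τ)) (D 0 (vt t)) t :=
      (DL L 0).hasFDerivAt.comp_hasDerivAt t (deriv t ht)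
    refine (hasDerivAt_of_inner_increment hD (g := fun τ => defectGrad (v t) (v τ))
      (tendsto_defectGrad hL (cont t ht))
      (Filter.Eventually.of_forall fun τ => sphereDefect_sub hL _ _)).congr_deriv ?_
    rw [inner_eq_integral]
    refine integral_eq_zero_of_ae ?_
    filter_upwards [coeFn_defectGrad hL (v t) (v t), heq t ht] with s h1 h2
    rw [h1, h2, dot_smul, dot_add]
    have : dot (cross (D 0 (v t) s) (D 2 (v t) s)) (D 0 (v t) s) = 0 := by
      simp only [dot, cross_apply_zero, cross_apply_one, cross_apply_two]
      ring
    rw [this, add_zero, mul_zero, Pi.zero_apply]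
  have h0 : sphereDefect (v 0) = 0 := by
    rw [h.initial, sphereDefect_eq_zero_iff hL]
    exact hu
  have hlim : Filter.Tendsto (fun τ => sphereDefect (v τ)) (nhdsWithin 0 (Ioi 0)) (nhds 0) := by
    have := tendsto_sphereDefect hL
      ((h.continuousOn 0 self_mem_Ici).tendsto.mono_left (nhdsWithin_mono 0 Ioi_subset_Ici_self))
    rwa [h0] at this
  refine ⟨vt, cont, fun t ht => hvt.continuousAt (Ici_mem_nhds ht), deriv, heq, fun t ht => ?_,
    h.boundary⟩
  rw [← sphereDefect_eq_zero_iff hL]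
  refine tendsto_nhds_unique (tendsto_const_nhds.congr' ?_) hlim
  filter_upwards [self_mem_nhdsWithin] with τ hτ
  exact eq_of_hasDerivAt_zero hF ht hτ

/-! ### The stationary arc and the stability estimate. -/

theorem norm_sq_eq_sum {L : ℝ} (x : H L 3) :
    ‖x‖ ^ 2 = ‖D 0 x‖ ^ 2 + ‖D 1 x‖ ^ 2 + ‖D 2 x‖ ^ 2 + ‖D 3 x‖ ^ 2 := by
  have : ‖x‖ ^ 2 = ∑ k : Fin 4, ‖D k x‖ ^ 2 := PiLp.norm_sq_eq_of_L2 _ x.1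
  rw [this, Fin.sum_univ_four]

/-- The arc as a stationary solution. -/
theorem isSolution_vR (L R : ℝ) :
    IsSolution L (arc R L) (vR L R) (fun _ => vR L R) where
  continuousOn := continuousOn_const
  equation := by
    refine ⟨fun _ => 0, continuousOn_const, fun t _ => hasDerivWithinAt_const _ _ _, fun t _ => ?_⟩
    filter_upwards [coeFn_vR L R 0, coeFn_vR L R 2, Lp.coeFn_zero E3 2 (volI L)] with s h1 h2 h3
    have e0 : D 0 (vR L R) s = arc R s := by rw [h1]; simp
    have e2 : D 2 (vR L R) s = -(R⁻¹ ^ 2) • arc R s := by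
      have e : ((2 : Fin 4) : ℕ) = 2 := rfl
      rw [h2, e, iteratedDeriv_two_arc]
    have ez : D 0 (0 : H L 1) s = 0 := h3
    rw [e0, e2, ez]
    refine ext3 ?_ ?_ ?_ <;>
    · simp only [cross_apply_zero, cross_apply_one, cross_apply_two, PiLp.smul_apply,
        PiLp.zero_apply, smul_eq_mul]
      ring
  initial := rfl
  boundary t _ := by
    refine ⟨arc R, ⟨(contDiff_arc R).continuous.continuousOn, ?_⟩, arc_zero R, rfl⟩
    filter_upwards [coeFn_vR L R 0] with s h1
    rw [h1]
    simp

theorem exists_uniform_constant {L κ μ : ℝ} (hL : 0 < L) (hκ : 0 ≤ κ) (hμ : 0 ≤ μ)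
    (hκμ : κ * μ < 1) :
    ∃ K : ℝ, 1 ≤ K ∧ L ≤ K ∧ 1 / L ≤ K ∧ κ ≤ K ∧ μ ≤ K ∧ 1 / (1 - κ * μ) ≤ K := by
  have p1 : 0 < 1 / L := by positivity
  have p3 : 0 < 1 / (1 - κ * μ) := one_div_pos.2 (by linarith)
  exact ⟨1 + L + 1 / L + κ + μ + 1 / (1 - κ * μ), by linarith, by linarith, by linarith,
    by linarith, by linarith, by linarith⟩

theorem le_of_sq_le_cubic {x K N : ℝ} (hK : 1 ≤ K) (hN : 0 ≤ N)
    (h : x ^ 2 ≤ (1500 * K ^ 5 * (N * (1 + N) ^ 2)) ^ 2) : x ≤ 3000 * K ^ 5 * (N + N ^ 3) := by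
  have hK0 : 0 ≤ K := by linarith
  calc x ≤ 1500 * K ^ 5 * (N * (1 + N) ^ 2) := (abs_le_of_sq_le_sq' h (by positivity)).2
    _ ≤ 1500 * K ^ 5 * (2 * (N + N ^ 3)) := by
        refine mul_le_mul_of_nonneg_left ?_ (by positivity)
        -- The square `N (1 - N)² ≥ 0` says `2 N² ≤ N + N³`.
        nlinarith [mul_nonneg hN (sq_nonneg (1 - N))]
    _ = _ := by ring

/-- Comparison of a flow with the arc at two positive times. -/
theorem IsFlow.norm_sub_le {L R ℓ K : ℝ} (hL : 0 < L) (hℓ : L < Real.pi * ℓ)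
    (hκμ : R⁻¹ ^ 2 * ℓ ^ 2 < 1) (hK1 : 1 ≤ K) (hKL : L ≤ K) (hKL' : 1 / L ≤ K)
    (hKκ : R⁻¹ ^ 2 ≤ K) (hKμ : ℓ ^ 2 ≤ K) (hKc : 1 / (1 - R⁻¹ ^ 2 * ℓ ^ 2) ≤ K)
    {v : ℝ → H L 3} {vt : ℝ → H L 1} (hf : IsFlow L e₁ (arc R L) v vt) {t₀ t : ℝ}
    (ht₀ : 0 < t₀) (ht : 0 < t) :
    ‖v t - vR L R‖ ≤ 3000 * K ^ 5 * (‖v t₀ - vR L R‖ + ‖v t₀ - vR L R‖ ^ 3) := by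
  obtain ⟨f₀, p₀, n₀, hr₀⟩ := hf.exists_isRep hL ht₀
  obtain ⟨f, p, n, hr⟩ := hf.exists_isRep hL ht
  obtain ⟨u₀, w₀, r₀, q₀, m₀, b₀, a₁, a₂, a₃⟩ := exists_staticBounds hL hℓ hr₀
  obtain ⟨u, w, r, q, m, b, b₁, b₂, b₃⟩ := exists_staticBounds hL hℓ hr
  have l₁ := hf.first_law hL ht ht₀
  have l₂ := hf.second_law hL ht ht₀
  have l₃ := hf.third_law hL ht ht₀
  rw [a₁, b₁] at l₁
  rw [a₂, b₂] at l₂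
  rw [a₃, b₃] at l₃
  have c₁ := add_left_cancel l₁
  rw [c₁] at l₂ l₃
  have c₂ : u - 1 / 4 * r = u₀ - 1 / 4 * r₀ := by
    -- By the first law the contribution of `∫ ρ` is the same at both times, so it cancels.
    generalize ‖D 1 (v t₀ - vR L R)‖ ^ 2 - R⁻¹ ^ 2 * ‖D 0 (v t₀ - vR L R)‖ ^ 2 = e at l₂
    linear_combination l₂
  have c₃ : w - 5 / 2 * m + 3 / 8 * R⁻¹ ^ 2 * r + 1 / 8 * q
      = w₀ - 5 / 2 * m₀ + 3 / 8 * R⁻¹ ^ 2 * r₀ + 1 / 8 * q₀ := by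
    generalize ‖D 1 (v t₀ - vR L R)‖ ^ 2 - R⁻¹ ^ 2 * ‖D 0 (v t₀ - vR L R)‖ ^ 2 = e at l₃
    linear_combination l₃
  refine le_of_sq_le_cubic hK1 (norm_nonneg _) ?_
  have key := energy_le_of_conserved hL (sq_nonneg _) hκμ hK1 hKL hKL' hKκ hKμ hKc
    (norm_nonneg _) (norm_sq_eq_sum (v t₀ - vR L R)) b₀ b c₁ c₂ c₃
  rwa [← norm_sq_eq_sum] at key

theorem IsFlow.exists_norm_sub_le {L R : ℝ} (hL : 0 < L) (hR : L / Real.pi < R) :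
    ∃ C : ℝ, 1 ≤ C ∧ ∀ (v : ℝ → H L 3) (vt : ℝ → H L 1), IsFlow L e₁ (arc R L) v vt →
      ∀ t₀ t : ℝ, 0 < t₀ → 0 < t →
        ‖v t - vR L R‖ ≤ C * (‖v t₀ - vR L R‖ + ‖v t₀ - vR L R‖ ^ 3) := by
  have hπ := Real.pi_pos
  have hR0 : 0 < R := lt_trans (by positivity) hR
  -- The strict gap leaves room on both sides: `poincare` needs `L < π ℓ`, and coercivity of the
  -- first law needs `ℓ < R`.
  obtain ⟨ℓ, h1, h2⟩ := exists_between hR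
  have hℓ0 : 0 < ℓ := lt_trans (by positivity) h1
  have hℓ : L < Real.pi * ℓ := by rwa [div_lt_iff₀ hπ, mul_comm] at h1
  have hκμ : R⁻¹ ^ 2 * ℓ ^ 2 < 1 := by
    rw [inv_pow, inv_mul_lt_iff₀ (by positivity), mul_one]
    gcongr
  obtain ⟨K, k1, k2, k3, k4, k5, k6⟩ :=
    exists_uniform_constant hL (sq_nonneg R⁻¹) (sq_nonneg ℓ) hκμ
  exact ⟨3000 * K ^ 5, by linarith [one_le_pow₀ k1 (n := 5)], fun v vt hf t₀ t ht₀ ht =>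
    hf.norm_sub_le hL hℓ hκμ k1 k2 k3 k4 k5 k6 ht₀ ht⟩

/-- The a priori bound for perturbations of the arc. -/
theorem exists_norm_sub_vR_le {L R : ℝ} (hL : 0 < L) (hR : L / Real.pi < R) :
    ∃ C : ℝ, 0 < C ∧ ∀ φ₀ : H L 3, Admissible L R φ₀ →
      ∀ v : ℝ → H L 3, IsSolution L (arc R L) (vR L R + φ₀) v →
        ∀ t : ℝ, 0 ≤ t → ‖v t - vR L R‖ ≤ C * (‖φ₀‖ + ‖φ₀‖ ^ 3) := by
  obtain ⟨C, hC, hb⟩ := IsFlow.exists_norm_sub_le hL hR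
  refine ⟨C, by linarith, fun φ₀ hφ v hv t ht => ?_⟩
  have h0 : v 0 - vR L R = φ₀ := by rw [hv.initial, add_sub_cancel_left]
  rcases ht.eq_or_lt with rfl | ht
  · rw [h0]
    have h1 := norm_nonneg φ₀
    have h3 : 0 ≤ ‖φ₀‖ ^ 3 := by positivity
    nlinarith
  · obtain ⟨vt, hf⟩ := hv.exists_isFlow hL hφ.unit
    have hn : Filter.Tendsto (fun τ => ‖v τ - vR L R‖) (nhdsWithin 0 (Ioi 0)) (nhds ‖φ₀‖) := by
      rw [← h0]
      exact (((hv.continuousOn 0 self_mem_Ici).tendsto.mono_left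
        (nhdsWithin_mono 0 Ioi_subset_Ici_self)).sub_const _).norm
    -- The constant does not depend on the comparison time, which may therefore tend to zero.
    refine ge_of_tendsto ((hn.add (hn.pow 3)).const_mul C) ?_
    filter_upwards [self_mem_nhdsWithin] with τ hτ
    exact hb v vt hf τ t hτ ht

/-- Smallness of the a priori bound. -/
theorem exists_forall_lt_of_bound (C : ℝ) {ε : ℝ} (hε : 0 < ε) :
    ∃ δ : ℝ, 0 < δ ∧ ∀ x : ℝ, 0 ≤ x → x < δ → C * (x + x ^ 3) < ε := by
  have hc : ContinuousAt (fun x : ℝ => C * (x + x ^ 3)) 0 := by fun_prop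
  have h0 : (fun x : ℝ => C * (x + x ^ 3)) 0 < ε := by simpa using hε
  obtain ⟨δ, hδ, h⟩ := Metric.eventually_nhds_iff.1 (hc.eventually (gt_mem_nhds h0))
  exact ⟨δ, hδ, fun x hx hxδ => h (by rwa [Real.dist_eq, sub_zero, abs_of_nonneg hx])⟩

end VFE

end

theorem mainTheorem4 (L R : ℝ) (hL : 0 < L) (hR : L / Real.pi < R) :
    VFE.IsSolution L (VFE.arc R L) (VFE.vR L R) (fun _ => VFE.vR L R) ∧
    (∃ C : ℝ, 0 < C ∧ ∀ φ₀ : VFE.H L 3, VFE.Admissible L R φ₀ →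
      ∀ v : ℝ → VFE.H L 3, VFE.IsSolution L (VFE.arc R L) (VFE.vR L R + φ₀) v →
        ∀ t : ℝ, 0 ≤ t → ‖v t - VFE.vR L R‖ ≤ C * (‖φ₀‖ + ‖φ₀‖ ^ 3)) ∧
    (∀ ε : ℝ, 0 < ε → ∃ δ : ℝ, 0 < δ ∧ ∀ φ₀ : VFE.H L 3, VFE.Admissible L R φ₀ → ‖φ₀‖ < δ →
      ∀ v : ℝ → VFE.H L 3, VFE.IsSolution L (VFE.arc R L) (VFE.vR L R + φ₀) v →
        ∀ t : ℝ, 0 ≤ t → ‖v t - VFE.vR L R‖ < ε) := by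
  have hb := VFE.exists_norm_sub_vR_le hL hR
  refine ⟨VFE.isSolution_vR L R, hb, fun ε hε => ?_⟩
  obtain ⟨C, hC, h⟩ := hb
  obtain ⟨δ, hδ, hlt⟩ := VFE.exists_forall_lt_of_bound C hε
  exact ⟨δ, hδ, fun φ₀ hφ hs v hv t ht => (h φ₀ hφ v hv t ht).trans_lt (hlt _ (norm_nonneg _) hs)⟩
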